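/- Let $\mathsf G$ be a smooth étale groupoid: a groupoid whose spaces $\mathsf G_0$ of objects and $\mathsf G_1$ of arrows are Hausdorff paracompact finite-dimensional smooth manifolds, whose structure maps are smooth, and whose source and target maps $s,t:\mathsf G_1\to\mathsf G_0$ are local diffeomorphisms. Assume that $\mathsf G$ is proper (the map $(s,t):\mathsf G_1\to\mathsf G_0\times\mathsf G_0$ is proper), that its orbit space $\mathsf G_0/\!\sim$ (where $s(a)\sim t(a)$ for every arrow $a$) is paracompact, and that $\mathsf G$ is Leray: for every $i\ge 0$ the manifold $\mathsf G_i$ of strings of $i$ composable arrows is a disjoint union of contractible open sets. For a sheaf $F$ among the following four, write $\Gamma(\mathsf G_i,F)$ for its sections over $\mathsf G_i$: the sheaf $\mathcal A^j$ of smooth real $j$-forms, the sheaf $\underline{U(1)}$ of smooth $U(1)$-valued functions, and the constant sheaves $\mathbb Z$ and $U(1)$ (locally constant functions). Let $\delta:\Gamma(\mathsf G_i,F)\to\Gamma(\mathsf G_{i+1},F)$ be the alternating sum of the pullbacks along the face maps of the nerve of $\mathsf G$. The cohomology groups $H^k(\mathsf G,\underline{U(1)})$, $H^k(\mathsf G,U(1))$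 and $H^k(\mathsf G,\mathbb Z)$ are the cohomology groups of the complexes $(\Gamma(\mathsf G_\bullet,F),\delta)$. For an integer $n\ge 1$, $H^k(\mathsf G,U(1)(n))$ is the $k$-th cohomology group of the total complex, with coboundary $\delta+(-1)^i d$, of the double complex with rows $$\Gamma(\mathsf G_i,\underline{U(1)})\xrightarrow{-\sqrt{-1}\,d\log}\Gamma(\mathsf G_i,\mathcal A^1)\xrightarrow{d}\cdots\xrightarrow{d}\Gamma(\mathsf G_i,\mathcal A^{n-1}),$$ and $H^k(\mathsf G,\mathbb Z(n))$ is defined in the same way by the double complex with rows $$\Gamma(\mathsf G_i,\mathbb Z)\hookrightarrow\Gamma(\mathsf G_i,\mathcal A^0)\xrightarrow{d}\Gamma(\mathsf G_i,\mathcal A^1)\xrightarrow{d}\cdots\xrightarrow{d}\Gamma(\mathsf G_i,\mathcal A^{n-1}).$$ Cohomology in negative degrees is $0$. Then, for every $n\ge 1$ and every $p\ge 0$: 1. $H^p(\mathsf G,\mathbb Z(n))\cong H^{p-1}(\mathsf G,U(1)(n))$. In particular $H^0(\mathsf G,\mathbb Z(n))=0$. For $p\ge 1$ the isomorphism is induced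 by the map of cochains that is $f\mapsto\exp(2\pi\sqrt{-1}f)$ on $\mathcal A^0$, multiplication by $2\pi$ on $\mathcal A^j$ for $j\ge1$, and zero on $\mathbb Z$. 2. If $p>n$, then $H^{p-1}(\mathsf G,U(1)(n))\cong H^{p-1}(\mathsf G,\underline{U(1)})\cong H^p(\mathsf G,\mathbb Z)$. The first isomorphism is induced by the projection to the component in $\Gamma(\mathsf G_{p-1},\underline{U(1)})$. The second one is the connecting homomorphism of the exponential sequence: it maps the class of $\exp(2\pi\sqrt{-1}f)$ to the class of $\delta f$ for every $f\in\Gamma(\mathsf G_{p-1},\mathcal A^0)$ for which $\delta f$ has locally constant integer values. 3. If $p<n$, then $H^{p-1}(\mathsf G,U(1))\cong H^{p-1}(\mathsf G,U(1)(n))$ for the constant coefficients $U(1)$; for $p\ge1$ the isomorphism is induced by the inclusion of $\Gamma(\mathsf G_{p-1},U(1))$ into $\Gamma(\mathsf G_{p-1},\underline{U(1)})$. -/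

import Mathlib

open Set Filter Topology
open scoped Manifold ContDiff

universe u

noncomputable section

section Forms

variable {E : Type*} [NormedAddCommGroup E] [NormedSpace ℝ E]
variable {M : Type u} [TopologicalSpace M] [ChartedSpace E M]
variable {N : Type u} [TopologicalSpace N] [ChartedSpace E N]
variable {P : Type u} [TopologicalSpace P] [ChartedSpace E P]

/-- A not necessarily smooth differential form of degree `k` on `M`: an alternating `k`-form on
every tangent space. (In Mathlib `TangentSpace 𝓘(ℝ, E) x` is `E` by definition.) -/
abbrev RawForm (E : Type*) [NormedAddCommGroup E] [NormedSpace ℝ E] (M : Type u) (k : ℕ) :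
    Type _ := M → E [⋀^Fin k]→L[ℝ] ℝ

/-- The differential of a map, as a map between the tangent spaces at `x` and at `f x`, both of
which are `E` by definition. -/
def dmap (E : Type*) [NormedAddCommGroup E] [NormedSpace ℝ E] {M N : Type*} [TopologicalSpace M]
    [ChartedSpace E M] [TopologicalSpace N] [ChartedSpace E N] (f : M → N) (x : M) : E →L[ℝ] E :=
  (mfderiv 𝓘(ℝ, E) 𝓘(ℝ, E) f x : TangentSpace 𝓘(ℝ, E) x →L[ℝ] TangentSpace 𝓘(ℝ, E) (f x))

/-- The coordinate expression of a form in the chart around `x₀`: its pullback along the inverse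
of that chart. -/
def RawForm.rep {k : ℕ} (α : RawForm E M k) (x₀ : M) : E → E [⋀^Fin k]→L[ℝ] ℝ := fun y =>
  (α ((chartAt E x₀).symm y)).compContinuousLinearMap (dmap E (chartAt E x₀).symm y)

/-- A form is smooth if all its coordinate expressions are smooth. -/
def RawForm.IsSmooth {k : ℕ} (α : RawForm E M k) : Prop :=
  ∀ x₀ : M, ContDiffOn ℝ ∞ (α.rep x₀) (chartAt E x₀).target

/-- The pullback `f^* α`. -/
def RawForm.pullback {k : ℕ} (f : M → N) (α : RawForm E N k) : RawForm E M k := fun x =>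
  (α (f x)).compContinuousLinearMap (dmap E f x)

/-- The exterior derivative, computed at each point in the chart around this point. -/
def RawForm.ext {k : ℕ} (α : RawForm E M k) : RawForm E M (k + 1) := fun x =>
  (extDeriv (α.rep x) (chartAt E x x)).compContinuousLinearMap (dmap E (chartAt E x) x)

lemma comp_cLM {k : ℕ} (a : E [⋀^Fin k]→L[ℝ] ℝ) (f g : E →L[ℝ] E) :
    (a.compContinuousLinearMap f).compContinuousLinearMap g =
      a.compContinuousLinearMap (f.comp g) := rfl

lemma dmap_comp {M N P : Type*} [TopologicalSpace M] [ChartedSpace E M] [TopologicalSpace N]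
    [ChartedSpace E N] [TopologicalSpace P] [ChartedSpace E P] {f : M → N} {g : N → P} {x : M}
    (hg : ContMDiffAt 𝓘(ℝ, E) 𝓘(ℝ, E) ∞ g (f x)) (hf : ContMDiffAt 𝓘(ℝ, E) 𝓘(ℝ, E) ∞ f x) :
    dmap E (g ∘ f) x = (dmap E g (f x)).comp (dmap E f x) :=
  mfderiv_comp x (hg.mdifferentiableAt (by simp)) (hf.mdifferentiableAt (by simp))

lemma dmap_id {M : Type*} [TopologicalSpace M] [ChartedSpace E M] (x : M) :
    dmap E (id : M → M) x = ContinuousLinearMap.id ℝ E := mfderiv_id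

lemma dmap_congr {M N : Type*} [TopologicalSpace M] [ChartedSpace E M] [TopologicalSpace N]
    [ChartedSpace E N] {f g : M → N} {x : M} (h : f =ᶠ[𝓝 x] g) : dmap E f x = dmap E g x := by
  unfold dmap
  rw [h.mfderiv_eq]

lemma dmap_eq_fderiv (f : E → E) (x : E) : dmap E f x = fderiv ℝ f x := mfderiv_eq_fderiv

lemma contMDiffAt_chartAt [IsManifold 𝓘(ℝ, E) ∞ M] (x₀ : M) {x : M}
    (hx : x ∈ (chartAt E x₀).source) :
    ContMDiffAt 𝓘(ℝ, E) 𝓘(ℝ, E) ∞ (chartAt E x₀) x :=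
  contMDiffAt_of_mem_maximalAtlas (IsManifold.chart_mem_maximalAtlas x₀) hx

lemma contMDiffAt_chartAt_symm [IsManifold 𝓘(ℝ, E) ∞ M] (x₀ : M) {y : E}
    (hy : y ∈ (chartAt E x₀).target) :
    ContMDiffAt 𝓘(ℝ, E) 𝓘(ℝ, E) ∞ (chartAt E x₀).symm y :=
  contMDiffAt_symm_of_mem_maximalAtlas (IsManifold.chart_mem_maximalAtlas x₀) hy

/-- The coordinate expression of a map. -/
def mapRep (f : M → N) (x₀ : M) (z₀ : N) : E → E :=
  fun y => chartAt E z₀ (f ((chartAt E x₀).symm y))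

lemma mapRep_contDiffAt [IsManifold 𝓘(ℝ, E) ∞ M] [IsManifold 𝓘(ℝ, E) ∞ N] {f : M → N} {x₀ : M}
    {z₀ : N} {y : E} (hy : y ∈ (chartAt E x₀).target)
    (hf : ContMDiffAt 𝓘(ℝ, E) 𝓘(ℝ, E) ∞ f ((chartAt E x₀).symm y))
    (hz : f ((chartAt E x₀).symm y) ∈ (chartAt E z₀).source) :
    ContDiffAt ℝ ∞ (mapRep f x₀ z₀) y := by
  rw [← contMDiffAt_iff_contDiffAt]
  exact ((contMDiffAt_chartAt z₀ hz).comp _ hf).comp _ (contMDiffAt_chartAt_symm x₀ hy)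

lemma mapRep_fderiv [IsManifold 𝓘(ℝ, E) ∞ M] [IsManifold 𝓘(ℝ, E) ∞ N] {f : M → N} {x₀ : M}
    {z₀ : N} {y : E} (hy : y ∈ (chartAt E x₀).target)
    (hf : ContMDiffAt 𝓘(ℝ, E) 𝓘(ℝ, E) ∞ f ((chartAt E x₀).symm y))
    (hz : f ((chartAt E x₀).symm y) ∈ (chartAt E z₀).source) :
    fderiv ℝ (mapRep f x₀ z₀) y =
      (dmap E (chartAt E z₀) (f ((chartAt E x₀).symm y))).comp
        ((dmap E f ((chartAt E x₀).symm y)).comp (dmap E (chartAt E x₀).symm y)) := by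
  rw [← dmap_eq_fderiv]
  have h1 := contMDiffAt_chartAt z₀ hz
  have h3 := contMDiffAt_chartAt_symm x₀ hy
  have h2 := dmap_comp (f := f ∘ (chartAt E x₀).symm) (x := y) h1 (hf.comp _ h3)
  rw [dmap_comp hf h3] at h2
  exact h2

lemma dmap_symm_comp_chart [IsManifold 𝓘(ℝ, E) ∞ M] (x₀ : M) {x : M}
    (hx : x ∈ (chartAt E x₀).source) :
    (dmap E (chartAt E x₀).symm (chartAt E x₀ x)).comp (dmap E (chartAt E x₀) x) =
      ContinuousLinearMap.id ℝ E := by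
  rw [← dmap_comp (contMDiffAt_chartAt_symm x₀ ((chartAt E x₀).map_source hx))
    (contMDiffAt_chartAt x₀ hx), ← dmap_id x]
  refine dmap_congr ?_
  filter_upwards [(chartAt E x₀).open_source.mem_nhds hx] with z hz
  exact (chartAt E x₀).left_inv hz

lemma rep_chart {k : ℕ} [IsManifold 𝓘(ℝ, E) ∞ M] (α : RawForm E M k) (x₀ : M) {x : M}
    (hx : x ∈ (chartAt E x₀).source) :
    (α.rep x₀ (chartAt E x₀ x)).compContinuousLinearMap (dmap E (chartAt E x₀) x) = α x := by
  unfold RawForm.rep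
  rw [comp_cLM, dmap_symm_comp_chart x₀ hx, (chartAt E x₀).left_inv hx]
  rfl

lemma RawForm.ext_of_rep {k : ℕ} [IsManifold 𝓘(ℝ, E) ∞ M] {α β : RawForm E M k}
    (h : ∀ x₀ : M, ∀ y ∈ (chartAt E x₀).target, α.rep x₀ y = β.rep x₀ y) : α = β := by
  funext x
  rw [← rep_chart α x (mem_chart_source E x), ← rep_chart β x (mem_chart_source E x),
    h x _ (mem_chart_target E x)]

lemma two_le_smooth : minSmoothness ℝ 2 ≤ (∞ : WithTop ℕ∞) := by
  rw [minSmoothness_of_isRCLikeNormedField]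
  exact WithTop.coe_le_coe.2 (le_top : (2 : ℕ∞) ≤ ⊤)

lemma rep_pullback {k : ℕ} [IsManifold 𝓘(ℝ, E) ∞ M] [IsManifold 𝓘(ℝ, E) ∞ N] {f : M → N}
    (α : RawForm E N k) {x₀ : M} {z₀ : N} {y : E} (hy : y ∈ (chartAt E x₀).target)
    (hf : ContMDiffAt 𝓘(ℝ, E) 𝓘(ℝ, E) ∞ f ((chartAt E x₀).symm y))
    (hz : f ((chartAt E x₀).symm y) ∈ (chartAt E z₀).source) :
    (α.pullback f).rep x₀ y = (α.rep z₀ (mapRep f x₀ z₀ y)).compContinuousLinearMap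
      (fderiv ℝ (mapRep f x₀ z₀) y) := by
  rw [mapRep_fderiv hy hf hz, ← comp_cLM]
  have h := rep_chart α z₀ hz
  unfold mapRep
  rw [h]
  rfl

lemma mapRep_eventually [IsManifold 𝓘(ℝ, E) ∞ M] {f : M → N} (hf : Continuous f) {x₀ : M}
    {z₀ : N} {y : E} (hy : y ∈ (chartAt E x₀).target)
    (hz : f ((chartAt E x₀).symm y) ∈ (chartAt E z₀).source) :
    ∀ᶠ y' in 𝓝 y, y' ∈ (chartAt E x₀).target ∧
      f ((chartAt E x₀).symm y') ∈ (chartAt E z₀).source := by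
  refine Filter.Eventually.and ((chartAt E x₀).open_target.mem_nhds hy) ?_
  exact (hf.continuousAt.comp ((chartAt E x₀).continuousAt_symm hy)).eventually
    ((chartAt E z₀).open_source.mem_nhds hz)

lemma IsSmooth.contDiffAt {k : ℕ} {α : RawForm E M k} (h : α.IsSmooth) {x₀ : M} {y : E}
    (hy : y ∈ (chartAt E x₀).target) : ContDiffAt ℝ ∞ (α.rep x₀) y :=
  (h x₀).contDiffAt ((chartAt E x₀).open_target.mem_nhds hy)

/-- Alternatization as a continuous linear map. -/
def altCLM (k : ℕ) :
    ContinuousMultilinearMap ℝ (fun _ : Fin k => E) ℝ →L[ℝ] E [⋀^Fin k]→L[ℝ] ℝ :=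
  LinearMap.mkContinuous
    { toFun := fun f => ContinuousMultilinearMap.alternatization f
      map_add' := fun f g => map_add _ f g
      map_smul' := fun c f => by
        ext v
        simp only [ContinuousMultilinearMap.alternatization_apply_apply,
          _root_.smul_apply, ContinuousAlternatingMap.smul_apply,
          RingHom.id_apply, Finset.smul_sum]
        exact Finset.sum_congr rfl fun s _ => smul_comm _ _ _ }
    (Fintype.card (Equiv.Perm (Fin k))) (fun f => by
      refine ContinuousAlternatingMap.opNorm_le_bound _
        (mul_nonneg (Nat.cast_nonneg _) (norm_nonneg f)) fun v => ?_
      simp only [LinearMap.coe_mk, AddHom.coe_mk,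
        ContinuousMultilinearMap.alternatization_apply_apply]
      refine (norm_sum_le _ _).trans ?_
      have : ∀ s ∈ (Finset.univ : Finset (Equiv.Perm (Fin k))),
          ‖Equiv.Perm.sign s • f (v ∘ s)‖ ≤ ‖f‖ * ∏ i, ‖v i‖ := by
        intro s _
        have h1 : ‖Equiv.Perm.sign s • f (v ∘ s)‖ = ‖f (v ∘ s)‖ := by
          rcases Int.units_eq_one_or (Equiv.Perm.sign s) with h | h <;> simp [h]
        rw [h1]
        refine (f.le_opNorm _).trans (le_of_eq ?_)
        simp only [Function.comp_apply]
        rw [Equiv.prod_comp s (fun i => ‖v i‖)]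
      refine (Finset.sum_le_card_nsmul _ _ _ this).trans (le_of_eq ?_)
      rw [nsmul_eq_mul, Finset.card_univ, mul_assoc])

lemma altCLM_apply (k : ℕ) (f : ContinuousMultilinearMap ℝ (fun _ : Fin k => E) ℝ)
    (v : Fin k → E) : altCLM k f v = ∑ s : Equiv.Perm (Fin k), Equiv.Perm.sign s • f (v ∘ s) := by
  simp [altCLM, ContinuousMultilinearMap.alternatization_apply_apply]

lemma contDiffAt_compCLM {k : ℕ} {a : E → E [⋀^Fin k]→L[ℝ] ℝ} {g : E → E →L[ℝ] E} {y : E}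
    (ha : ContDiffAt ℝ ∞ a y) (hg : ContDiffAt ℝ ∞ g y) :
    ContDiffAt ℝ ∞ (fun y => (a y).compContinuousLinearMap (g y)) y := by
  have h0 : ContDiffAt ℝ ∞ (fun p : (Fin k → E →L[ℝ] E) × ContinuousMultilinearMap ℝ
      (fun _ : Fin k => E) ℝ => p.2.compContinuousLinearMap p.1)
      ((fun _ => g y), (a y).toContinuousMultilinearMap) :=
    ContinuousMultilinearMap.analyticAt_uncurry_compContinuousLinearMap.contDiffAt
  have h1 : ContDiffAt ℝ ∞ (fun y => (a y).toContinuousMultilinearMap.compContinuousLinearMap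
      (fun _ => g y)) y := by
    have h5 : ContDiffAt ℝ ∞ (fun y => (a y).toContinuousMultilinearMap) y :=
      (((ContinuousAlternatingMap.toContinuousMultilinearMapCLM ℝ :
        E [⋀^Fin k]→L[ℝ] ℝ →L[ℝ] ContinuousMultilinearMap ℝ (fun _ : Fin k => E) ℝ).contDiff
          (n := ∞)).contDiffAt (x := a y)).comp y ha
    have h6 : ContDiffAt ℝ ∞ (fun y => ((fun _ : Fin k => g y),
        (a y).toContinuousMultilinearMap)) y := (contDiffAt_pi.2 fun _ => hg).prodMk h5
    exact ContDiffAt.comp y h0 h6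
  have h2 := ((((k.factorial : ℝ)⁻¹) • altCLM (E := E) k).contDiff (n := ∞)).contDiffAt.comp y h1
  refine h2.congr_of_eventuallyEq (Eventually.of_forall fun z => ?_)
  ext v
  simp only [Function.comp_apply, _root_.smul_apply,
    ContinuousAlternatingMap.smul_apply, altCLM_apply]
  have h3 : ∀ s : Equiv.Perm (Fin k), Equiv.Perm.sign s •
      (a z).compContinuousLinearMap (g z) (v ∘ s) = (a z).compContinuousLinearMap (g z) v := by
    intro s
    have := ((a z).compContinuousLinearMap (g z)).toAlternatingMap.map_perm v s
    refine (congrArg (fun r => Equiv.Perm.sign s • r) this).trans ?_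
    rw [smul_smul, Int.units_mul_self, one_smul]
    rfl
  have h4 := Finset.sum_congr (s₁ := Finset.univ) rfl fun s _ => h3 s
  rw [Finset.sum_const, Finset.card_univ, Fintype.card_perm, Fintype.card_fin] at h4
  refine Eq.trans ?_ (congrArg (fun r => ((k.factorial : ℝ)⁻¹) • r) h4.symm)
  have : (k.factorial : ℝ) ≠ 0 := by positivity
  simp only [nsmul_eq_mul, smul_eq_mul]
  field_simp

lemma IsSmooth.pullback {k : ℕ} [IsManifold 𝓘(ℝ, E) ∞ M] [IsManifold 𝓘(ℝ, E) ∞ N] {f : M → N}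
    (hf : ContMDiff 𝓘(ℝ, E) 𝓘(ℝ, E) ∞ f) {α : RawForm E N k} (h : α.IsSmooth) :
    (α.pullback f).IsSmooth := by
  intro x₀ y hy
  set z₀ := f ((chartAt E x₀).symm y)
  have hz : f ((chartAt E x₀).symm y) ∈ (chartAt E z₀).source := mem_chart_source E z₀
  refine ContDiffAt.contDiffWithinAt ?_
  have hm := mapRep_contDiffAt hy hf.contMDiffAt hz
  have h1 : ContDiffAt ℝ ∞ (fun y => α.rep z₀ (mapRep f x₀ z₀ y)) y :=
    ContDiffAt.comp (g := α.rep z₀) y (IsSmooth.contDiffAt h ((chartAt E z₀).map_source hz)) hm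
  have h2 : ContDiffAt ℝ ∞ (fderiv ℝ (mapRep f x₀ z₀)) y := hm.fderiv_right (by simp)
  refine (contDiffAt_compCLM h1 h2).congr_of_eventuallyEq ?_
  filter_upwards [mapRep_eventually hf.continuous hy hz] with y' hy'
  exact rep_pullback α hy'.1 hf.contMDiffAt hy'.2

lemma extDeriv_rep_pullback {k : ℕ} [IsManifold 𝓘(ℝ, E) ∞ M] [IsManifold 𝓘(ℝ, E) ∞ N] {f : M → N}
    (hf : ContMDiff 𝓘(ℝ, E) 𝓘(ℝ, E) ∞ f) {α : RawForm E N k} (h : α.IsSmooth)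
    {x₀ : M} {z₀ : N} {y : E} (hy : y ∈ (chartAt E x₀).target)
    (hz : f ((chartAt E x₀).symm y) ∈ (chartAt E z₀).source) :
    extDeriv ((α.pullback f).rep x₀) y =
      (extDeriv (α.rep z₀) (mapRep f x₀ z₀ y)).compContinuousLinearMap
        (fderiv ℝ (mapRep f x₀ z₀) y) := by
  have he : (α.pullback f).rep x₀ =ᶠ[𝓝 y] fun y =>
      (α.rep z₀ (mapRep f x₀ z₀ y)).compContinuousLinearMap (fderiv ℝ (mapRep f x₀ z₀) y) := by
    filter_upwards [mapRep_eventually hf.continuous hy hz] with y' hy'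
    exact rep_pullback α hy'.1 hf.contMDiffAt hy'.2
  rw [he.extDeriv_eq]
  exact extDeriv_pullback
    ((IsSmooth.contDiffAt h ((chartAt E z₀).map_source hz)).differentiableAt (by simp))
    (mapRep_contDiffAt hy hf.contMDiffAt hz) two_le_smooth

lemma RawForm.pullback_id {k : ℕ} (α : RawForm E M k) : α.pullback id = α := by
  funext x
  unfold RawForm.pullback
  rw [dmap_id]
  rfl

/-- The exterior derivative is given by the usual formula in every chart. -/
lemma rep_ext {k : ℕ} [IsManifold 𝓘(ℝ, E) ∞ M] {α : RawForm E M k} (h : α.IsSmooth) {x₀ : M}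
    {y : E} (hy : y ∈ (chartAt E x₀).target) : α.ext.rep x₀ y = extDeriv (α.rep x₀) y := by
  have hz : id ((chartAt E x₀).symm y) ∈ (chartAt E ((chartAt E x₀).symm y)).source :=
    mem_chart_source E _
  have h1 := extDeriv_rep_pullback (f := (id : M → M)) contMDiff_id h hy hz
  rw [RawForm.pullback_id, mapRep_fderiv hy contMDiffAt_id hz, dmap_id] at h1
  rw [h1]
  rfl

lemma IsSmooth.ext {k : ℕ} [IsManifold 𝓘(ℝ, E) ∞ M] {α : RawForm E M k} (h : α.IsSmooth) :
    α.ext.IsSmooth := by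
  intro x₀ y hy
  refine ContDiffAt.contDiffWithinAt ?_
  have h1 : ContDiffAt ℝ ∞ (extDeriv (α.rep x₀)) y := by
    have h2 : ContDiffAt ℝ ∞ (fderiv ℝ (α.rep x₀)) y :=
      (IsSmooth.contDiffAt h hy).fderiv_right (by simp)
    exact (ContinuousAlternatingMap.alternatizeUncurryFinCLM ℝ E ℝ).contDiff.contDiffAt.comp y h2
  refine h1.congr_of_eventuallyEq ?_
  filter_upwards [(chartAt E x₀).open_target.mem_nhds hy] with y' hy'
  exact rep_ext h hy'

lemma RawForm.ext_ext {k : ℕ} [IsManifold 𝓘(ℝ, E) ∞ M] {α : RawForm E M k} (h : α.IsSmooth) :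
    α.ext.ext = 0 := by
  refine RawForm.ext_of_rep fun x₀ y hy => ?_
  rw [rep_ext (IsSmooth.ext h) hy]
  have he : α.ext.rep x₀ =ᶠ[𝓝 y] extDeriv (α.rep x₀) := by
    filter_upwards [(chartAt E x₀).open_target.mem_nhds hy] with y' hy'
    exact rep_ext h hy'
  rw [he.extDeriv_eq, extDeriv_extDeriv_apply (IsSmooth.contDiffAt h hy) two_le_smooth]
  rfl

lemma RawForm.ext_pullback {k : ℕ} [IsManifold 𝓘(ℝ, E) ∞ M] [IsManifold 𝓘(ℝ, E) ∞ N] {f : M → N}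
    (hf : ContMDiff 𝓘(ℝ, E) 𝓘(ℝ, E) ∞ f) {α : RawForm E N k} (h : α.IsSmooth) :
    (α.pullback f).ext = α.ext.pullback f := by
  refine RawForm.ext_of_rep fun x₀ y hy => ?_
  have hz : f ((chartAt E x₀).symm y) ∈ (chartAt E (f ((chartAt E x₀).symm y))).source :=
    mem_chart_source E _
  rw [rep_ext (IsSmooth.pullback hf h) hy, extDeriv_rep_pullback hf h hy hz,
    rep_pullback _ hy hf.contMDiffAt hz, mapRep, rep_ext h ((chartAt E _).map_source hz)]

lemma RawForm.pullback_comp {k : ℕ} {f : M → N} {g : N → P}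
    (hf : ContMDiff 𝓘(ℝ, E) 𝓘(ℝ, E) ∞ f) (hg : ContMDiff 𝓘(ℝ, E) 𝓘(ℝ, E) ∞ g)
    (α : RawForm E P k) : (α.pullback g).pullback f = α.pullback (g ∘ f) := by
  funext x
  unfold RawForm.pullback
  rw [dmap_comp hg.contMDiffAt hf.contMDiffAt, comp_cLM]
  rfl


lemma rep_add {k : ℕ} (α β : RawForm E M k) (x₀ : M) : (α + β).rep x₀ = α.rep x₀ + β.rep x₀ := rfl

lemma rep_neg {k : ℕ} (α : RawForm E M k) (x₀ : M) : (-α).rep x₀ = -α.rep x₀ := rfl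

lemma rep_smul {k : ℕ} (c : ℝ) (α : RawForm E M k) (x₀ : M) : (c • α).rep x₀ = c • α.rep x₀ := rfl

/-- The group `Ω^k(M)` of smooth differential forms of degree `k` on `M`. -/
def smoothForms (E : Type*) [NormedAddCommGroup E] [NormedSpace ℝ E] (M : Type u)
    [TopologicalSpace M] [ChartedSpace E M] (k : ℕ) : AddSubgroup (RawForm E M k) where
  carrier := {α | α.IsSmooth}
  add_mem' {α β} hα hβ := fun x₀ => by
    rw [rep_add]
    exact (hα x₀).add (hβ x₀)
  zero_mem' := fun x₀ => by
    have h : RawForm.rep (0 : RawForm E M k) x₀ = fun _ => 0 := rfl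
    rw [h]
    exact contDiffOn_const
  neg_mem' {α} hα := fun x₀ => by
    rw [rep_neg]
    exact (hα x₀).neg

/-- Smooth differential forms of degree `k` on `M`. -/
abbrev DiffForm (E : Type*) [NormedAddCommGroup E] [NormedSpace ℝ E] (M : Type u)
    [TopologicalSpace M] [ChartedSpace E M] (k : ℕ) : Type _ := smoothForms E M k

lemma DiffForm.smooth {k : ℕ} (α : DiffForm E M k) : RawForm.IsSmooth α.1 := α.2

lemma RawForm.ext_zero {k : ℕ} [IsManifold 𝓘(ℝ, E) ∞ M] :
    RawForm.ext (0 : RawForm E M k) = 0 := by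
  refine RawForm.ext_of_rep fun x₀ y hy => ?_
  have h : RawForm.IsSmooth (0 : RawForm E M k) := (smoothForms E M k).zero_mem
  have h0 : RawForm.rep (0 : RawForm E M k) x₀ = (0 : ℝ) • RawForm.rep (0 : RawForm E M k) x₀ := by
    rw [zero_smul]
    rfl
  rw [rep_ext h hy, h0, extDeriv_smul, zero_smul]
  rfl

lemma RawForm.ext_add {k : ℕ} [IsManifold 𝓘(ℝ, E) ∞ M] {α β : RawForm E M k} (hα : α.IsSmooth)
    (hβ : β.IsSmooth) : (α + β).ext = α.ext + β.ext := by
  refine RawForm.ext_of_rep fun x₀ y hy => ?_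
  have h : (α + β).IsSmooth := (smoothForms E M k).add_mem hα hβ
  rw [rep_ext h hy, rep_add, rep_add, Pi.add_apply, rep_ext hα hy, rep_ext hβ hy]
  exact extDeriv_add ((IsSmooth.contDiffAt hα hy).differentiableAt (by simp))
    ((IsSmooth.contDiffAt hβ hy).differentiableAt (by simp))

lemma RawForm.IsSmooth.const_smul {k : ℕ} {α : RawForm E M k} (hα : α.IsSmooth) (c : ℝ) :
    (c • α).IsSmooth := fun x₀ => by
  rw [rep_smul]
  exact contDiffOn_const.smul (hα x₀)

lemma RawForm.ext_smul {k : ℕ} [IsManifold 𝓘(ℝ, E) ∞ M] {α : RawForm E M k} (hα : α.IsSmooth)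
    (c : ℝ) : (c • α).ext = c • α.ext := by
  refine RawForm.ext_of_rep fun x₀ y hy => ?_
  rw [rep_ext (hα.const_smul c) hy, rep_smul, rep_smul, Pi.smul_apply, rep_ext hα hy]
  exact extDeriv_smul c _

/-- The exterior derivative `Ω^k(M) → Ω^{k+1}(M)`. -/
def DiffForm.d [IsManifold 𝓘(ℝ, E) ∞ M] (k : ℕ) : DiffForm E M k →+ DiffForm E M (k + 1) where
  toFun α := ⟨RawForm.ext α.1, IsSmooth.ext α.smooth⟩
  map_zero' := Subtype.ext RawForm.ext_zero
  map_add' α β := Subtype.ext (RawForm.ext_add α.smooth β.smooth)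

/-- The pullback of smooth forms along a smooth map. -/
def DiffForm.pullback [IsManifold 𝓘(ℝ, E) ∞ M] [IsManifold 𝓘(ℝ, E) ∞ N]
    (f : C^∞⟮𝓘(ℝ, E), M; 𝓘(ℝ, E), N⟯) (k : ℕ) : DiffForm E N k →+ DiffForm E M k where
  toFun α := ⟨RawForm.pullback f α.1, IsSmooth.pullback f.contMDiff α.smooth⟩
  map_zero' := rfl
  map_add' _ _ := rfl

/-- Multiplication of a smooth form by a real constant. -/
def DiffForm.scale (c : ℝ) (k : ℕ) : DiffForm E M k →+ DiffForm E M k where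
  toFun α := ⟨c • α.1, α.smooth.const_smul c⟩
  map_zero' := Subtype.ext (smul_zero c)
  map_add' _ _ := Subtype.ext (smul_add c _ _)

lemma DiffForm.d_d [IsManifold 𝓘(ℝ, E) ∞ M] {k : ℕ} (α : DiffForm E M k) :
    DiffForm.d (k + 1) (DiffForm.d k α) = 0 :=
  Subtype.ext (RawForm.ext_ext α.smooth)

lemma DiffForm.d_pullback [IsManifold 𝓘(ℝ, E) ∞ M] [IsManifold 𝓘(ℝ, E) ∞ N]
    (f : C^∞⟮𝓘(ℝ, E), M; 𝓘(ℝ, E), N⟯) {k : ℕ} (α : DiffForm E N k) :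
    DiffForm.d k (DiffForm.pullback f k α) = DiffForm.pullback f (k + 1) (DiffForm.d k α) :=
  Subtype.ext (RawForm.ext_pullback f.contMDiff α.smooth)

lemma DiffForm.pullback_comp [IsManifold 𝓘(ℝ, E) ∞ M] [IsManifold 𝓘(ℝ, E) ∞ N]
    [IsManifold 𝓘(ℝ, E) ∞ P] (f : C^∞⟮𝓘(ℝ, E), M; 𝓘(ℝ, E), N⟯)
    (g : C^∞⟮𝓘(ℝ, E), N; 𝓘(ℝ, E), P⟯) {k : ℕ} (α : DiffForm E P k) :
    DiffForm.pullback f k (DiffForm.pullback g k α) = DiffForm.pullback (g.comp f) k α :=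
  Subtype.ext (RawForm.pullback_comp f.contMDiff g.contMDiff α.1)

/-- The function underlying a form of degree `0`. -/
def DiffForm.eval (f : DiffForm E M 0) (x : M) : ℝ := f.1 x ![]

lemma DiffForm.eval_contMDiff [IsManifold 𝓘(ℝ, E) ∞ M] (f : DiffForm E M 0) :
    ContMDiff 𝓘(ℝ, E) 𝓘(ℝ, ℝ) ∞ f.eval := by
  intro x
  have h1 : ContMDiffAt 𝓘(ℝ, E) 𝓘(ℝ, ℝ) ∞
      ((fun y => RawForm.rep f.1 x y ![]) ∘ chartAt E x) x := by
    refine ContMDiffAt.comp x (ContDiffAt.contMDiffAt ?_)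
      (contMDiffAt_chartAt x (mem_chart_source E x))
    have h := IsSmooth.contDiffAt f.smooth (mem_chart_target E x)
    exact ((ContinuousAlternatingMap.apply ℝ E ℝ (![] : Fin 0 → E)).contDiff (n := ∞)).contDiffAt.comp
      (chartAt E x x) h
  refine h1.congr_of_eventuallyEq ?_
  filter_upwards [(chartAt E x).open_source.mem_nhds (mem_chart_source E x)] with z hz
  simp only [DiffForm.eval, Function.comp_apply, RawForm.rep]
  rw [(chartAt E x).left_inv hz]
  simp only [ContinuousAlternatingMap.compContinuousLinearMap_apply]
  congr 1
  exact Subsingleton.elim _ _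

/-- A locally constant integer valued function, as a form of degree `0`. -/
def intForm (z : LocallyConstant M ℤ) : RawForm E M 0 := fun x =>
  ContinuousAlternatingMap.constOfIsEmpty ℝ E (Fin 0) (z x : ℝ)

lemma rep_intForm (z : LocallyConstant M ℤ) {x₀ : M} {y : E} (hy : y ∈ (chartAt E x₀).target) :
    RawForm.rep (intForm z : RawForm E M 0) x₀ =ᶠ[𝓝 y] fun _ =>
      ContinuousAlternatingMap.constOfIsEmpty ℝ E (Fin 0) (z ((chartAt E x₀).symm y) : ℝ) := by
  have h := ((chartAt E x₀).continuousAt_symm hy).eventually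
    (z.isLocallyConstant.eventually_eq ((chartAt E x₀).symm y))
  filter_upwards [h] with y' hy'
  have hy2 : z ((chartAt E x₀).symm y') = z ((chartAt E x₀).symm y) := hy'
  ext v
  simp [RawForm.rep, intForm, hy2]

lemma intForm_smooth (z : LocallyConstant M ℤ) : (intForm z : RawForm E M 0).IsSmooth :=
  fun _ _ hy => (contDiffAt_const.congr_of_eventuallyEq (rep_intForm z hy)).contDiffWithinAt

/-- The inclusion of the locally constant integer valued functions into the smooth functions,
which are the forms of degree `0`. -/
def DiffForm.ofInt : LocallyConstant M ℤ →+ DiffForm E M 0 where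
  toFun z := ⟨intForm z, intForm_smooth z⟩
  map_zero' := by
    refine Subtype.ext (funext fun x => ?_)
    ext v
    simp [intForm]
  map_add' z w := by
    refine Subtype.ext (funext fun x => ?_)
    ext v
    simp [intForm]

lemma DiffForm.ofInt_pullback [IsManifold 𝓘(ℝ, E) ∞ M] [IsManifold 𝓘(ℝ, E) ∞ N]
    (f : C^∞⟮𝓘(ℝ, E), M; 𝓘(ℝ, E), N⟯) (z : LocallyConstant N ℤ) :
    DiffForm.pullback f 0 (DiffForm.ofInt z) =
      DiffForm.ofInt (z.comap ⟨f, f.contMDiff.continuous⟩) := by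
  refine Subtype.ext (funext fun x => ?_)
  ext v
  rfl

lemma DiffForm.d_ofInt [IsManifold 𝓘(ℝ, E) ∞ M] (z : LocallyConstant M ℤ) :
    DiffForm.d 0 (DiffForm.ofInt z : DiffForm E M 0) = 0 := by
  refine Subtype.ext (RawForm.ext_of_rep fun x₀ y hy => ?_)
  change RawForm.rep (RawForm.ext (intForm z : RawForm E M 0)) x₀ y = 0
  rw [rep_ext (intForm_smooth z) hy, (rep_intForm z hy).extDeriv_eq, extDeriv_constOfIsEmpty]
  ext v
  simp

/-- The group of smooth functions on `M` with values in `U(1)`, written additively. -/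
abbrev SmoothU1 (E : Type*) [NormedAddCommGroup E] [NormedSpace ℝ E] (M : Type u)
    [TopologicalSpace M] [ChartedSpace E M] : Type _ :=
  Additive C^∞⟮𝓘(ℝ, E), M; 𝓡 1, Circle⟯

/-- The differential of a function with values in `U(1) ⊆ ℂ`. -/
def circleDiff (g : M → Circle) (x : M) : E →L[ℝ] ℂ :=
  (mfderiv 𝓘(ℝ, E) 𝓘(ℝ, ℂ) (fun y => (g y : ℂ)) x :
    TangentSpace 𝓘(ℝ, E) x →L[ℝ] TangentSpace 𝓘(ℝ, ℂ) (g x : ℂ))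

/-- The `1`-form `-√-1 g⁻¹ dg`, which takes real values. -/
def dlogRaw (g : M → Circle) : RawForm E M 1 := fun x =>
  ContinuousAlternatingMap.ofSubsingleton ℝ E ℝ (0 : Fin 1)
    (Complex.reCLM.comp ((-Complex.I * (g x : ℂ)⁻¹) • circleDiff g x))


lemma coe_circle_contMDiff (g : C^∞⟮𝓘(ℝ, E), M; 𝓡 1, Circle⟯) :
    ContMDiff 𝓘(ℝ, E) 𝓘(ℝ, ℂ) ∞ (fun y => (g y : ℂ)) := by
  have : Fact (Module.finrank ℝ ℂ = 1 + 1) := finrank_real_complex_fact'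
  exact (contMDiff_coe_sphere (E := ℂ) (n := 1) (m := ∞)).comp g.contMDiff

/-- Locally a smooth function with values in `U(1)` has a smooth logarithm: in a chart it has the
form `exp(√-1 F)`. -/
lemma exists_log (g : C^∞⟮𝓘(ℝ, E), M; 𝓡 1, Circle⟯) [IsManifold 𝓘(ℝ, E) ∞ M] {x₀ : M} {y : E}
    (hy : y ∈ (chartAt E x₀).target) : ∃ F : E → ℝ, ContDiffAt ℝ ∞ F y ∧
      ∀ᶠ y' in 𝓝 y, (g ((chartAt E x₀).symm y') : ℂ) = Complex.exp (F y' * Complex.I) := by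
  have hG : ContDiffAt ℝ ∞ (fun y' => (g ((chartAt E x₀).symm y') : ℂ)) y := by
    rw [← contMDiffAt_iff_contDiffAt]
    exact (coe_circle_contMDiff g).contMDiffAt.comp y (contMDiffAt_chartAt_symm x₀ hy)
  set c : Circle := g ((chartAt E x₀).symm y) with hc
  have hG2 : ContDiffAt ℝ ∞ (fun y' => (c : ℂ)⁻¹ * (g ((chartAt E x₀).symm y') : ℂ)) y :=
    contDiffAt_const.mul hG
  have h1 : (c : ℂ)⁻¹ * (g ((chartAt E x₀).symm y) : ℂ) = 1 := by
    rw [← hc]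
    exact inv_mul_cancel₀ (Circle.coe_ne_zero c)
  have hlog : ContDiffAt ℝ ∞ Complex.log ((c : ℂ)⁻¹ * (g ((chartAt E x₀).symm y) : ℂ)) := by
    rw [h1]
    exact (Complex.contDiffAt_log (n := ∞) Complex.one_mem_slitPlane).restrict_scalars ℝ
  have hL := ContDiffAt.comp (g := Complex.log) y hlog hG2
  refine ⟨fun y' => Complex.arg c + Complex.imCLM
    (Complex.log ((c : ℂ)⁻¹ * (g ((chartAt E x₀).symm y') : ℂ))), ?_, ?_⟩
  · exact contDiffAt_const.add ((Complex.imCLM.contDiff (n := ∞)).contDiffAt.comp y hL)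
  · refine Eventually.of_forall fun y' => ?_
    have h3 : ∀ a : ℂ, ‖a‖ = 1 → Complex.exp (Complex.arg a * Complex.I) = a := by
      intro a ha
      have := Complex.norm_mul_exp_arg_mul_I a
      rwa [ha, Complex.ofReal_one, one_mul] at this
    have hc1 : ‖(c : ℂ)‖ = 1 := Circle.norm_coe c
    have h4 : ‖(c : ℂ)⁻¹ * (g ((chartAt E x₀).symm y') : ℂ)‖ = 1 := by
      rw [norm_mul, norm_inv, hc1, Circle.norm_coe]
      norm_num
    simp only [Complex.imCLM_apply, Complex.log_im]
    push_cast
    rw [add_mul, Complex.exp_add, h3 _ hc1, h3 _ h4, ← mul_assoc,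
      mul_inv_cancel₀ (Circle.coe_ne_zero c), one_mul]

lemma rep_dlogRaw [IsManifold 𝓘(ℝ, E) ∞ M] (g : C^∞⟮𝓘(ℝ, E), M; 𝓡 1, Circle⟯) {x₀ : M} {y : E}
    (hy : y ∈ (chartAt E x₀).target) {F : E → ℝ} (hF : DifferentiableAt ℝ F y)
    (h : ∀ᶠ y' in 𝓝 y, (g ((chartAt E x₀).symm y') : ℂ) = Complex.exp (F y' * Complex.I)) :
    RawForm.rep (dlogRaw g : RawForm E M 1) x₀ y =
      ContinuousAlternatingMap.ofSubsingleton ℝ E ℝ (0 : Fin 1) (fderiv ℝ F y) := by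
  have h1 : ((circleDiff g ((chartAt E x₀).symm y)).comp (dmap E (chartAt E x₀).symm y) :
      E →L[ℝ] ℂ) = fderiv ℝ (fun y' => (g ((chartAt E x₀).symm y') : ℂ)) y := by
    rw [← mfderiv_eq_fderiv]
    exact (mfderiv_comp y ((coe_circle_contMDiff g).contMDiffAt.mdifferentiableAt (by simp))
      ((contMDiffAt_chartAt_symm x₀ hy).mdifferentiableAt (by simp))).symm
  have h2 : HasFDerivAt (fun y' => Complex.exp (F y' * Complex.I))
      (Complex.exp (F y * Complex.I) • ((Complex.ofRealCLM.comp (fderiv ℝ F y)).smulRight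
        Complex.I)) y := by
    have hF' := hF.hasFDerivAt
    have h3 := (Complex.ofRealCLM.hasFDerivAt.comp y hF').mul_const Complex.I
    refine (h3.cexp).congr_fderiv ?_
    ext v
    simp
    ring
  have h3 := h2.congr_of_eventuallyEq h
  rw [h3.fderiv] at h1
  ext v
  have h4 := DFunLike.congr_fun h1 (v 0)
  simp only [ContinuousLinearMap.comp_apply] at h4
  simp only [RawForm.rep, dlogRaw, ContinuousAlternatingMap.compContinuousLinearMap_apply,
    ContinuousAlternatingMap.ofSubsingleton_apply_apply, ContinuousLinearMap.comp_apply,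
    Function.comp_apply, _root_.smul_apply, h4, h.self_of_nhds]
  have h5 : Complex.exp (F y * Complex.I) ≠ 0 := Complex.exp_ne_zero _
  simp only [ContinuousLinearMap.smulRight_apply, ContinuousLinearMap.comp_apply, smul_eq_mul,
    Complex.ofRealCLM_apply, Complex.reCLM_apply]
  rw [show -Complex.I * (Complex.exp (F y * Complex.I))⁻¹ * (Complex.exp (F y * Complex.I) *
    (((fderiv ℝ F y) (v 0) : ℂ) * Complex.I)) = (fderiv ℝ F y) (v 0) by
      field_simp
      rw [Complex.I_sq]
      ring]
  exact Complex.ofReal_re _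

lemma rep_dlogRaw_eventually [IsManifold 𝓘(ℝ, E) ∞ M] (g : C^∞⟮𝓘(ℝ, E), M; 𝓡 1, Circle⟯)
    {x₀ : M} {y : E} (hy : y ∈ (chartAt E x₀).target) :
    ∃ F : E → ℝ, ContDiffAt ℝ ∞ F y ∧ RawForm.rep (dlogRaw g : RawForm E M 1) x₀ =ᶠ[𝓝 y]
      extDeriv fun y' => ContinuousAlternatingMap.constOfIsEmpty ℝ E (Fin 0) (F y') := by
  obtain ⟨F, hF, h⟩ := exists_log g hy
  refine ⟨F, hF, ?_⟩
  have h1 : ∀ᶠ y' in 𝓝 y, ContDiffAt ℝ 1 F y' :=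
    (hF.of_le (by exact WithTop.coe_le_coe.2 (le_top : (1 : ℕ∞) ≤ ⊤))).eventually (by simp)
  filter_upwards [h1, h.eventually_nhds, (chartAt E x₀).open_target.mem_nhds hy] with y' h1 h2 h3
  rw [rep_dlogRaw g h3 (h1.differentiableAt (by simp)) h2, extDeriv_constOfIsEmpty]

lemma contDiffAt_extDeriv {k : ℕ} {a : E → E [⋀^Fin k]→L[ℝ] ℝ} {y : E}
    (h : ContDiffAt ℝ ∞ a y) : ContDiffAt ℝ ∞ (extDeriv a) y := by
  have h2 : ContDiffAt ℝ ∞ (fderiv ℝ a) y := h.fderiv_right (by simp)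
  exact (ContinuousAlternatingMap.alternatizeUncurryFinCLM ℝ E ℝ).contDiff.contDiffAt.comp y h2

lemma contDiffAt_constOfIsEmpty {F : E → ℝ} {y : E} (h : ContDiffAt ℝ ∞ F y) : ContDiffAt ℝ ∞
    (fun y' => ContinuousAlternatingMap.constOfIsEmpty ℝ E (Fin 0) (F y')) y :=
  ((ContinuousAlternatingMap.constOfIsEmptyLIE ℝ E ℝ (Fin 0)).toContinuousLinearEquiv.contDiff
    (n := ∞)).contDiffAt.comp y h

lemma dlogRaw_smooth [IsManifold 𝓘(ℝ, E) ∞ M] (g : C^∞⟮𝓘(ℝ, E), M; 𝓡 1, Circle⟯) :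
    (dlogRaw g : RawForm E M 1).IsSmooth := by
  intro x₀ y hy
  obtain ⟨F, hF, h⟩ := rep_dlogRaw_eventually g hy
  exact ((contDiffAt_extDeriv (contDiffAt_constOfIsEmpty hF)).congr_of_eventuallyEq
    h).contDiffWithinAt

/-- The homomorphism `-√-1 d log` from the smooth functions with values in `U(1)` to the
`1`-forms, `g ↦ -√-1 g⁻¹ dg`. -/
def dlog [IsManifold 𝓘(ℝ, E) ∞ M] : SmoothU1 E M →+ DiffForm E M 1 :=
  AddMonoidHom.mk' (fun g => ⟨dlogRaw g.toMul, dlogRaw_smooth g.toMul⟩) fun g h => by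
    refine Subtype.ext (RawForm.ext_of_rep fun x₀ y hy => ?_)
    obtain ⟨F, hF, h1⟩ := exists_log g.toMul hy
    obtain ⟨H, hH, h2⟩ := exists_log h.toMul hy
    have hF1 : DifferentiableAt ℝ F y := hF.differentiableAt (by simp)
    have hH1 : DifferentiableAt ℝ H y := hH.differentiableAt (by simp)
    have h3 : ∀ᶠ y' in 𝓝 y, ((g + h).toMul ((chartAt E x₀).symm y') : ℂ) =
        Complex.exp (((F + H) y' : ℝ) * Complex.I) := by
      filter_upwards [h1, h2] with y' h1 h2
      have h4 : (g + h).toMul ((chartAt E x₀).symm y') =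
        g.toMul ((chartAt E x₀).symm y') * h.toMul ((chartAt E x₀).symm y') := rfl
      rw [h4, Circle.coe_mul, h1, h2, ← Complex.exp_add]
      push_cast [Pi.add_apply]
      rw [add_mul]
    refine (rep_dlogRaw (g + h).toMul hy (hF1.add hH1) h3).trans ?_
    rw [fderiv_add hF1 hH1]
    change _ = RawForm.rep (dlogRaw g.toMul) x₀ y + RawForm.rep (dlogRaw h.toMul) x₀ y
    rw [rep_dlogRaw g.toMul hy hF1 h1, rep_dlogRaw h.toMul hy hH1 h2]
    ext v
    simp

lemma d_dlog [IsManifold 𝓘(ℝ, E) ∞ M] (g : SmoothU1 E M) : DiffForm.d 1 (dlog g) = 0 := by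
  refine Subtype.ext (RawForm.ext_of_rep fun x₀ y hy => ?_)
  obtain ⟨F, hF, h⟩ := rep_dlogRaw_eventually g.toMul hy
  refine (rep_ext (dlogRaw_smooth g.toMul) hy).trans ?_
  rw [h.extDeriv_eq, extDeriv_extDeriv_apply (contDiffAt_constOfIsEmpty hF) two_le_smooth]
  rfl

/-- The pullback of smooth functions with values in `U(1)`. -/
def SmoothU1.pullback (f : C^∞⟮𝓘(ℝ, E), M; 𝓘(ℝ, E), N⟯) : SmoothU1 E N →+ SmoothU1 E M where
  toFun g := Additive.ofMul (g.toMul.comp f)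
  map_zero' := rfl
  map_add' _ _ := rfl

lemma dlog_pullback [IsManifold 𝓘(ℝ, E) ∞ M] [IsManifold 𝓘(ℝ, E) ∞ N]
    (f : C^∞⟮𝓘(ℝ, E), M; 𝓘(ℝ, E), N⟯) (g : SmoothU1 E N) :
    dlog (SmoothU1.pullback f g) = DiffForm.pullback f 1 (dlog g) := by
  refine Subtype.ext (funext fun x => ?_)
  have h1 : (circleDiff (g.toMul.comp f) x : E →L[ℝ] ℂ) =
      (circleDiff g.toMul (f x)).comp (dmap E f x) :=
    mfderiv_comp x ((coe_circle_contMDiff g.toMul).contMDiffAt.mdifferentiableAt (by simp))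
      (f.contMDiff.contMDiffAt.mdifferentiableAt (by simp))
  change dlogRaw (g.toMul.comp f) x =
    (dlogRaw g.toMul (f x)).compContinuousLinearMap (dmap E f x)
  unfold dlogRaw
  rw [h1]
  rfl

/-- The exponential map `f ↦ exp(2π√-1 f)` from the smooth functions to the smooth functions with
values in `U(1)`. -/
def expU1 [IsManifold 𝓘(ℝ, E) ∞ M] : DiffForm E M 0 →+ SmoothU1 E M where
  toFun f := Additive.ofMul ⟨fun x => Circle.exp (2 * Real.pi * f.eval x),
    contMDiff_circleExp.comp ((contDiff_const.mul contDiff_id).contMDiff.comp f.eval_contMDiff)⟩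
  map_zero' := by
    refine ContMDiffMap.ext fun x => ?_
    change Circle.exp (2 * Real.pi * 0) = 1
    rw [mul_zero, Circle.exp_zero]
  map_add' f g := by
    refine ContMDiffMap.ext fun x => ?_
    change Circle.exp (2 * Real.pi * (f.eval x + g.eval x)) =
      Circle.exp (2 * Real.pi * f.eval x) * Circle.exp (2 * Real.pi * g.eval x)
    rw [mul_add, Circle.exp_add]

lemma expU1_ofInt [IsManifold 𝓘(ℝ, E) ∞ M] (z : LocallyConstant M ℤ) :
    expU1 (DiffForm.ofInt z : DiffForm E M 0) = 0 := by
  refine ContMDiffMap.ext fun x => ?_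
  change Circle.exp (2 * Real.pi * (z x : ℝ)) = 1
  rw [mul_comm]
  exact Circle.exp_int_mul_two_pi (z x)

lemma expU1_pullback [IsManifold 𝓘(ℝ, E) ∞ M] [IsManifold 𝓘(ℝ, E) ∞ N]
    (f : C^∞⟮𝓘(ℝ, E), M; 𝓘(ℝ, E), N⟯) (h : DiffForm E N 0) :
    expU1 (DiffForm.pullback f 0 h) = SmoothU1.pullback f (expU1 h) := by
  refine ContMDiffMap.ext fun x => ?_
  change Circle.exp (2 * Real.pi * (h.1 (f x)) (fun i => dmap E f x (![] i))) =
    Circle.exp (2 * Real.pi * h.1 (f x) ![])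
  congr 4
  exact Subsingleton.elim _ _

lemma dlog_expU1 [IsManifold 𝓘(ℝ, E) ∞ M] (f : DiffForm E M 0) :
    dlog (expU1 f) = DiffForm.scale (2 * Real.pi) 1 (DiffForm.d 0 f) := by
  refine Subtype.ext (RawForm.ext_of_rep fun x₀ y hy => ?_)
  have hf : ∀ y', RawForm.rep f.1 x₀ y' = ContinuousAlternatingMap.constOfIsEmpty ℝ E (Fin 0)
      (f.eval ((chartAt E x₀).symm y')) := by
    intro y'
    ext v
    simp only [RawForm.rep, DiffForm.eval, ContinuousAlternatingMap.compContinuousLinearMap_apply,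
      ContinuousAlternatingMap.constOfIsEmpty_apply]
    congr 1
    exact Subsingleton.elim _ _
  have hF : ContDiffAt ℝ ∞ (fun y' => f.eval ((chartAt E x₀).symm y')) y := by
    rw [← contMDiffAt_iff_contDiffAt]
    exact f.eval_contMDiff.contMDiffAt.comp y (contMDiffAt_chartAt_symm x₀ hy)
  have hF1 := hF.differentiableAt (by simp)
  refine (rep_dlogRaw (expU1 f).toMul hy (F := fun y' => 2 * Real.pi * f.eval
    ((chartAt E x₀).symm y')) (hF1.const_mul _) (Eventually.of_forall fun y' => ?_)).trans ?_
  · exact Circle.coe_exp _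
  · change _ = RawForm.rep ((2 * Real.pi) • RawForm.ext f.1) x₀ y
    rw [rep_smul, Pi.smul_apply, rep_ext f.smooth hy, funext hf, extDeriv_constOfIsEmpty,
      fderiv_const_mul hF1]
    ext v
    simp

end Forms

section PullbackManifold

variable {E : Type*} [NormedAddCommGroup E] [NormedSpace ℝ E]
variable {X Y Z : Type*} [TopologicalSpace X] [TopologicalSpace Y] [ChartedSpace E Y]
variable [TopologicalSpace Z] [ChartedSpace E Z]

/-- The charts of the source of a local homeomorphism obtained from the charts of its target. -/
@[reducible]
def pullbackChartedSpace {f : X → Y} (hf : IsLocalHomeomorph f) : ChartedSpace E X where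
  atlas := {c | ∃ e : OpenPartialHomeomorph X Y, ⇑e = f ∧ ∃ c' ∈ atlas E Y, c = e.trans c'}
  chartAt x := (hf x).choose.trans (chartAt E (f x))
  mem_chart_source x := by
    have h := (hf x).choose_spec
    rw [OpenPartialHomeomorph.trans_source]
    refine ⟨h.1, ?_⟩
    rw [mem_preimage, ← h.2]
    exact mem_chart_source E (f x)
  chart_mem_atlas x := ⟨_, (hf x).choose_spec.2.symm, _, chart_mem_atlas E (f x), rfl⟩

lemma pullback_isManifold [IsManifold 𝓘(ℝ, E) ∞ Y] {f : X → Y} (hf : IsLocalHomeomorph f) :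
    @IsManifold ℝ _ E _ _ E _ 𝓘(ℝ, E) ∞ X _ (pullbackChartedSpace hf) := by
  let _ : ChartedSpace E X := pullbackChartedSpace hf
  refine isManifold_of_contDiffOn 𝓘(ℝ, E) ∞ X ?_
  rintro _ _ ⟨e, he, c, hc, rfl⟩ ⟨e', he', c', hc', rfl⟩ y hy
  have hy' := hy.1
  simp only [mfld_simps] at hy'
  obtain ⟨⟨h1, h2⟩, h3, h4⟩ := hy'
  have hfe : ∀ y', c.symm y' ∈ e.target → e' (e.symm (c.symm y')) = c.symm y' := by
    intro y' h
    rw [he', ← he, e.right_inv h]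
  rw [hfe y h2] at h4
  have h5 : ContMDiffAt 𝓘(ℝ, E) 𝓘(ℝ, E) ∞ (c' ∘ c.symm) y :=
    (contMDiffAt_of_mem_maximalAtlas (IsManifold.subset_maximalAtlas hc') h4).comp y
      (contMDiffAt_symm_of_mem_maximalAtlas (IsManifold.subset_maximalAtlas hc) h1)
  rw [contMDiffAt_iff_contDiffAt] at h5
  refine (h5.congr_of_eventuallyEq ?_).contDiffWithinAt
  filter_upwards [(c.symm.continuousAt h1).eventually (e.open_target.mem_nhds h2)] with y' h6
  simp only [mfld_simps]
  rw [hfe y' h6]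

lemma pullback_chart_comp {f : X → Y} (hf : IsLocalHomeomorph f) (x : X) :
    ((pullbackChartedSpace (E := E) hf).chartAt x : X → E) = chartAt E (f x) ∘ f := by
  have h := (hf x).choose_spec.2
  have h1 : ((pullbackChartedSpace (E := E) hf).chartAt x : X → E) =
    chartAt E (f x) ∘ (hf x).choose := rfl
  rw [h1, ← h]

lemma contMDiff_pullback [IsManifold 𝓘(ℝ, E) ∞ Y] {f : X → Y} (hf : IsLocalHomeomorph f) :
    letI := pullbackChartedSpace (E := E) hf
    ContMDiff 𝓘(ℝ, E) 𝓘(ℝ, E) ∞ f := by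
  let _ := pullbackChartedSpace (E := E) hf
  have := pullback_isManifold (E := E) hf
  intro x
  have h1 : ContMDiffAt 𝓘(ℝ, E) 𝓘(ℝ, E) ∞ (chartAt E x) x :=
    contMDiffAt_chartAt x (mem_chart_source E x)
  have h2 : (chartAt E x : X → E) = chartAt E (f x) ∘ f := pullback_chart_comp hf x
  rw [h2] at h1
  have h3 : ContMDiffAt 𝓘(ℝ, E) 𝓘(ℝ, E) ∞ ((chartAt E (f x)).symm ∘ (chartAt E (f x) ∘ f)) x :=
    (contMDiffAt_chartAt_symm (f x) (mem_chart_target E (f x))).comp x h1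
  refine h3.congr_of_eventuallyEq ?_
  filter_upwards [hf.continuous.continuousAt.eventually
    ((chartAt E (f x)).open_source.mem_nhds (mem_chart_source E (f x)))] with z hz
  exact ((chartAt E (f x)).left_inv hz).symm

lemma contMDiff_lift [IsManifold 𝓘(ℝ, E) ∞ Y] {f : X → Y} (hf : IsLocalHomeomorph f)
    {g : Z → X} (hg : Continuous g) (h : ContMDiff 𝓘(ℝ, E) 𝓘(ℝ, E) ∞ (f ∘ g)) :
    letI := pullbackChartedSpace (E := E) hf
    ContMDiff 𝓘(ℝ, E) 𝓘(ℝ, E) ∞ g := by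
  let _ := pullbackChartedSpace (E := E) hf
  have := pullback_isManifold (E := E) hf
  intro z
  have h2 : (chartAt E (g z) : X → E) = chartAt E (f (g z)) ∘ f := pullback_chart_comp hf (g z)
  have h1 : ContMDiffAt 𝓘(ℝ, E) 𝓘(ℝ, E) ∞ (chartAt E (g z) ∘ g) z := by
    rw [h2]
    exact ContMDiffAt.comp (g := chartAt E (f (g z))) (f := f ∘ g) z
      (contMDiffAt_chartAt (f (g z)) (mem_chart_source E (f (g z)))) h.contMDiffAt
  have h3 : ContMDiffAt 𝓘(ℝ, E) 𝓘(ℝ, E) ∞ ((chartAt E (g z)).symm ∘ (chartAt E (g z) ∘ g)) z :=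
    (contMDiffAt_chartAt_symm (g z) (mem_chart_target E (g z))).comp z h1
  refine h3.congr_of_eventuallyEq ?_
  filter_upwards [hg.continuousAt.eventually
    ((chartAt E (g z)).open_source.mem_nhds (mem_chart_source E (g z)))] with w hw
  exact ((chartAt E (g z)).left_inv hw).symm

lemma contMDiff_of_localDiffeo {W : Type*} [TopologicalSpace W] [ChartedSpace E W] {f : W → Y}
    (hf : IsLocalDiffeomorph 𝓘(ℝ, E) 𝓘(ℝ, E) ∞ f)
    {g : Z → W} (hg : Continuous g) (h : ContMDiff 𝓘(ℝ, E) 𝓘(ℝ, E) ∞ (f ∘ g)) :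
    ContMDiff 𝓘(ℝ, E) 𝓘(ℝ, E) ∞ g := by
  intro z
  have h1 : ContMDiffAt 𝓘(ℝ, E) 𝓘(ℝ, E) ∞ ((hf (g z)).localInverse ∘ (f ∘ g)) z :=
    (hf (g z)).localInverse_contMDiffAt.comp z h.contMDiffAt
  refine h1.congr_of_eventuallyEq ?_
  exact (hg.continuousAt.eventually (hf (g z)).localInverse_eventuallyEq_left).mono
    fun w hw => hw.symm

end PullbackManifold

/-- A smooth étale groupoid: a groupoid with smooth manifolds `G₀` of objects and `G₁` of arrows,
modelled on `E`, whose source and target maps are local diffeomorphisms and whose structure maps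
are smooth. The composite `m a b` of `a` followed by `b` is only meaningful if `t a = s b`. As `s`
and `t` are local diffeomorphisms and `s (m a b) = s a`, the composition is smooth on the manifold
of composable pairs if and only if it is continuous there. -/
structure EtaleGroupoid (E : Type*) [NormedAddCommGroup E] [NormedSpace ℝ E] (G₀ G₁ : Type u)
    [TopologicalSpace G₀] [ChartedSpace E G₀] [TopologicalSpace G₁] [ChartedSpace E G₁] where
  /-- source -/
  s : G₁ → G₀
  /-- target -/
  t : G₁ → G₀
  /-- identity arrows -/
  e : G₀ → G₁
  /-- inverse arrows -/
  inv : G₁ → G₁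
  /-- composition -/
  m : G₁ → G₁ → G₁
  s_e : ∀ x, s (e x) = x
  t_e : ∀ x, t (e x) = x
  s_inv : ∀ a, s (inv a) = t a
  t_inv : ∀ a, t (inv a) = s a
  s_m : ∀ a b, t a = s b → s (m a b) = s a
  t_m : ∀ a b, t a = s b → t (m a b) = t b
  m_assoc : ∀ a b c, t a = s b → t b = s c → m (m a b) c = m a (m b c)
  e_m : ∀ a, m (e (s a)) a = a
  m_e : ∀ a, m a (e (t a)) = a
  m_inv : ∀ a, m a (inv a) = e (s a)
  inv_m : ∀ a, m (inv a) a = e (t a)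
  etale_s : IsLocalDiffeomorph 𝓘(ℝ, E) 𝓘(ℝ, E) ∞ s
  etale_t : IsLocalDiffeomorph 𝓘(ℝ, E) 𝓘(ℝ, E) ∞ t
  smooth_e : ContMDiff 𝓘(ℝ, E) 𝓘(ℝ, E) ∞ e
  smooth_inv : ContMDiff 𝓘(ℝ, E) 𝓘(ℝ, E) ∞ inv
  continuous_m : ContinuousOn (fun p : G₁ × G₁ => m p.1 p.2) {p | t p.1 = s p.2}

namespace EtaleGroupoid

variable {E : Type*} [NormedAddCommGroup E] [NormedSpace ℝ E] {G₀ G₁ : Type u}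
variable [TopologicalSpace G₀] [ChartedSpace E G₀]
variable [TopologicalSpace G₁] [ChartedSpace E G₁]

/-- The space `G_k` of strings of `k` composable arrows
`x_0 → x_1 → ⋯ → x_k`, given by its vertices and its arrows. For `k = 0` this is the space of
objects, and for `k ≥ 1` the vertices are determined by the arrows. -/
@[ext]
structure Nerve (G : EtaleGroupoid E G₀ G₁) (k : ℕ) : Type u where
  /-- the vertices -/
  vertex : Fin (k + 1) → G₀
  /-- the arrows -/
  arrow : Fin k → G₁
  s_arrow : ∀ i, G.s (arrow i) = vertex i.castSucc
  t_arrow : ∀ i, G.t (arrow i) = vertex i.succ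

variable {G : EtaleGroupoid E G₀ G₁}

/-- The topology of `G_k` is the subspace topology. -/
instance (k : ℕ) : TopologicalSpace (G.Nerve k) :=
  TopologicalSpace.induced (fun p => (p.vertex, p.arrow)) inferInstance

lemma Nerve.hext {k : ℕ} {p q : G.Nerve k} (hv : ∀ i, p.vertex i = q.vertex i)
    (ha : ∀ i, p.arrow i = q.arrow i) : p = q :=
  Nerve.ext (funext hv) (funext ha)

lemma Nerve.continuous_vertex {k : ℕ} (i : Fin (k + 1)) :
    Continuous fun p : G.Nerve k => p.vertex i :=
  have h : Continuous fun p : G.Nerve k => (p.vertex, p.arrow) := continuous_induced_dom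
  (continuous_apply i).comp (continuous_fst.comp h)

lemma Nerve.continuous_arrow {k : ℕ} (i : Fin k) : Continuous fun p : G.Nerve k => p.arrow i :=
  have h : Continuous fun p : G.Nerve k => (p.vertex, p.arrow) := continuous_induced_dom
  (continuous_apply i).comp (continuous_snd.comp h)

lemma Nerve.continuous_mk {X : Type*} [TopologicalSpace X] {k : ℕ} {f : X → G.Nerve k}
    (hv : ∀ i, Continuous fun x => (f x).vertex i) (ha : ∀ i, Continuous fun x => (f x).arrow i) :
    Continuous f :=
  continuous_induced_rng.2 ((continuous_pi hv).prodMk (continuous_pi ha))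

/-- The string without its last arrow. -/
def Nerve.init {k : ℕ} (p : G.Nerve (k + 1)) : G.Nerve k :=
  ⟨fun i => p.vertex i.castSucc, fun i => p.arrow i.castSucc, fun i => p.s_arrow i.castSucc,
    fun i => p.t_arrow i.castSucc⟩

/-- The string with one more arrow at its end. -/
def Nerve.snoc {k : ℕ} (p : G.Nerve k) (a : G₁) (h : G.s a = p.vertex (Fin.last k)) :
    G.Nerve (k + 1) :=
  ⟨Fin.snoc (α := fun _ => G₀) p.vertex (G.t a), Fin.snoc (α := fun _ => G₁) p.arrow a, by
    intro i
    refine Fin.lastCases ?_ (fun i => ?_) i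
    · rw [Fin.snoc_last, Fin.snoc_castSucc]
      exact h
    · rw [Fin.snoc_castSucc, Fin.snoc_castSucc]
      exact p.s_arrow i, by
    intro i
    refine Fin.lastCases ?_ (fun i => ?_) i
    · rw [Fin.snoc_last, Fin.succ_last, Fin.snoc_last]
    · rw [Fin.snoc_castSucc, Fin.succ_castSucc, Fin.snoc_castSucc]
      exact p.t_arrow i⟩

lemma Nerve.init_snoc {k : ℕ} (p : G.Nerve k) (a : G₁) (h : G.s a = p.vertex (Fin.last k)) :
    (p.snoc a h).init = p := by
  refine Nerve.hext (fun i => ?_) fun i => ?_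
  · exact Fin.snoc_castSucc (α := fun _ => G₀) _ _ i
  · exact Fin.snoc_castSucc (α := fun _ => G₁) _ _ i

lemma Nerve.arrow_snoc_last {k : ℕ} (p : G.Nerve k) (a : G₁)
    (h : G.s a = p.vertex (Fin.last k)) : (p.snoc a h).arrow (Fin.last k) = a :=
  Fin.snoc_last (α := fun _ => G₁) _ _

lemma Nerve.eq_of_init {k : ℕ} {p q : G.Nerve (k + 1)} (h : p.init = q.init)
    (ha : p.arrow (Fin.last k) = q.arrow (Fin.last k)) : p = q := by
  refine Nerve.hext (fun i => ?_) fun i => ?_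
  · refine Fin.lastCases ?_ (fun i => ?_) i
    · rw [← Fin.succ_last, ← p.t_arrow, ← q.t_arrow, ha]
    · exact congrArg (fun r => Nerve.vertex r i) h
  · refine Fin.lastCases ha (fun i => ?_) i
    exact congrArg (fun r => Nerve.arrow r i) h

lemma Nerve.continuous_init {k : ℕ} : Continuous (Nerve.init : G.Nerve (k + 1) → G.Nerve k) :=
  Nerve.continuous_mk (fun i => Nerve.continuous_vertex i.castSucc)
    fun i => Nerve.continuous_arrow i.castSucc

lemma Nerve.isLocalHomeomorph_init {k : ℕ} :
    IsLocalHomeomorph (Nerve.init : G.Nerve (k + 1) → G.Nerve k) := by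
  refine IsLocalHomeomorph.mk _ fun p => ?_
  obtain ⟨c, hc, hsc⟩ := G.etale_s.isLocalHomeomorph (p.arrow (Fin.last k))
  have hs : ∀ q : G.Nerve k, q.vertex (Fin.last k) ∈ c.target →
      G.s (c.symm (q.vertex (Fin.last k))) = q.vertex (Fin.last k) := fun q hq => by
    rw [hsc]
    exact c.right_inv hq
  classical
  let r : G.Nerve k → G.Nerve (k + 1) := fun q =>
    if h : q.vertex (Fin.last k) ∈ c.target then q.snoc _ (hs q h)
    else q.snoc (G.e (q.vertex (Fin.last k))) (G.s_e _)
  have hr : ∀ q : G.Nerve k, ∀ h : q.vertex (Fin.last k) ∈ c.target,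
      r q = q.snoc _ (hs q h) := fun q h => dif_pos h
  have hlast : ∀ q : G.Nerve (k + 1), q.arrow (Fin.last k) ∈ c.source →
      q.init.vertex (Fin.last k) = c (q.arrow (Fin.last k)) := fun q hq => by
    have := q.s_arrow (Fin.last k)
    rw [hsc] at this
    exact this.symm
  refine ⟨{ toFun := Nerve.init
            invFun := r
            source := {q | q.arrow (Fin.last k) ∈ c.source}
            target := {q | q.vertex (Fin.last k) ∈ c.target}
            map_source' := fun q hq => ?_
            map_target' := fun q hq => ?_
            left_inv' := fun q hq => ?_
            right_inv' := fun q hq => ?_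
            open_source := c.open_source.preimage (Nerve.continuous_arrow _)
            open_target := c.open_target.preimage (Nerve.continuous_vertex _)
            continuousOn_toFun := Nerve.continuous_init.continuousOn
            continuousOn_invFun := ?_ }, hc, fun _ _ => rfl⟩
  · change q.init.vertex (Fin.last k) ∈ c.target
    rw [hlast q hq]
    exact c.map_source hq
  · change (r q).arrow (Fin.last k) ∈ c.source
    rw [hr q hq, Nerve.arrow_snoc_last]
    exact c.map_target hq
  · have h1 : q.init.vertex (Fin.last k) ∈ c.target := by
      rw [hlast q hq]
      exact c.map_source hq
    rw [hr _ h1]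
    refine Nerve.eq_of_init (Nerve.init_snoc _ _ _) ?_
    rw [Nerve.arrow_snoc_last, hlast q hq, c.left_inv hq]
  · rw [hr q hq, Nerve.init_snoc]
  · rw [continuousOn_iff_continuous_domRestrict]
    have hcont : Continuous fun q : {q : G.Nerve k | q.vertex (Fin.last k) ∈ c.target} =>
        c.symm (q.1.vertex (Fin.last k)) :=
      c.symm.continuousOn.comp_continuous
        ((Nerve.continuous_vertex _).comp continuous_subtype_val) fun q => q.2
    have hres : ({q : G.Nerve k | q.vertex (Fin.last k) ∈ c.target}.domRestrict r) =
        fun q => q.1.snoc _ (hs q.1 q.2) := funext fun q => hr q.1 q.2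
    rw [hres]
    refine Nerve.continuous_mk (fun i => ?_) fun i => ?_
    · refine Fin.lastCases ?_ (fun i => ?_) i
      · refine (G.etale_t.contMDiff.continuous.comp hcont).congr fun q => ?_
        exact (Fin.snoc_last (α := fun _ => G₀) _ _).symm
      · refine ((Nerve.continuous_vertex i).comp continuous_subtype_val).congr fun q => ?_
        exact (Fin.snoc_castSucc (α := fun _ => G₀) _ _ i).symm
    · refine Fin.lastCases ?_ (fun i => ?_) i
      · exact hcont.congr fun q => (Fin.snoc_last (α := fun _ => G₁) _ _).symm
      · refine ((Nerve.continuous_arrow i).comp continuous_subtype_val).congr fun q => ?_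
        exact (Fin.snoc_castSucc (α := fun _ => G₁) _ _ i).symm

/-- The first vertex of a string of arrows. -/
def Nerve.first {k : ℕ} (p : G.Nerve k) : G₀ := p.vertex 0

/-- The space `G_0` of the nerve is the space of objects. -/
def nerveZero : G.Nerve 0 ≃ₜ G₀ where
  toFun := Nerve.first
  invFun x := ⟨fun _ => x, fun i => i.elim0, fun i => i.elim0, fun i => i.elim0⟩
  left_inv p := Nerve.hext (fun i => by rw [Fin.fin_one_eq_zero i]; rfl) fun i => i.elim0
  right_inv _ := rfl
  continuous_toFun := Nerve.continuous_vertex 0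
  continuous_invFun := Nerve.continuous_mk (fun _ => continuous_id) fun i => i.elim0

lemma Nerve.isLocalHomeomorph_first : ∀ k : ℕ, IsLocalHomeomorph (Nerve.first : G.Nerve k → G₀)
  | 0 => (nerveZero (G := G)).isLocalHomeomorph
  | k + 1 => (Nerve.isLocalHomeomorph_first k).comp Nerve.isLocalHomeomorph_init

/-- The manifold structure on `G_k`: the projection to the first vertex is a local
diffeomorphism. -/
instance (k : ℕ) : ChartedSpace E (G.Nerve k) :=
  pullbackChartedSpace (Nerve.isLocalHomeomorph_first k)

instance [IsManifold 𝓘(ℝ, E) ∞ G₀] (k : ℕ) : IsManifold 𝓘(ℝ, E) ∞ (G.Nerve k) :=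
  pullback_isManifold (Nerve.isLocalHomeomorph_first k)

lemma Nerve.contMDiff_first [IsManifold 𝓘(ℝ, E) ∞ G₀] (k : ℕ) :
    ContMDiff 𝓘(ℝ, E) 𝓘(ℝ, E) ∞ (Nerve.first : G.Nerve k → G₀) :=
  contMDiff_pullback (Nerve.isLocalHomeomorph_first k)

lemma Nerve.contMDiff_arrow_of_vertex {k : ℕ} {i : Fin k}
    (h : ContMDiff 𝓘(ℝ, E) 𝓘(ℝ, E) ∞ fun p : G.Nerve k => p.vertex i.castSucc) :
    ContMDiff 𝓘(ℝ, E) 𝓘(ℝ, E) ∞ fun p : G.Nerve k => p.arrow i := by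
  refine contMDiff_of_localDiffeo G.etale_s (Nerve.continuous_arrow i) ?_
  exact h.congr fun p => p.s_arrow i

lemma Nerve.contMDiff_vertex [IsManifold 𝓘(ℝ, E) ∞ G₀] {k : ℕ} (i : Fin (k + 1)) :
    ContMDiff 𝓘(ℝ, E) 𝓘(ℝ, E) ∞ fun p : G.Nerve k => p.vertex i := by
  refine Fin.induction (Nerve.contMDiff_first k) (fun i hi => ?_) i
  exact (G.etale_t.contMDiff.comp (Nerve.contMDiff_arrow_of_vertex hi)).congr
    fun p => (p.t_arrow i).symm

/-- The arrows of the `i`-th face of a string of arrows: the `i`-th vertex is left out, and the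
two arrows at that vertex are replaced by their composite. -/
def Nerve.faceArrow {k : ℕ} (i : Fin (k + 2)) (p : G.Nerve (k + 1)) (j : Fin k) : G₁ :=
  if (j : ℕ) + 1 < i then p.arrow j.castSucc
  else if (j : ℕ) + 1 = i then G.m (p.arrow j.castSucc) (p.arrow j.succ)
  else p.arrow j.succ

lemma Nerve.t_eq_s {k : ℕ} (p : G.Nerve (k + 1)) (j : Fin k) :
    G.t (p.arrow j.castSucc) = G.s (p.arrow j.succ) := by
  rw [p.t_arrow, p.s_arrow, Fin.succ_castSucc]

lemma Nerve.faceArrow_ends {k : ℕ} (i : Fin (k + 2)) (p : G.Nerve (k + 1)) (j : Fin k) :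
    G.s (Nerve.faceArrow i p j) = p.vertex (i.succAbove j.castSucc) ∧
      G.t (Nerve.faceArrow i p j) = p.vertex (i.succAbove j.succ) := by
  have hc := p.t_eq_s j
  have h1 : i.succAbove j.castSucc =
      if (j : ℕ) < i then j.castSucc.castSucc else j.succ.castSucc := by
    rw [Fin.succAbove]
    simp [Fin.lt_def]
  have h2 : i.succAbove j.succ =
      if (j : ℕ) + 1 < i then j.castSucc.succ else j.succ.succ := by
    rw [Fin.succAbove]
    simp [Fin.lt_def]
  rw [h1, h2]
  unfold Nerve.faceArrow
  by_cases h3 : (j : ℕ) + 1 < i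
  · have h4 : (j : ℕ) < i := by omega
    rw [if_pos h3, if_pos h3, if_pos h4]
    exact ⟨p.s_arrow _, p.t_arrow _⟩
  · by_cases h5 : (j : ℕ) + 1 = i
    · have h4 : (j : ℕ) < i := by omega
      rw [if_neg h3, if_neg h3, if_pos h4, if_pos h5]
      exact ⟨(G.s_m _ _ hc).trans (p.s_arrow _), (G.t_m _ _ hc).trans (p.t_arrow _)⟩
    · have h4 : ¬ (j : ℕ) < i := by omega
      rw [if_neg h3, if_neg h3, if_neg h4, if_neg h5]
      exact ⟨p.s_arrow _, p.t_arrow _⟩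

/-- The face maps `δ_i : G_{k+1} → G_k`:
`δ_0 (a_1, …, a_{k+1}) = (a_2, …, a_{k+1})`, `δ_{k+1} (a_1, …, a_{k+1}) = (a_1, …, a_k)` and
`δ_i (a_1, …, a_{k+1}) = (a_1, …, m (a_i, a_{i+1}), …, a_{k+1})` for `0 < i < k + 1`.
On `G_1` these are `δ_0 = t` and `δ_1 = s`. -/
def Nerve.face {k : ℕ} (i : Fin (k + 2)) (p : G.Nerve (k + 1)) : G.Nerve k :=
  ⟨fun j => p.vertex (i.succAbove j), Nerve.faceArrow i p,
    fun j => (Nerve.faceArrow_ends i p j).1, fun j => (Nerve.faceArrow_ends i p j).2⟩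

lemma Nerve.continuous_face {k : ℕ} (i : Fin (k + 2)) :
    Continuous (Nerve.face i : G.Nerve (k + 1) → G.Nerve k) := by
  refine Nerve.continuous_mk (fun j => Nerve.continuous_vertex (i.succAbove j)) fun j => ?_
  change Continuous fun p => Nerve.faceArrow i p j
  unfold Nerve.faceArrow
  split_ifs
  · exact Nerve.continuous_arrow _
  · refine G.continuous_m.comp_continuous ((Nerve.continuous_arrow j.castSucc).prodMk
      (Nerve.continuous_arrow j.succ)) fun p => p.t_eq_s j
  · exact Nerve.continuous_arrow _

lemma Nerve.contMDiff_face [IsManifold 𝓘(ℝ, E) ∞ G₀] {k : ℕ} (i : Fin (k + 2)) :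
    ContMDiff 𝓘(ℝ, E) 𝓘(ℝ, E) ∞ (Nerve.face i : G.Nerve (k + 1) → G.Nerve k) :=
  contMDiff_lift (Nerve.isLocalHomeomorph_first k) (Nerve.continuous_face i)
    (Nerve.contMDiff_vertex (i.succAbove 0))

/-- The simplicial identities. -/
lemma Nerve.face_face {k : ℕ} {i : Fin (k + 2)} {j : Fin (k + 2)} (h : i ≤ j)
    (p : G.Nerve (k + 2)) :
    Nerve.face i (Nerve.face j.succ p) = Nerve.face j (Nerve.face i.castSucc p) := by
  have hij : (i : ℕ) ≤ j := h
  refine Nerve.hext (fun l => ?_) fun l => ?_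
  · change p.vertex (j.succ.succAbove (i.succAbove l)) =
      p.vertex (i.castSucc.succAbove (j.succAbove l))
    congr 1
    apply Fin.ext
    simp only [Fin.succAbove, Fin.lt_def]
    split_ifs <;> simp_all <;> omega
  · have h1 := p.t_eq_s l.castSucc
    have h2 := p.t_eq_s l.succ
    rw [Fin.succ_castSucc] at h1
    change Nerve.faceArrow i (Nerve.face j.succ p) l = Nerve.faceArrow j (Nerve.face i.castSucc p) l
    simp only [Nerve.faceArrow, Nerve.face, Fin.val_castSucc, Fin.val_succ, Fin.succ_castSucc]
    split_ifs <;> first | rfl | omega | exact G.m_assoc _ _ _ h1 h2 | exact (G.m_assoc _ _ _ h1 h2).symm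

end EtaleGroupoid

section Complexes

universe w w'

/-- A cochain complex of abelian groups in non-negative degrees. -/
structure CochainCpx where
  /-- the groups of cochains -/
  X : ℕ → Type w
  [grp : ∀ k, AddCommGroup (X k)]
  /-- the coboundary operator -/
  d : ∀ k, X k →+ X (k + 1)
  d_d : ∀ k x, d (k + 1) (d k x) = 0

attribute [instance] CochainCpx.grp

namespace CochainCpx

/-- The cocycles of degree `k`. -/
def cocycles (C : CochainCpx.{w}) (k : ℕ) : AddSubgroup (C.X k) := (C.d k).ker

/-- The coboundaries of degree `k`. -/
def coboundaries (C : CochainCpx.{w}) : ∀ k : ℕ, AddSubgroup (C.X k)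
  | 0 => ⊥
  | k + 1 => (C.d k).range

/-- The cohomology group `H^k(C)`: cocycles modulo coboundaries. -/
abbrev H (C : CochainCpx.{w}) (k : ℕ) : Type w :=
  C.cocycles k ⧸ (C.coboundaries k).addSubgroupOf (C.cocycles k)

/-- The cohomology class of a cocycle. -/
def cls (C : CochainCpx.{w}) {k : ℕ} (z : C.X k) (hz : C.d k z = 0) : C.H k :=
  QuotientAddGroup.mk (⟨z, hz⟩ : C.cocycles k)

/-- A homomorphism between cohomology groups is induced by a map `φ` of cochains if `φ` maps
cocycles to cocycles and the homomorphism is `[z] ↦ [φ z]`. -/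
def Induces {C : CochainCpx.{w}} {D : CochainCpx.{w'}} {k l : ℕ} (φ : C.X k → D.X l)
    (e : C.H k → D.H l) : Prop :=
  ∀ (z : C.X k) (hz : C.d k z = 0), ∃ hw : D.d l (φ z) = 0, e (C.cls z hz) = D.cls (φ z) hw

end CochainCpx

/-- A double complex of abelian groups in non-negative degrees `(i, j)` whose two differentials
commute. -/
structure DoubleCpx where
  /-- the groups of the double complex -/
  X : ℕ → ℕ → Type w
  [grp : ∀ i j, AddCommGroup (X i j)]
  /-- the differential in the first direction -/
  δ : ∀ i j, X i j →+ X (i + 1) j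
  /-- the differential in the second direction -/
  d : ∀ i j, X i j →+ X i (j + 1)
  δ_δ : ∀ i j x, δ (i + 1) j (δ i j x) = 0
  d_d : ∀ i j x, d i (j + 1) (d i j x) = 0
  d_δ : ∀ i j x, d (i + 1) j (δ i j x) = δ i (j + 1) (d i j x)

attribute [instance] DoubleCpx.grp

namespace DoubleCpx

variable (A : DoubleCpx.{w})

/-- The cochains of degree `k` in the total complex of the columns `j < n`: families of elements
of the groups in the degrees `(i, j)` with `i + j = k` and `j < n`. -/
abbrev Tot (n k : ℕ) : Type w := ∀ p : {p : ℕ × ℕ // p.1 + p.2 = k ∧ p.2 < n}, A.X p.1.1 p.1.2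

variable {A} in
/-- The component in degree `(i, j)` of a total cochain. -/
def Tot.comp {n k : ℕ} (x : A.Tot n k) (i j : ℕ) (h : i + j = k) (hj : j < n) : A.X i j :=
  x ⟨(i, j), h, hj⟩

/-- The component in degree `(i, j)` of the coboundary `(δ + (-1)^i d) x`; terms that would come
from negative degrees are absent. -/
def totDComp {n k : ℕ} (x : A.Tot n k) :
    ∀ i j : ℕ, i + j = k + 1 → j < n → A.X i j
  | 0, 0, _, _ => 0
  | i + 1, 0, h, hj => A.δ i 0 (x.comp i 0 (by omega) hj)
  | 0, j + 1, h, hj => A.d 0 j (x.comp 0 j (by omega) (by omega))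
  | i + 1, j + 1, h, hj => A.δ i (j + 1) (x.comp i (j + 1) (by omega) hj) +
      (-1 : ℤ) ^ (i + 1) • A.d (i + 1) j (x.comp (i + 1) j (by omega) (by omega))

lemma totDComp_add {n k : ℕ} (x y : A.Tot n k) : ∀ (i j : ℕ) (h : i + j = k + 1) (hj : j < n),
    A.totDComp (x + y) i j h hj = A.totDComp x i j h hj + A.totDComp y i j h hj
  | 0, 0, _, _ => (add_zero 0).symm
  | _ + 1, 0, _, _ => map_add _ _ _
  | 0, _ + 1, _, _ => map_add _ _ _
  | i + 1, j + 1, h, hj => by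
    have hc : ∀ (a b : ℕ) (h : a + b = k) (hb : b < n),
      (x + y).comp a b h hb = x.comp a b h hb + y.comp a b h hb := fun _ _ _ _ => rfl
    simp only [totDComp, hc, map_add, smul_add]
    abel

/-- The coboundary operator `δ + (-1)^i d` of the total complex. -/
def totD (n k : ℕ) : A.Tot n k →+ A.Tot n (k + 1) :=
  AddMonoidHom.mk' (fun x p => A.totDComp x p.1.1 p.1.2 p.2.1 p.2.2) fun x y =>
    funext fun p => A.totDComp_add x y p.1.1 p.1.2 p.2.1 p.2.2

lemma totD_comp {n k : ℕ} (x : A.Tot n k) (i j : ℕ) (h : i + j = k + 1) (hj : j < n) :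
    Tot.comp (A.totD n k x) i j h hj = A.totDComp x i j h hj := rfl

lemma totD_totD {n k : ℕ} (x : A.Tot n k) : A.totD n (k + 1) (A.totD n k x) = 0 := by
  suffices h : ∀ (i j : ℕ) (h : i + j = k + 1 + 1) (hj : j < n),
      A.totDComp (A.totD n k x) i j h hj = 0 from
    funext fun p => h p.1.1 p.1.2 p.2.1 p.2.2
  intro i j h hj
  match i, j, h, hj with
  | 0, 0, h, hj => rfl
  | 0, 1, h, hj => omega
  | 1, 0, h, hj => omega
  | i + 2, 0, h, hj =>
    simp only [totDComp, totD_comp]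
    exact A.δ_δ _ _ _
  | 0, j + 2, h, hj =>
    simp only [totDComp, totD_comp]
    exact A.d_d _ _ _
  | 1, 1, h, hj =>
    simp only [totDComp, totD_comp, A.d_δ]
    simp
  | i + 2, 1, h, hj =>
    simp only [totDComp, totD_comp, map_add, map_zsmul, A.δ_δ, A.d_δ, zero_add]
    rw [pow_succ (-1 : ℤ) (i + 1), mul_neg_one, neg_smul, add_neg_cancel]
  | 1, j + 2, h, hj =>
    simp only [totDComp, totD_comp, map_add, map_zsmul, A.d_d, A.d_δ]
    simp
  | i + 2, j + 2, h, hj =>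
    simp only [totDComp, totD_comp, map_add, map_zsmul, A.δ_δ, A.d_δ, A.d_d, zero_add, smul_zero,
      add_zero]
    rw [pow_succ (-1 : ℤ) (i + 1), mul_neg_one, neg_smul, add_neg_cancel]

/-- The total complex of the columns `j < n` of a double complex. -/
def tot (n : ℕ) : CochainCpx.{w} where
  X k := A.Tot n k
  d k := A.totD n k
  d_d _ x := A.totD_totD x

/-- The complex formed by the column `j = 0`. -/
def firstColumn : CochainCpx.{w} where
  X i := A.X i 0
  d i := A.δ i 0
  d_d i x := A.δ_δ i 0 x

/-- The projection of total cochains to the first column. -/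
def toFirstColumn {n : ℕ} (hn : 1 ≤ n) (k : ℕ) : (A.tot n).X k → A.firstColumn.X k :=
  fun x => Tot.comp x k 0 (by omega) hn

/-- The total cochain given by an element of the first column: all its other components
vanish. -/
def ofFirstColumn (n k : ℕ) (x : A.firstColumn.X k) : (A.tot n).X k
  | ⟨(i, 0), h⟩ => (show k = i by have := h.1; omega) ▸ x
  | ⟨(_, _ + 1), _⟩ => 0

end DoubleCpx

/-- The alternating sum `∑_r (-1)^r f_r`. -/
def altSum {A B : Type w} [AddCommGroup A] [AddCommGroup B] {k : ℕ} (f : Fin (k + 2) → A →+ B) :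
    A →+ B :=
  ∑ r : Fin (k + 2), (-1 : ℤ) ^ (r : ℕ) • f r

lemma altSum_apply {A B : Type w} [AddCommGroup A] [AddCommGroup B] {k : ℕ}
    (f : Fin (k + 2) → A →+ B) (x : A) :
    altSum f x = ∑ r : Fin (k + 2), (-1 : ℤ) ^ (r : ℕ) • f r x := by
  unfold altSum
  rw [AddMonoidHom.finsetSum_apply]
  rfl

lemma altSum_altSum {A B C : Type w} [AddCommGroup A] [AddCommGroup B] [AddCommGroup C] {k : ℕ}
    (f : Fin (k + 2) → A →+ B) (g : Fin (k + 3) → B →+ C)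
    (h : ∀ i j : Fin (k + 2), i ≤ j → ∀ x, g j.succ (f i x) = g i.castSucc (f j x)) (x : A) :
    altSum g (altSum f x) = 0 := by
  simp only [altSum_apply, map_sum, map_zsmul, Finset.smul_sum, smul_smul]
  rw [← Finset.sum_product']
  let S : Finset (Fin (k + 2) × Fin (k + 3)) := {p | (p.2 : ℕ) ≤ p.1}
  rw [Finset.univ_product_univ, ← Finset.sum_add_sum_compl S, ← eq_neg_iff_add_eq_zero,
    ← Finset.sum_neg_distrib]
  let φ : ∀ p : Fin (k + 2) × Fin (k + 3), p ∈ S → Fin (k + 2) × Fin (k + 3) := fun p hp =>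
    (Fin.castLT p.2 (lt_of_le_of_lt (Finset.mem_filter.mp hp).right p.1.is_lt), p.1.succ)
  refine Finset.sum_bij φ ?_ ?_ ?_ ?_
  · intro p hp
    simp_rw [S, φ, Finset.compl_filter, Finset.mem_filter_univ, Fin.val_succ,
      Fin.val_castLT] at hp ⊢
    omega
  · rintro ⟨s, r⟩ hp ⟨s', r'⟩ hp' he
    simp only [φ, Prod.mk.injEq, Fin.ext_iff, Fin.val_succ, Fin.val_castLT] at he ⊢
    omega
  · rintro ⟨s, r⟩ hp
    simp_rw [S, Finset.compl_filter, Finset.mem_filter_univ, not_le] at hp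
    refine ⟨(r.pred ?_, s.castSucc), ?_, ?_⟩
    · rintro rfl
      simp only [Fin.val_zero, not_lt_zero] at hp
    · simp only [S, Finset.mem_filter_univ, Fin.val_castSucc, Fin.val_pred]
      omega
    · simp only [φ, Fin.castLT_castSucc, Fin.succ_pred]
  · rintro ⟨s, r⟩ hp
    have hrs : (r : ℕ) ≤ s := (Finset.mem_filter.mp hp).right
    have h1 := h (Fin.castLT r (lt_of_le_of_lt hrs s.is_lt)) s hrs x
    rw [Fin.castSucc_castLT] at h1
    simp only [φ, Fin.val_succ, Fin.val_castLT, h1, ← neg_smul]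
    congr 1
    rw [pow_succ]
    ring

/-- Alternating sums are natural. -/
lemma map_altSum {A B A' B' : Type w} [AddCommGroup A] [AddCommGroup B] [AddCommGroup A']
    [AddCommGroup B'] {k : ℕ} (f : Fin (k + 2) → A →+ B) (g : Fin (k + 2) → A' →+ B')
    (a : A →+ A') (b : B →+ B') (h : ∀ r x, b (f r x) = g r (a x)) (x : A) :
    b (altSum f x) = altSum g (a x) := by
  simp only [altSum_apply, map_sum, map_zsmul, h]

end Complexes

section LocallyConstantFunctions

variable {E : Type*} [NormedAddCommGroup E] [NormedSpace ℝ E]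
variable {M : Type u} [TopologicalSpace M] [ChartedSpace E M]

/-- The pullback of locally constant functions along a continuous map. -/
def lcPullback {M N : Type u} [TopologicalSpace M] [TopologicalSpace N] (A : Type)
    [AddCommGroup A] (f : C(M, N)) : LocallyConstant N A →+ LocallyConstant M A where
  toFun z := z.comap f
  map_zero' := rfl
  map_add' _ _ := rfl

/-- Locally constant functions with values in `U(1)` are smooth. -/
def SmoothU1.ofConst (z : LocallyConstant M (Additive Circle)) : SmoothU1 E M :=
  Additive.ofMul ⟨fun x => (z x).toMul, fun x => by
    refine (contMDiffAt_const (c := (z x).toMul)).congr_of_eventuallyEq ?_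
    filter_upwards [z.isLocallyConstant.eventually_eq x] with y hy
    exact congrArg Additive.toMul hy⟩

/-- The column `j` of the complex of sheaves `U(1) → A^1 → A^2 → ⋯`, over a manifold `M`. -/
def UCol (E : Type) [NormedAddCommGroup E] [NormedSpace ℝ E] (M : Type u) [TopologicalSpace M]
    [ChartedSpace E M] : ℕ → Type u
  | 0 => SmoothU1 E M
  | j + 1 => DiffForm E M (j + 1)

/-- The column `j` of the complex of sheaves `ℤ → A^0 → A^1 → ⋯`, over a manifold `M`. -/
def ZCol (E : Type) [NormedAddCommGroup E] [NormedSpace ℝ E] (M : Type u) [TopologicalSpace M]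
    [ChartedSpace E M] : ℕ → Type u
  | 0 => LocallyConstant M ℤ
  | j + 1 => DiffForm E M j

end LocallyConstantFunctions

section Columns

variable {E : Type} [NormedAddCommGroup E] [NormedSpace ℝ E]
variable {M : Type u} [TopologicalSpace M] [ChartedSpace E M]
variable {N : Type u} [TopologicalSpace N] [ChartedSpace E N]
variable {P : Type u} [TopologicalSpace P] [ChartedSpace E P]

instance : ∀ j, AddCommGroup (UCol E M j)
  | 0 => inferInstanceAs (AddCommGroup (SmoothU1 E M))
  | j + 1 => inferInstanceAs (AddCommGroup (DiffForm E M (j + 1)))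

instance : ∀ j, AddCommGroup (ZCol E M j)
  | 0 => inferInstanceAs (AddCommGroup (LocallyConstant M ℤ))
  | j + 1 => inferInstanceAs (AddCommGroup (DiffForm E M j))

/-- The differential of `U(1) → A^1 → A^2 → ⋯`: it is `-√-1 d log` followed by exterior
derivatives. -/
def UCol.d [IsManifold 𝓘(ℝ, E) ∞ M] : ∀ j, UCol E M j →+ UCol E M (j + 1)
  | 0 => (dlog : SmoothU1 E M →+ DiffForm E M 1)
  | j + 1 => (DiffForm.d (j + 1) : DiffForm E M (j + 1) →+ DiffForm E M (j + 2))

/-- The differential of `ℤ → A^0 → A^1 → ⋯`: it is the inclusion followed by exterior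
derivatives. -/
def ZCol.d [IsManifold 𝓘(ℝ, E) ∞ M] : ∀ j, ZCol E M j →+ ZCol E M (j + 1)
  | 0 => (DiffForm.ofInt : LocallyConstant M ℤ →+ DiffForm E M 0)
  | j + 1 => (DiffForm.d j : DiffForm E M j →+ DiffForm E M (j + 1))

/-- The pullback along a smooth map. -/
def UCol.pullback [IsManifold 𝓘(ℝ, E) ∞ M] [IsManifold 𝓘(ℝ, E) ∞ N]
    (f : C^∞⟮𝓘(ℝ, E), M; 𝓘(ℝ, E), N⟯) : ∀ j, UCol E N j →+ UCol E M j
  | 0 => SmoothU1.pullback f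
  | j + 1 => DiffForm.pullback f (j + 1)

/-- The pullback along a smooth map. -/
def ZCol.pullback [IsManifold 𝓘(ℝ, E) ∞ M] [IsManifold 𝓘(ℝ, E) ∞ N]
    (f : C^∞⟮𝓘(ℝ, E), M; 𝓘(ℝ, E), N⟯) : ∀ j, ZCol E N j →+ ZCol E M j
  | 0 => lcPullback ℤ ⟨f, f.contMDiff.continuous⟩
  | j + 1 => DiffForm.pullback f j

lemma UCol.d_d [IsManifold 𝓘(ℝ, E) ∞ M] :
    ∀ (j : ℕ) (x : UCol E M j), UCol.d (j + 1) (UCol.d j x) = 0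
  | 0, x => d_dlog x
  | _ + 1, x => DiffForm.d_d x

lemma ZCol.d_d [IsManifold 𝓘(ℝ, E) ∞ M] :
    ∀ (j : ℕ) (x : ZCol E M j), ZCol.d (j + 1) (ZCol.d j x) = 0
  | 0, x => DiffForm.d_ofInt x
  | _ + 1, x => DiffForm.d_d x

lemma UCol.d_pullback [IsManifold 𝓘(ℝ, E) ∞ M] [IsManifold 𝓘(ℝ, E) ∞ N]
    (f : C^∞⟮𝓘(ℝ, E), M; 𝓘(ℝ, E), N⟯) : ∀ (j : ℕ) (x : UCol E N j),
    UCol.d j (UCol.pullback f j x) = UCol.pullback f (j + 1) (UCol.d j x)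
  | 0, x => dlog_pullback f x
  | _ + 1, x => DiffForm.d_pullback f x

lemma ZCol.d_pullback [IsManifold 𝓘(ℝ, E) ∞ M] [IsManifold 𝓘(ℝ, E) ∞ N]
    (f : C^∞⟮𝓘(ℝ, E), M; 𝓘(ℝ, E), N⟯) : ∀ (j : ℕ) (x : ZCol E N j),
    ZCol.d j (ZCol.pullback f j x) = ZCol.pullback f (j + 1) (ZCol.d j x)
  | 0, x => (DiffForm.ofInt_pullback f x).symm
  | _ + 1, x => DiffForm.d_pullback f x

lemma UCol.pullback_comp [IsManifold 𝓘(ℝ, E) ∞ M] [IsManifold 𝓘(ℝ, E) ∞ N]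
    [IsManifold 𝓘(ℝ, E) ∞ P] (f : C^∞⟮𝓘(ℝ, E), M; 𝓘(ℝ, E), N⟯)
    (g : C^∞⟮𝓘(ℝ, E), N; 𝓘(ℝ, E), P⟯) : ∀ (j : ℕ) (x : UCol E P j),
    UCol.pullback f j (UCol.pullback g j x) = UCol.pullback (g.comp f) j x
  | 0, _ => rfl
  | _ + 1, x => DiffForm.pullback_comp f g x

lemma ZCol.pullback_comp [IsManifold 𝓘(ℝ, E) ∞ M] [IsManifold 𝓘(ℝ, E) ∞ N]
    [IsManifold 𝓘(ℝ, E) ∞ P] (f : C^∞⟮𝓘(ℝ, E), M; 𝓘(ℝ, E), N⟯)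
    (g : C^∞⟮𝓘(ℝ, E), N; 𝓘(ℝ, E), P⟯) : ∀ (j : ℕ) (x : ZCol E P j),
    ZCol.pullback f j (ZCol.pullback g j x) = ZCol.pullback (g.comp f) j x
  | 0, _ => rfl
  | _ + 1, x => DiffForm.pullback_comp f g x

/-- The maps `(exp(2π√-1 ·), 2π, 2π, …)` from the complex `A^0 → A^1 → ⋯` to the complex
`U(1) → A^1 → ⋯`. -/
def ZCol.toUCol [IsManifold 𝓘(ℝ, E) ∞ M] : ∀ j, ZCol E M (j + 1) →+ UCol E M j
  | 0 => (expU1 : DiffForm E M 0 →+ SmoothU1 E M)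
  | j + 1 => (DiffForm.scale (2 * Real.pi) (j + 1) :
      DiffForm E M (j + 1) →+ DiffForm E M (j + 1))

end Columns

namespace EtaleGroupoid

variable {E : Type} [NormedAddCommGroup E] [NormedSpace ℝ E] {G₀ G₁ : Type u}
variable [TopologicalSpace G₀] [ChartedSpace E G₀]
variable [TopologicalSpace G₁] [ChartedSpace E G₁]
variable (G : EtaleGroupoid E G₀ G₁)

/-- A groupoid is proper if `(s, t) : G₁ → G₀ × G₀` is proper. -/
def IsProper : Prop := IsProperMap fun a : G₁ => (G.s a, G.t a)

/-- A groupoid is Leray if every manifold `G_k` is a disjoint union of contractible open sets,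
that is, if its connected components are contractible. -/
def IsLeray : Prop := ∀ (k : ℕ) (x : G.Nerve k), ContractibleSpace (connectedComponent x)

/-- The orbit space of a groupoid: the quotient of the space of objects by the relation that
identifies the source and the target of every arrow. -/
abbrev OrbitSpace : Type u := Quot fun x y : G₀ => ∃ a : G₁, G.s a = x ∧ G.t a = y

variable [IsManifold 𝓘(ℝ, E) ∞ G₀]

/-- The face maps as smooth maps. -/
def smoothFace (k : ℕ) (i : Fin (k + 2)) :
    C^∞⟮𝓘(ℝ, E), G.Nerve (k + 1); 𝓘(ℝ, E), G.Nerve k⟯ :=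
  ⟨Nerve.face i, Nerve.contMDiff_face i⟩

lemma smoothFace_comp {k : ℕ} {i j : Fin (k + 2)} (h : i ≤ j) :
    (G.smoothFace k i).comp (G.smoothFace (k + 1) j.succ) =
      (G.smoothFace k j).comp (G.smoothFace (k + 1) i.castSucc) :=
  ContMDiffMap.ext fun p => Nerve.face_face h p

/-- The double complex `Γ(G_i, U(1)) → Γ(G_i, A^1) → Γ(G_i, A^2) → ⋯`, with differentials
`-√-1 d log` and `d` in the second direction, and the alternating sums of the pullbacks along the
face maps in the first direction. -/
def uDouble : DoubleCpx.{u} where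
  X i j := UCol E (G.Nerve i) j
  δ i j := altSum fun r : Fin (i + 2) => UCol.pullback (G.smoothFace i r) j
  d i j := UCol.d j
  δ_δ i j x := altSum_altSum _ _ (fun a b h x => by
    rw [UCol.pullback_comp, UCol.pullback_comp, G.smoothFace_comp h]) x
  d_d i j x := UCol.d_d j x
  d_δ i j x := map_altSum _ _ _ _ (fun r x => UCol.d_pullback _ j x) x

/-- The double complex `Γ(G_i, ℤ) → Γ(G_i, A^0) → Γ(G_i, A^1) → ⋯`, with the inclusion and the
exterior derivatives in the second direction, and the alternating sums of the pullbacks along the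
face maps in the first direction. -/
def zDouble : DoubleCpx.{u} where
  X i j := ZCol E (G.Nerve i) j
  δ i j := altSum fun r : Fin (i + 2) => ZCol.pullback (G.smoothFace i r) j
  d i j := ZCol.d j
  δ_δ i j x := altSum_altSum _ _ (fun a b h x => by
    rw [ZCol.pullback_comp, ZCol.pullback_comp, G.smoothFace_comp h]) x
  d_d i j x := ZCol.d_d j x
  d_δ i j x := map_altSum _ _ _ _ (fun r x => ZCol.d_pullback _ j x) x

/-- The complex `U(1)(n)` of Čech cochains with values in `U(1) → A^1 → ⋯ → A^{n-1}`, where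
`U(1)` stands for the sheaf of smooth functions with values in `U(1)`. -/
def cechU (n : ℕ) : CochainCpx.{u} := G.uDouble.tot n

/-- The complex `ℤ(n)` of Čech cochains with values in `ℤ → A^0 → ⋯ → A^{n-1}`; it consists of
`n + 1` columns. -/
def cechZ (n : ℕ) : CochainCpx.{u} := G.zDouble.tot (n + 1)

/-- The Čech complex `Γ(G_0, U(1)) → Γ(G_1, U(1)) → ⋯` of the sheaf of smooth functions with
values in `U(1)`. -/
def cechSmoothU1 : CochainCpx.{u} := G.uDouble.firstColumn

/-- The Čech complex of the constant sheaf with fibre `A`: its cochains of degree `k` are the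
locally constant functions on `G_k` with values in `A`. -/
def cechConst (A : Type) [AddCommGroup A] : CochainCpx.{u} where
  X k := LocallyConstant (G.Nerve k) A
  d k := altSum fun r : Fin (k + 2) => lcPullback A
    ⟨G.smoothFace k r, (G.smoothFace k r).contMDiff.continuous⟩
  d_d k x := altSum_altSum _ _ (fun a b h x => by
    refine LocallyConstant.ext fun p => ?_
    exact congrArg x (Nerve.face_face h p)) x

/-- The alternating sum of the pullbacks of smooth functions along the face maps. -/
def cechFun (k : ℕ) : DiffForm E (G.Nerve k) 0 →+ DiffForm E (G.Nerve (k + 1)) 0 :=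
  altSum fun r : Fin (k + 2) => DiffForm.pullback (G.smoothFace k r) 0

/-- The map of cochains of degree `k + 1` to cochains of degree `k`, `ℤ(n) → U(1)(n)`, which is
`exp(2π√-1 ·)` on functions, multiplication by `2π` on forms of positive degree, and which forgets
the component with values in `ℤ`. -/
def expMap (n k : ℕ) (x : (G.cechZ n).X (k + 1)) : (G.cechU n).X k := fun p =>
  ZCol.toUCol p.1.2 (DoubleCpx.Tot.comp (A := G.zDouble) x p.1.1 (p.1.2 + 1)
    (by have := p.2.1; omega) (by have := p.2.2; omega))

/-- The inclusion of the cochains with values in the locally constant functions into the cochains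
of `U(1)(n)`. -/
def inclConst (n k : ℕ) (x : (G.cechConst (Additive Circle)).X k) : (G.cechU n).X k :=
  G.uDouble.ofFirstColumn n k (SmoothU1.ofConst x : SmoothU1 E (G.Nerve k))

/-- The projection of the cochains of `U(1)(n)` to the cochains with values in the sheaf of smooth
functions with values in `U(1)`. -/
def projU1 {n : ℕ} (hn : 1 ≤ n) (k : ℕ) : (G.cechU n).X k → G.cechSmoothU1.X k :=
  G.uDouble.toFirstColumn hn k

end EtaleGroupoid

end

/-! The theorem combines two geometric inputs with homological algebra of double complexes whose
rows are complexes of sheaves and whose columns are Čech complexes of the nerve.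

Rows. Since `G` is Leray, every component of every `G_i` is contractible. A continuous contraction
is deformed, rel its ends, into a smooth one (`exists_contMDiff_eqOn`, `exists_smooth_contraction`).
These glue to a smooth homotopy from a locally constant map to the identity of `G_i`, and
integrating over the time variable shows that closed forms of positive degree are exact
(`exists_ext_eq_of_homotopy`, `HasPoincareLemma`). Hence each smooth function with values in `U(1)`
has a global logarithm, unique up to locally constant integers, and `U(1) → A^1 → A^2 → ⋯` is on
sections a resolution of the locally constant functions with values in `U(1)`.

Columns. Properness makes the orbit space Hausdorff; together with paracompactness this yields a
smooth function `c ≥ 0` on the objects whose sum over the arrows into each object is `1`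
(`IsProper.exists_isCutoff`). Averaging a form over the ways to prolong a string at its beginning,
with weight `c`, is a contracting homotopy, so the Čech complexes of forms are exact in positive
degrees (`exists_altSum_pullback_eq`).

Algebra. For 1, the map `(exp(2π√-1 ·), 2π, …)` from `ℤ(n)` to `U(1)(n)` is surjective and lowers
degrees by one. Its kernel consists of two copies of the integer column joined by the identity and
has no cohomology (`exists_equiv_shiftMap`). In degree `0` only the injectivity of `ℤ → A^0`
matters. For 2, all columns but the first are exact in positive degrees, so above the range of the
form degrees only the first column counts (`exists_equiv_toFirstColumn`); the exponential sequence
is exact on sections with acyclic middle term, so its connecting map is bijective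
(`exists_connecting_equiv`). For 3, truncation destroys exactness of the rows only at the last
column, which is invisible in degrees below `n - 1` (`exists_equiv_ofFirstColumn`). -/

noncomputable section

/-! ### Homological algebra: isomorphisms between cohomology groups. -/

section CohomologyAlgebra

universe w w'

/-- Two surjective homomorphisms with the same kernel have isomorphic targets. -/
lemma exists_addEquiv_of_surjective {P A B : Type*} [AddCommGroup P] [AddCommGroup A]
    [AddCommGroup B] (a : P →+ A) (b : P →+ B) (ha : Function.Surjective a)
    (hb : Function.Surjective b) (h : ∀ p, a p = 0 ↔ b p = 0) :
    ∃ e : A ≃+ B, ∀ p, e (a p) = b p := by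
  have hk : a.ker = b.ker := by
    ext p
    exact h p
  let ea := QuotientAddGroup.quotientKerEquivOfSurjective a ha
  let eb := QuotientAddGroup.quotientKerEquivOfSurjective b hb
  refine ⟨(ea.symm.trans (QuotientAddGroup.quotientAddEquivOfEq hk)).trans eb, fun p => ?_⟩
  have h1 : ea.symm (a p) = (p : P ⧸ a.ker) := by
    rw [AddEquiv.symm_apply_eq]
    rfl
  simp only [AddEquiv.trans_apply, h1]
  rfl

namespace CochainCpx

variable {C : CochainCpx.{w}} {D : CochainCpx.{w'}}

lemma exists_cls {k : ℕ} (x : C.H k) : ∃ (z : C.X k) (hz : C.d k z = 0), C.cls z hz = x := by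
  obtain ⟨⟨z, hz⟩, rfl⟩ := QuotientAddGroup.mk_surjective x
  exact ⟨z, hz, rfl⟩

lemma cls_eq_zero_iff {k : ℕ} {z : C.X k} (hz : C.d k z = 0) :
    C.cls z hz = 0 ↔ z ∈ C.coboundaries k := by
  unfold cls
  rw [QuotientAddGroup.eq_zero_iff, AddSubgroup.mem_addSubgroupOf]

lemma cls_eq_cls_of_sub_mem {k : ℕ} {z w : C.X k} (hz : C.d k z = 0) (hw : C.d k w = 0)
    (h : z - w ∈ C.coboundaries k) : C.cls z hz = C.cls w hw := by
  have hzw : C.d k (z - w) = 0 := by rw [map_sub, hz, hw, sub_zero]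
  rw [← sub_eq_zero]
  exact (cls_eq_zero_iff hzw).2 h

lemma d_eq_zero_of_mem_coboundaries : ∀ {k : ℕ} {z : C.X k}, z ∈ C.coboundaries k → C.d k z = 0
  | 0, z, h => by
    rw [show z = 0 from h, map_zero]
  | k + 1, z, h => by
    obtain ⟨y, rfl⟩ := h
    exact C.d_d k y

/-- The homomorphism from cocycles to cohomology. -/
def clsHom (C : CochainCpx.{w}) (k : ℕ) : C.cocycles k →+ C.H k := QuotientAddGroup.mk' _

/-- A cochain homomorphism in a single degree that is bijective modulo coboundaries induces an
isomorphism of cohomology groups. -/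
lemma exists_addEquiv_induces {k l : ℕ} (φ : C.X k →+ D.X l)
    (hφ : ∀ z, C.d k z = 0 → D.d l (φ z) = 0)
    (hcob : ∀ z ∈ C.coboundaries k, φ z ∈ D.coboundaries l)
    (hinj : ∀ z, C.d k z = 0 → φ z ∈ D.coboundaries l → z ∈ C.coboundaries k)
    (hsurj : ∀ w, D.d l w = 0 → ∃ z, C.d k z = 0 ∧ w - φ z ∈ D.coboundaries l) :
    ∃ e : C.H k ≃+ D.H l, Induces φ e := by
  let ψ : C.cocycles k →+ D.cocycles l :=
    (φ.comp (C.cocycles k).subtype).codRestrict (D.cocycles l) fun z => hφ z.1 z.2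
  -- Both cohomology groups become quotients of the cocycles of `C`, with equal kernels by `hcob`
  -- and `hinj`. Only the one degree matters, so `φ` may also shift degrees.
  obtain ⟨e, he⟩ := exists_addEquiv_of_surjective (C.clsHom k) ((D.clsHom l).comp ψ)
    (QuotientAddGroup.mk'_surjective _) (fun y => by
      obtain ⟨w, hw, rfl⟩ := exists_cls y
      obtain ⟨z, hz, h⟩ := hsurj w hw
      exact ⟨⟨z, hz⟩, (cls_eq_cls_of_sub_mem hw (hφ z hz) h).symm⟩)
    (fun z => by
      have h1 := cls_eq_zero_iff (C := C) (z := z.1) z.2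
      have h2 := cls_eq_zero_iff (C := D) (z := φ z.1) (hφ z.1 z.2)
      exact h1.trans (Iff.trans ⟨hcob z.1, hinj z.1 z.2⟩ h2.symm))
  exact ⟨e, fun z hz => ⟨hφ z hz, he ⟨z, hz⟩⟩⟩

end CochainCpx

/-! ### Total complexes of truncated double complexes. -/

namespace DoubleCpx

variable {A : DoubleCpx.{w}} {B : DoubleCpx.{w'}}

lemma Tot.ext {n k : ℕ} {x y : A.Tot n k}
    (h : ∀ i j (h : i + j = k) (hj : j < n), x.comp i j h hj = y.comp i j h hj) : x = y :=
  funext fun p => h p.1.1 p.1.2 p.2.1 p.2.2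

/-- The total cochain with a single component. -/
def Tot.single {n k : ℕ} (i j : ℕ) (h : i + j = k) (hj : j < n) (x : A.X i j) : A.Tot n k :=
  Pi.single (M := fun p : {p : ℕ × ℕ // p.1 + p.2 = k ∧ p.2 < n} => A.X p.1.1 p.1.2)
    ⟨(i, j), h, hj⟩ x

lemma Tot.comp_single_same {n k : ℕ} (i j : ℕ) (h : i + j = k) (hj : j < n) (x : A.X i j) :
    (Tot.single i j h hj x).comp i j h hj = x :=
  Pi.single_eq_same (M := fun p : {p : ℕ × ℕ // p.1 + p.2 = k ∧ p.2 < n} => A.X p.1.1 p.1.2) _ _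

lemma Tot.comp_single_of_ne {n k : ℕ} {i j i' j' : ℕ} (h : i + j = k) (hj : j < n) (x : A.X i j)
    (h' : i' + j' = k) (hj' : j' < n) (hne : j' ≠ j) :
    (Tot.single i j h hj x).comp i' j' h' hj' = 0 := by
  refine Pi.single_eq_of_ne
    (M := fun p : {p : ℕ × ℕ // p.1 + p.2 = k ∧ p.2 < n} => A.X p.1.1 p.1.2) (fun he => hne ?_) _
  exact congrArg (fun p : {p : ℕ × ℕ // p.1 + p.2 = k ∧ p.2 < n} => p.1.2) he

lemma Tot.comp_add {n k : ℕ} (x y : A.Tot n k) (i j : ℕ) (h : i + j = k) (hj : j < n) :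
    (x + y).comp i j h hj = x.comp i j h hj + y.comp i j h hj := rfl

lemma Tot.comp_sub {n k : ℕ} (x y : A.Tot n k) (i j : ℕ) (h : i + j = k) (hj : j < n) :
    (x - y).comp i j h hj = x.comp i j h hj - y.comp i j h hj := rfl

lemma Tot.comp_zero {n k : ℕ} (i j : ℕ) (h : i + j = k) (hj : j < n) :
    (0 : A.Tot n k).comp i j h hj = 0 := rfl

/-- This and the next two lemmas list all components of the coboundary of a one-component cochain.
They are the tool for changing a total cochain one component at a time. -/
lemma totD_single_left {n k : ℕ} (i j : ℕ) (h : i + j = k) (hj : j < n) (x : A.X i j) :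
    (A.totD n k (Tot.single i j h hj x)).comp (i + 1) j (by omega) hj = A.δ i j x := by
  rw [totD_comp]
  cases j with
  | zero => simp only [totDComp, Tot.comp_single_same]
  | succ j =>
    simp only [totDComp, Tot.comp_single_same]
    rw [Tot.comp_single_of_ne _ _ _ _ _ (by omega), map_zero, smul_zero, add_zero]

lemma totD_single_right {n k : ℕ} (i j : ℕ) (h : i + j = k) (hj : j + 1 < n) (x : A.X i j) :
    (A.totD n k (Tot.single i j h (by omega) x)).comp i (j + 1) (by omega) hj =
      (-1 : ℤ) ^ i • A.d i j x := by
  rw [totD_comp]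
  cases i with
  | zero => simp only [totDComp, Tot.comp_single_same, pow_zero, one_smul]
  | succ i =>
    simp only [totDComp, Tot.comp_single_same]
    rw [Tot.comp_single_of_ne _ _ _ _ _ (by omega), map_zero, zero_add]

lemma totD_single_of_ne {n k : ℕ} (i j : ℕ) (h : i + j = k) (hj : j < n) (x : A.X i j)
    (i' j' : ℕ) (h' : i' + j' = k + 1) (hj' : j' < n) (h1 : j' ≠ j) (h2 : j' ≠ j + 1) :
    (A.totD n k (Tot.single i j h hj x)).comp i' j' h' hj' = 0 := by
  rw [totD_comp]
  match i', j', h', hj', h1, h2 with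
  | 0, 0, _, _, _, _ => rfl
  | i' + 1, 0, _, _, _, _ =>
    simp only [totDComp]
    rw [Tot.comp_single_of_ne _ _ _ _ _ (by omega), map_zero]
  | 0, j' + 1, _, _, _, _ =>
    simp only [totDComp]
    rw [Tot.comp_single_of_ne _ _ _ _ _ (by omega), map_zero]
  | i' + 1, j' + 1, _, _, _, _ =>
    simp only [totDComp]
    rw [Tot.comp_single_of_ne _ _ _ _ _ (by omega), Tot.comp_single_of_ne _ _ _ _ _ (by omega),
      map_zero, map_zero, smul_zero, add_zero]

/-- If the rows of a double complex are exact outside of the first and the last column, then a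
total cochain whose coboundary lies in the first column is cohomologous to a cochain in the first
column. -/
lemma exists_coboundary_sub_firstColumn {n m : ℕ} (hm : m + 1 < n)
    (hrow : ∀ i j, j + 2 < n → ∀ x : A.X i (j + 1), A.d i (j + 1) x = 0 → ∃ y, A.d i j y = x)
    (y : A.Tot n m)
    (hy : ∀ i j (h : i + (j + 1) = m + 1) (hj : j + 1 < n),
      (A.totD n m y).comp i (j + 1) h hj = 0) :
    ∃ v : A.Tot n m, v ∈ (A.tot n).coboundaries m ∧ ∀ i j (h : i + (j + 1) = m) (hj : j + 1 < n),
      (y - v : A.Tot n m).comp i (j + 1) h hj = 0 := by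
  cases m with
  | zero => exact ⟨0, zero_mem _, fun i j h => by omega⟩
  | succ k =>
  -- Components are removed in order of increasing `i`, that is, from the highest second degree
  -- downwards. After `k + 1` steps only `i = k + 1`, the first column, is left.
  suffices hs : ∀ s, s ≤ k + 1 → ∃ v : A.Tot n (k + 1), v ∈ (A.tot n).coboundaries (k + 1) ∧
      ∀ i j (h : i + j = k + 1) (hj : j < n), i < s → (y - v : A.Tot n (k + 1)).comp i j h hj = 0 by
    obtain ⟨v, hv, h⟩ := hs (k + 1) le_rfl
    exact ⟨v, hv, fun i j h' hj => h i (j + 1) h' hj (by omega)⟩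
  intro s
  induction s with
  | zero => exact fun _ => ⟨0, zero_mem _, fun i j h hj hi => by omega⟩
  | succ s ih =>
    intro hsk
    obtain ⟨v, hv, h0⟩ := ih (by omega)
    set y' : A.Tot n (k + 1) := y - v with hy'
    have hDy : A.totD n (k + 1) y' = A.totD n (k + 1) y := by
      rw [hy', map_sub]
      have := CochainCpx.d_eq_zero_of_mem_coboundaries hv
      rw [show A.totD n (k + 1) v = 0 from this, sub_zero]
    obtain ⟨j, hj⟩ : ∃ j, s + (j + 1) = k + 1 := ⟨k - s, by omega⟩
    have hd : A.d s (j + 1) (y'.comp s (j + 1) hj (by omega)) = 0 := by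
      -- In degree `(s, j + 2)` the coboundary is `±d` of the component to be removed plus `δ` of a
      -- component that already vanishes, so the former is closed for `d`.
      have h1 := hy s (j + 1) (by omega) (by omega)
      rw [← hDy, totD_comp] at h1
      cases s with
      | zero => exact h1
      | succ s =>
        simp only [totDComp] at h1
        rw [h0 s _ _ _ (by omega), map_zero, zero_add] at h1
        rcases neg_one_pow_eq_or ℤ (s + 1) with h2 | h2 <;> rw [h2] at h1 <;> simpa using h1
    obtain ⟨x, hx⟩ := hrow s j (by omega) _ hd
    -- The factor `(-1)^s` cancels the sign of `d` in row `s`. The other component of this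
    -- coboundary lies in row `s + 1`, which is treated later.
    refine ⟨v + A.totD n k (Tot.single s j (by omega) (by omega) ((-1 : ℤ) ^ s • x)),
      add_mem hv ⟨_, rfl⟩, fun i j' h hj' hi => ?_⟩
    rw [← sub_sub, Tot.comp_sub, ← hy']
    by_cases his : i = s
    · subst his
      obtain rfl : j' = j + 1 := by omega
      rw [totD_single_right, map_zsmul, smul_smul, ← mul_pow, hx]
      simp
    · rw [h0 i j' h hj' (by omega), totD_single_of_ne _ _ _ _ _ _ _ _ _ (by omega) (by omega),
        sub_zero]

/-- If the columns of a double complex other than the first one are exact in positive degrees,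
then a total cocycle of high degree whose component in the first column vanishes is the coboundary
of a cochain whose component in the first column vanishes. -/
lemma exists_totD_eq_of_firstColumn_eq_zero {n m : ℕ} (hm : n ≤ m + 1)
    (hcol : ∀ i j, j + 1 < n → ∀ x : A.X (i + 1) (j + 1), A.δ (i + 1) (j + 1) x = 0 →
      ∃ y, A.δ i (j + 1) y = x)
    (w : A.Tot n (m + 1)) (hw : A.totD n (m + 1) w = 0)
    (hw0 : ∀ i (h : i + 0 = m + 1) (hj : 0 < n), w.comp i 0 h hj = 0) :
    ∃ y : A.Tot n m, A.totD n m y = w ∧ ∀ i (h : i + 0 = m) (hj : 0 < n), y.comp i 0 h hj = 0 := by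
  suffices hs : ∀ s, s < n → ∃ y : A.Tot n m,
      (∀ i (h : i + 0 = m) (hj : 0 < n), y.comp i 0 h hj = 0) ∧
      ∀ i j (h : i + j = m + 1) (hj : j < n), j ≤ s →
        (w - A.totD n m y).comp i j h hj = 0 by
    rcases Nat.eq_zero_or_pos n with rfl | hn
    · exact ⟨0, Tot.ext fun i j h hj => by omega, fun i h hj => by omega⟩
    · obtain ⟨y, hy, h⟩ := hs (n - 1) (by omega)
      refine ⟨y, (sub_eq_zero.1 (Tot.ext fun i j h' hj => ?_)).symm, hy⟩
      exact h i j h' hj (by omega)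
  intro s
  induction s with
  | zero =>
    refine fun _ => ⟨0, fun _ _ _ => rfl, fun i j h hj hj0 => ?_⟩
    obtain rfl : j = 0 := by omega
    rw [map_zero, sub_zero, hw0]
  | succ s ih =>
    intro hsn
    obtain ⟨y, hy, h0⟩ := ih (by omega)
    set w' : A.Tot n (m + 1) := w - A.totD n m y with hw'
    have hDw : A.totD n (m + 1) w' = 0 := by
      rw [hw', map_sub, hw, totD_totD, sub_zero]
    -- The bound `n ≤ m + 1` enters here: in every column `s + 1 < n` the component of `w` has
    -- positive first degree, where the column is exact.
    obtain ⟨i, hi⟩ : ∃ i, i + 1 + (s + 1) = m + 1 := ⟨m - (s + 1), by omega⟩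
    have hd : A.δ (i + 1) (s + 1) (w'.comp (i + 1) (s + 1) hi hsn) = 0 := by
      have h1 : (A.totD n (m + 1) w').comp (i + 2) (s + 1) (by omega) hsn = 0 := by
        rw [hDw]
        rfl
      rw [totD_comp] at h1
      simp only [totDComp] at h1
      rwa [h0 _ s _ _ le_rfl, map_zero, smul_zero, add_zero] at h1
    obtain ⟨x, hx⟩ := hcol i s hsn _ hd
    refine ⟨y + Tot.single i (s + 1) (by omega) hsn x, fun i' h hj => ?_,
      fun i' j' h hj' hjs => ?_⟩
    · rw [Tot.comp_add, hy, Tot.comp_single_of_ne _ _ _ _ _ (by omega), add_zero]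
    · rw [map_add, ← sub_sub, Tot.comp_sub, ← hw']
      by_cases hjs' : j' = s + 1
      · subst hjs'
        obtain rfl : i' = i + 1 := by omega
        rw [totD_single_left, hx, sub_self]
      · rw [h0 i' j' h hj' (by omega), totD_single_of_ne _ _ _ _ _ _ _ _ _ (by omega) (by omega),
          sub_zero]

lemma eq_single_zero {n k : ℕ} (hn : 0 < n) (x : A.Tot n k)
    (hx : ∀ i j (h : i + (j + 1) = k) (hj : j + 1 < n), x.comp i (j + 1) h hj = 0) :
    x = Tot.single k 0 rfl hn (x.comp k 0 rfl hn) := by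
  refine Tot.ext fun i j h hj => ?_
  cases j with
  | zero =>
    obtain rfl : i = k := h
    rw [Tot.comp_single_same]
  | succ j => rw [hx i j h hj, Tot.comp_single_of_ne _ _ _ _ _ (by omega)]

lemma ofFirstColumn_eq_single {n k : ℕ} (hn : 0 < n) (x : A.X k 0) :
    A.ofFirstColumn n k x = Tot.single k 0 rfl hn x := by
  refine Tot.ext fun i j h hj => ?_
  cases j with
  | zero =>
    obtain rfl : i = k := h
    exact (Tot.comp_single_same i 0 rfl hn x).symm
  | succ j => exact (Tot.comp_single_of_ne rfl hn x h hj (by omega)).symm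

/-- If all columns other than the first one are exact in positive degrees, then the projection to
the first column is an isomorphism on cohomology in high degrees. -/
theorem exists_equiv_toFirstColumn {n k : ℕ} (hn : 1 ≤ n) (hk : n ≤ k)
    (hcol : ∀ i j, j + 1 < n → ∀ x : A.X (i + 1) (j + 1), A.δ (i + 1) (j + 1) x = 0 →
      ∃ y, A.δ i (j + 1) y = x) :
    ∃ e : (A.tot n).H k ≃+ A.firstColumn.H k, CochainCpx.Induces (A.toFirstColumn hn k) e := by
  obtain ⟨k, rfl⟩ : ∃ m, k = m + 1 := ⟨k - 1, by omega⟩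
  let φ : ∀ m, A.Tot n m →+ A.X m 0 := fun m =>
    { toFun := fun x => x.comp m 0 rfl hn, map_zero' := rfl, map_add' := fun _ _ => rfl }
  have hφ : ∀ m x, φ (m + 1) (A.totD n m x) = A.δ m 0 (φ m x) := fun m x => rfl
  have hφs : ∀ m x, φ m (Tot.single m 0 rfl hn x) = x := fun m x =>
    Tot.comp_single_same m 0 rfl hn x
  refine CochainCpx.exists_addEquiv_induces (C := A.tot n) (D := A.firstColumn) (φ (k + 1))
    (fun (z : A.Tot n (k + 1)) (hz : A.totD n (k + 1) z = 0) => ?_) (fun z hz => ?_)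
    (fun (z : A.Tot n (k + 1)) (hz : A.totD n (k + 1) z = 0) hc => ?_)
    (fun (u : A.X (k + 1) 0) (hu : A.δ (k + 1) 0 u = 0) => ?_)
  · change A.δ (k + 1) 0 (φ (k + 1) z) = 0
    rw [← hφ, hz, map_zero]
  · obtain ⟨y, rfl⟩ := hz
    exact ⟨φ k y, hφ k y⟩
  -- Subtracting the total coboundary of `x` clears the first column of `z`; the exact columns take
  -- care of the rest.
  · obtain ⟨(x : A.X k 0), (hx : A.δ k 0 x = φ (k + 1) z)⟩ := hc
    obtain ⟨y, hy, -⟩ := exists_totD_eq_of_firstColumn_eq_zero (A := A) (n := n) (m := k) hk hcol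
      (z - A.totD n k (Tot.single k 0 rfl hn x)) (by rw [map_sub, totD_totD, hz, sub_zero])
      (fun i h hj => by
        obtain rfl : i = k + 1 := h
        rw [Tot.comp_sub, totD_single_left, hx]
        exact sub_self _)
    refine ⟨y + Tot.single k 0 rfl hn x, ?_⟩
    change A.totD n k (y + Tot.single k 0 rfl hn x) = z
    rw [map_add, hy, sub_add_cancel]
  -- A cocycle `u` of the first column is prolonged to a total cocycle: the total coboundary of `u`
  -- has no component in the first column, so it is also the coboundary of some `y` without such a
  -- component, and `u - y` is a cocycle over `u`.
  · obtain ⟨y, hy, hy0⟩ := exists_totD_eq_of_firstColumn_eq_zero (A := A) (n := n) (m := k + 1)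
      (by omega) hcol (A.totD n (k + 1) (Tot.single (k + 1) 0 rfl hn u)) (totD_totD _ _)
      (fun i h hj => by
        obtain rfl : i = k + 1 + 1 := h
        rw [totD_single_left, hu])
    refine ⟨(Tot.single (k + 1) 0 rfl hn u - y : A.Tot n (k + 1)), ?_, ?_⟩
    · change A.totD n (k + 1) (Tot.single (k + 1) 0 rfl hn u - y) = 0
      rw [map_sub, hy, sub_self]
    · have h1 : φ (k + 1) (Tot.single (k + 1) 0 rfl hn u - y) = u := by
        rw [map_sub, hφs, show φ (k + 1) y = 0 from hy0 _ rfl hn, sub_zero]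
      have h2 : u - φ (k + 1) (Tot.single (k + 1) 0 rfl hn u - y) = A.δ k 0 0 := by
        rw [h1, sub_self, map_zero]
      exact ⟨0, h2.symm⟩

/-- If the rows of a double complex are resolutions of the subcomplex `ι : K → A` of the first
column, except at the last column, then `ι` induces isomorphisms on cohomology in low degrees. -/
theorem exists_equiv_ofFirstColumn {n k : ℕ} (hk : k + 1 < n) (K : CochainCpx.{w})
    (ι : ∀ m, K.X m →+ A.X m 0) (hι : ∀ m x, ι (m + 1) (K.d m x) = A.δ m 0 (ι m x))
    (hinj : ∀ m, Function.Injective (ι m)) (hdι : ∀ m x, A.d m 0 (ι m x) = 0)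
    (hker : ∀ m x, A.d m 0 x = 0 → ∃ y, ι m y = x)
    (hrow : ∀ i j, j + 2 < n → ∀ x : A.X i (j + 1), A.d i (j + 1) x = 0 → ∃ y, A.d i j y = x) :
    ∃ e : K.H k ≃+ (A.tot n).H k,
      CochainCpx.Induces (C := K) (D := A.tot n) (fun x => A.ofFirstColumn n k (ι k x)) e := by
  have hn : 0 < n := by omega
  let φ : ∀ m, K.X m →+ A.Tot n m := fun m => AddMonoidHom.mk'
    (fun x => Tot.single m 0 rfl hn (ι m x)) fun x y => by
      rw [map_add]
      exact Pi.single_add _ _ _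
  have hφ0 : ∀ m x, (φ m x).comp m 0 rfl hn = ι m x := fun m x => Tot.comp_single_same _ _ _ _ _
  have hφs : ∀ m x i j h hj, (φ m x).comp i (j + 1) h hj = 0 := fun m x i j h hj =>
    Tot.comp_single_of_ne rfl hn (ι m x) h hj (by omega)
  have hφi : ∀ m, Function.Injective (φ m) := fun m x y h => by
    refine hinj m ?_
    rw [← hφ0 m x, h, hφ0]
  have hφ : ∀ m x, φ (m + 1) (K.d m x) = A.totD n m (φ m x) := fun m x => by
    refine Tot.ext fun i j h hj => ?_
    match j, h, hj with
    | 0, h, hj =>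
      obtain rfl : i = m + 1 := by omega
      rw [hφ0, hι]
      exact (totD_single_left _ 0 rfl hn (ι _ x)).symm
    | 1, h, hj =>
      obtain rfl : i = m := by omega
      rw [hφs]
      refine Eq.trans ?_ (totD_single_right _ 0 rfl hj (ι _ x)).symm
      rw [hdι, smul_zero]
    | j + 2, h, hj =>
      rw [hφs]
      exact (totD_single_of_ne m 0 rfl hn (ι m x) i (j + 2) h hj (by omega) (by omega)).symm
  -- Once `y` has been moved into the first column, the column `1` of its coboundary says that its
  -- only component is killed by `d`, hence comes from `K`. Surjectivity applies this to a cocycle,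
  -- injectivity to a total primitive of an element of `K`.
  have hclean : ∀ m, m + 1 < n → ∀ y : A.Tot n m, (∀ i j (h : i + (j + 1) = m + 1)
      (hj : j + 1 < n), (A.totD n m y).comp i (j + 1) h hj = 0) →
      ∃ (x : K.X m) (v : A.Tot n m), v ∈ (A.tot n).coboundaries m ∧ y - v = φ m x := by
    intro m hm y hy
    obtain ⟨v, hv, h⟩ := exists_coboundary_sub_firstColumn hm hrow y hy
    have h1 := eq_single_zero hn (y - v) h
    have h2 : A.totD n m (y - v) = A.totD n m y := by
      rw [map_sub, show A.totD n m v = 0 from CochainCpx.d_eq_zero_of_mem_coboundaries hv, sub_zero]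
    have h3 := hy m 0 rfl (by omega)
    rw [← h2, h1, totD_single_right] at h3
    obtain ⟨x, hx⟩ := hker m ((y - v).comp m 0 rfl hn) (by
      rcases neg_one_pow_eq_or ℤ m with h2 | h2 <;> rw [h2] at h3 <;> simpa using h3)
    refine ⟨x, v, hv, h1.trans ?_⟩
    rw [← hx]
    rfl
  have hfun : (fun x => A.ofFirstColumn n k (ι k x)) = φ k :=
    funext fun x => ofFirstColumn_eq_single hn _
  rw [hfun]
  refine CochainCpx.exists_addEquiv_induces (C := K) (D := A.tot n) (φ k)
    (fun z hz => ?_) (fun z hz => ?_) (fun z hz hc => ?_)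
    (fun (w : A.Tot n k) (hw : A.totD n k w = 0) => ?_)
  · change A.totD n k (φ k z) = 0
    rw [← hφ, hz, map_zero]
  · cases k with
    | zero =>
      change φ 0 z = 0
      rw [show z = 0 from hz, map_zero]
    | succ k =>
      obtain ⟨y, rfl⟩ := hz
      exact ⟨φ k y, (hφ k y).symm⟩
  · cases k with
    | zero => exact hφi 0 ((show φ 0 z = 0 from hc).trans (map_zero _).symm)
    | succ k =>
      obtain ⟨(y : A.Tot n k), (hy : A.totD n k y = φ (k + 1) z)⟩ := hc
      obtain ⟨x, v, hv, hx⟩ := hclean k (by omega) y (fun i j h hj => by rw [hy, hφs])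
      refine ⟨x, hφi _ ?_⟩
      rw [hφ, ← hx, map_sub, hy,
        show A.totD n k v = 0 from CochainCpx.d_eq_zero_of_mem_coboundaries hv, sub_zero]
  · obtain ⟨x, v, hv, hx⟩ := hclean k hk w (fun i j h hj => by rw [hw, Tot.comp_zero])
    refine ⟨x, hφi _ ?_, ?_⟩
    · rw [hφ, ← hx, map_sub, hw,
        show A.totD n k v = 0 from CochainCpx.d_eq_zero_of_mem_coboundaries hv, sub_zero, map_zero]
    · have h1 : w - φ k x = v := by rw [← hx, sub_sub_cancel]
      exact Eq.mpr (congrArg (· ∈ (A.tot n).coboundaries k) h1) hv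

/-- The map of total complexes of degree `-1` given by maps that lower the second degree. -/
def shiftMap (e : ∀ i j, A.X i (j + 1) →+ B.X i j) (n k : ℕ) :
    A.Tot (n + 1) (k + 1) →+ B.Tot n k :=
  AddMonoidHom.mk' (fun x p => e p.1.1 p.1.2 (x.comp p.1.1 (p.1.2 + 1)
    (by have := p.2.1; omega) (by have := p.2.2; omega))) fun x y => by
      refine Tot.ext fun i j h hj => ?_
      exact map_add (e i j) _ _

lemma shiftMap_comp (e : ∀ i j, A.X i (j + 1) →+ B.X i j) {n k : ℕ} (x : A.Tot (n + 1) (k + 1))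
    (i j : ℕ) (h : i + j = k) (hj : j < n) :
    (shiftMap e n k x).comp i j h hj = e i j (x.comp i (j + 1) (by omega) (by omega)) := rfl

/-- The sign `(-1)^i` depends on the first degree alone, which the shift preserves, so no extra sign
appears. Column `0` of `A` contributes to column `1` through `d` only, and `hzero` removes that
term. -/
lemma shiftMap_totD (e : ∀ i j, A.X i (j + 1) →+ B.X i j)
    (hδ : ∀ i j x, e (i + 1) j (A.δ i (j + 1) x) = B.δ i j (e i j x))
    (hd : ∀ i j x, e i (j + 1) (A.d i (j + 1) x) = B.d i j (e i j x))
    (hzero : ∀ i x, e i 0 (A.d i 0 x) = 0) {n k : ℕ} (x : A.Tot (n + 1) (k + 1)) :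
    shiftMap e n (k + 1) (A.totD (n + 1) (k + 1) x) = B.totD n k (shiftMap e n k x) := by
  refine Tot.ext fun i j h hj => ?_
  rw [shiftMap_comp, totD_comp, totD_comp]
  match i, j, h, hj with
  | 0, 0, h, hj => omega
  | i + 1, 0, h, hj =>
    simp only [totDComp, map_add, map_zsmul, hzero, hδ, smul_zero, add_zero]
    rfl
  | 0, j + 1, h, hj =>
    simp only [totDComp, hd]
    rfl
  | i + 1, j + 1, h, hj =>
    simp only [totDComp, map_add, map_zsmul, hδ, hd]
    rfl

lemma shiftMap_surjective (e : ∀ i j, A.X i (j + 1) →+ B.X i j)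
    (he : ∀ i j, Function.Surjective (e i j)) (n k : ℕ) :
    Function.Surjective (shiftMap e n k) := by
  intro z
  choose r hr using he
  let x : A.Tot (n + 1) (k + 1) := fun p => match p with
    | ⟨(_, 0), _⟩ => 0
    | ⟨(i, j + 1), h⟩ => r i j (z.comp i j (by have := h.1; omega) (by have := h.2; omega))
  refine ⟨x, Tot.ext fun i j h hj => ?_⟩
  rw [shiftMap_comp]
  exact hr i j _

/-- A total cochain that is killed by the shift differs by a coboundary from one that is
concentrated in the first column. -/
lemma exists_sub_eq_single_of_shiftMap_eq_zero (e : ∀ i j, A.X i (j + 1) →+ B.X i j)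
    (hker : ∀ i x, e i 0 x = 0 → ∃ y, A.d i 0 y = x)
    (hinj : ∀ i j, Function.Injective (e i (j + 1))) {n k : ℕ} (hn : 0 < n)
    (x : A.Tot (n + 1) (k + 1)) (hx : shiftMap e n k x = 0) :
    ∃ (y : A.Tot (n + 1) k) (u : A.X (k + 1) 0),
      (∀ i j h hj, y.comp i (j + 1) h hj = 0) ∧
      x - A.totD (n + 1) k y = Tot.single (k + 1) 0 rfl (by omega) u := by
  have h0 : ∀ i j h hj, e i j (x.comp i (j + 1) h hj) = 0 := fun i j h hj => by
    have h1 := shiftMap_comp e x i j (by omega) (by omega)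
    rw [hx, Tot.comp_zero] at h1
    exact h1.symm
  -- As `e` is injective beyond column `1`, the cochain `x` has components in the columns `0` and
  -- `1` only, and the latter is `d u`.
  obtain ⟨u, hu⟩ := hker k _ (h0 k 0 rfl (by omega))
  refine ⟨Tot.single k 0 rfl (by omega) ((-1 : ℤ) ^ k • u), _,
    fun i j h hj => Tot.comp_single_of_ne _ _ _ _ _ (by omega), eq_single_zero (by omega) _ fun i j h hj => ?_⟩
  rw [Tot.comp_sub]
  cases j with
  | zero =>
    obtain rfl : i = k := by omega
    rw [totD_single_right, map_zsmul, smul_smul, ← mul_pow, hu]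
    simp
  | succ j =>
    rw [totD_single_of_ne _ _ _ _ _ _ _ _ _ (by omega) (by omega), sub_zero]
    refine hinj i j ?_
    rw [h0, map_zero]

/-- The shift of a resolution by its first term is an isomorphism on cohomology. -/
theorem exists_equiv_shiftMap (e : ∀ i j, A.X i (j + 1) →+ B.X i j)
    (hδ : ∀ i j x, e (i + 1) j (A.δ i (j + 1) x) = B.δ i j (e i j x))
    (hd : ∀ i j x, e i (j + 1) (A.d i (j + 1) x) = B.d i j (e i j x))
    (hzero : ∀ i x, e i 0 (A.d i 0 x) = 0)
    (he : ∀ i j, Function.Surjective (e i j))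
    (hker : ∀ i x, e i 0 x = 0 → ∃ y, A.d i 0 y = x)
    (hinj : ∀ i j, Function.Injective (e i (j + 1)))
    (hdinj : ∀ i, Function.Injective (A.d i 0)) {n : ℕ} (hn : 0 < n) (k : ℕ) :
    ∃ f : (A.tot (n + 1)).H (k + 1) ≃+ (B.tot n).H k,
      CochainCpx.Induces (C := A.tot (n + 1)) (D := B.tot n) (shiftMap e n k) f := by
  have hcomm := @shiftMap_totD _ _ e hδ hd hzero
  -- The first column contains no nonzero total cocycles, because `A.d m 0` is injective. Together
  -- with the preceding lemma this makes the kernel of the shift acyclic, which is `hcl`.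
  have hsingle : ∀ m (u : A.X m 0), A.totD (n + 1) m (Tot.single m 0 rfl (by omega) u) = 0 →
      u = 0 := fun m u hu => by
    have h1 := totD_single_right (n := n + 1) (k := m) m 0 rfl (by omega) u
    rw [hu, Tot.comp_zero] at h1
    refine hdinj m ?_
    rw [map_zero]
    rcases neg_one_pow_eq_or ℤ m with h2 | h2 <;> rw [h2] at h1 <;> simpa using h1.symm
  have hcl : ∀ m (x : A.Tot (n + 1) (m + 1)), A.totD (n + 1) (m + 1) x = 0 →
      shiftMap e n m x = 0 → ∃ y, A.totD (n + 1) m y = x := by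
    intro m x hx hx0
    obtain ⟨y, u, -, h⟩ := exists_sub_eq_single_of_shiftMap_eq_zero e hker hinj hn x hx0
    have hu : u = 0 := hsingle (m + 1) u (by rw [← h, map_sub, hx, totD_totD, sub_zero])
    refine ⟨y, ?_⟩
    rw [hu] at h
    refine (sub_eq_zero.1 (h.trans ?_)).symm
    exact Pi.single_zero _
  refine CochainCpx.exists_addEquiv_induces (C := A.tot (n + 1)) (D := B.tot n) (shiftMap e n k)
    (fun (z : A.Tot (n + 1) (k + 1)) (hz : A.totD (n + 1) (k + 1) z = 0) => ?_) (fun z hz => ?_)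
    (fun (z : A.Tot (n + 1) (k + 1)) (hz : A.totD (n + 1) (k + 1) z = 0) hc => ?_)
    (fun (w : B.Tot n k) (hw : B.totD n k w = 0) => ?_)
  · change B.totD n k (shiftMap e n k z) = 0
    rw [← hcomm, hz, map_zero]
  · obtain ⟨(y : A.Tot (n + 1) k), rfl⟩ := hz
    cases k with
    | zero =>
      -- There are no coboundaries in degree `0` of the target, so coboundaries from degree `0` of
      -- `A` must be sent to zero outright; they come from the component in degree `(0, 0)`.
      have hy : shiftMap e n 0 (A.totD (n + 1) 0 y) = 0 := by
        refine Tot.ext fun i j h hj => ?_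
        obtain rfl : i = 0 := by omega
        obtain rfl : j = 0 := by omega
        rw [shiftMap_comp, totD_comp]
        exact hzero 0 _
      exact hy
    | succ k => exact ⟨shiftMap e n k y, (hcomm y).symm⟩
  · cases k with
    | zero => exact hcl 0 z hz hc
    | succ k =>
      obtain ⟨(y : B.Tot n k), (hy : B.totD n k y = shiftMap e n (k + 1) z)⟩ := hc
      obtain ⟨x, rfl⟩ := shiftMap_surjective e he n k y
      obtain ⟨v, hv⟩ := hcl (k + 1) (z - A.totD (n + 1) (k + 1) x)
        (by rw [map_sub, hz, totD_totD, sub_zero]) (by rw [map_sub, hcomm, hy, sub_self])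
      refine ⟨v + x, ?_⟩
      change A.totD (n + 1) (k + 1) (v + x) = z
      rw [map_add, hv, sub_add_cancel]
  · obtain ⟨x, rfl⟩ := shiftMap_surjective e he n k w
    -- A lift `x` of the cocycle `w` need not be a cocycle, but its coboundary is killed by the
    -- shift. It is corrected by `y` from column `0`, which the shift does not see.
    obtain ⟨y, u, hy, h⟩ := exists_sub_eq_single_of_shiftMap_eq_zero e hker hinj hn
      (A.totD (n + 1) (k + 1) x) (by rw [hcomm, hw])
    have hu : u = 0 := hsingle (k + 1 + 1) u (by rw [← h, map_sub, totD_totD, totD_totD, sub_zero])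
    have h1 : A.totD (n + 1) (k + 1) (x - y) = 0 := by
      rw [map_sub, h, hu]
      exact Pi.single_zero _
    have h2 : shiftMap e n k y = 0 := Tot.ext fun i j h hj => by
      rw [shiftMap_comp, hy, map_zero]
      rfl
    refine ⟨x - y, h1, ?_⟩
    have h3 : shiftMap e n k x - shiftMap e n k (x - y) = 0 := by
      rw [map_sub, h2, sub_zero, sub_self]
    exact Eq.mpr (congrArg (· ∈ (B.tot n).coboundaries k) h3) (zero_mem _)

/-- The total complex in degree zero has no cohomology if its first row starts with an injective
map. -/
lemma subsingleton_H_zero {n : ℕ} (hn : 1 < n) (hdinj : Function.Injective (A.d 0 0)) :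
    Subsingleton ((A.tot n).H 0) := by
  refine subsingleton_of_forall_eq 0 fun x => ?_
  obtain ⟨(z : A.Tot n 0), (hz : A.totD n 0 z = 0), rfl⟩ := CochainCpx.exists_cls x
  refine (CochainCpx.cls_eq_zero_iff hz).2 ?_
  have h1 : (A.totD n 0 z).comp 0 1 rfl hn = 0 := by
    rw [hz]
    rfl
  have h2 : z.comp 0 0 rfl (by omega) = 0 := hdinj (h1.trans (map_zero _).symm)
  have h3 : z = 0 := Tot.ext fun i j h hj => by
    obtain rfl : i = 0 := by omega
    obtain rfl : j = 0 := by omega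
    exact h2
  exact h3

end DoubleCpx

/-! ### The connecting isomorphism of a short exact sequence. -/

namespace CochainCpx

/-- The connecting isomorphism of a short exact sequence of complexes whose middle term is
acyclic. -/
theorem exists_connecting_equiv {Z F U : CochainCpx.{w}} (ι : ∀ k, Z.X k →+ F.X k)
    (π : ∀ k, F.X k →+ U.X k) (hι : ∀ k x, ι (k + 1) (Z.d k x) = F.d k (ι k x))
    (hπ : ∀ k x, π (k + 1) (F.d k x) = U.d k (π k x)) (hinj : ∀ k, Function.Injective (ι k))
    (hsurj : ∀ k, Function.Surjective (π k)) (hπι : ∀ k x, π k (ι k x) = 0)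
    (hker : ∀ k x, π k x = 0 → ∃ y, ι k y = x)
    (hF : ∀ k x, F.d (k + 1) x = 0 → ∃ y, F.d k y = x) {k : ℕ} (hk : 1 ≤ k) :
    ∃ e : U.H k ≃+ Z.H (k + 1), ∀ (f : F.X k) (z : Z.X (k + 1)), F.d k f = ι (k + 1) z →
      ∃ (hf : U.d k (π k f) = 0) (hz : Z.d (k + 1) z = 0), e (U.cls (π k f) hf) = Z.cls z hz := by
  obtain ⟨k, rfl⟩ : ∃ m, k = m + 1 := ⟨k - 1, by omega⟩
  have hf : ∀ (f : F.X (k + 1)) (z : Z.X (k + 1 + 1)), F.d (k + 1) f = ι _ z →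
      U.d (k + 1) (π (k + 1) f) = 0 := fun f z h => by rw [← hπ, h, hπι]
  have hz : ∀ (f : F.X (k + 1)) (z : Z.X (k + 1 + 1)), F.d (k + 1) f = ι _ z →
      Z.d (k + 1 + 1) z = 0 := fun f z h => hinj _ (by rw [hι, ← h, F.d_d, map_zero])
  -- The group of all pairs `(f, z)` with `F.d f = ι z` maps onto both cohomology groups. Comparing
  -- kernels replaces the choice of lifts in the usual construction.
  let P : AddSubgroup (F.X (k + 1) × Z.X (k + 1 + 1)) :=
    { carrier := {p | F.d (k + 1) p.1 = ι _ p.2}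
      add_mem' := fun {p q} (hp : _ = _) (hq : _ = _) => by
        change F.d (k + 1) (p.1 + q.1) = ι _ (p.2 + q.2)
        rw [map_add, map_add, hp, hq]
      zero_mem' := by
        change F.d (k + 1) 0 = ι _ 0
        rw [map_zero, map_zero]
      neg_mem' := fun {p} (hp : _ = _) => by
        change F.d (k + 1) (-p.1) = ι _ (-p.2)
        rw [map_neg, map_neg, hp] }
  let a : P →+ U.H (k + 1) := (U.clsHom (k + 1)).comp
    (((π (k + 1)).comp ((AddMonoidHom.fst _ _).comp P.subtype)).codRestrict (U.cocycles (k + 1))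
      fun p => hf p.1.1 p.1.2 p.2)
  let b : P →+ Z.H (k + 1 + 1) := (Z.clsHom (k + 1 + 1)).comp
    (((AddMonoidHom.snd _ _).comp P.subtype).codRestrict (Z.cocycles (k + 1 + 1))
      fun p => hz p.1.1 p.1.2 p.2)
  obtain ⟨e, he⟩ := exists_addEquiv_of_surjective a b (fun x => by
      obtain ⟨u, hu, rfl⟩ := exists_cls x
      obtain ⟨f, rfl⟩ := hsurj _ u
      obtain ⟨z, hz⟩ := hker _ (F.d (k + 1) f) (by rw [hπ, hu])
      exact ⟨⟨(f, z), hz.symm⟩, rfl⟩) (fun x => by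
      obtain ⟨z, hz, rfl⟩ := exists_cls x
      obtain ⟨f, hf⟩ := hF (k + 1) (ι _ z) (by rw [← hι, hz, map_zero])
      exact ⟨⟨(f, z), hf⟩, rfl⟩) (fun p => by
      obtain ⟨⟨f, z⟩, h⟩ := p
      refine (cls_eq_zero_iff (hf f z h)).trans (Iff.trans ?_ (cls_eq_zero_iff (hz f z h)).symm)
      constructor
      · rintro ⟨u, hu⟩
        obtain ⟨f', rfl⟩ := hsurj _ u
        obtain ⟨w, hw⟩ := hker _ (f - F.d k f') (by rw [map_sub, hπ, hu, sub_self])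
        refine ⟨w, hinj _ ?_⟩
        rw [hι, hw, map_sub, F.d_d, sub_zero]
        exact h
      · rintro ⟨w, hw⟩
        -- Acyclicity is used in the degree of `f`, which is positive because `1 ≤ k` in the
        -- statement.
        obtain ⟨f', hf'⟩ := hF k (f - ι _ w) (by
          rw [map_sub, ← hι, hw, sub_eq_zero]
          exact h)
        refine ⟨π k f', ?_⟩
        rw [← hπ, hf', map_sub, hπι, sub_zero])
  exact ⟨e, fun f z h => ⟨hf f z h, hz f z h, he ⟨(f, z), h⟩⟩⟩

end CochainCpx

end CohomologyAlgebra

/-! ### Smooth approximation of continuous maps between manifolds. -/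

section SmoothApproximation

variable {F : Type*} [NormedAddCommGroup F] [NormedSpace ℝ F] [FiniteDimensional ℝ F]
variable {H : Type*} [TopologicalSpace H] {I : ModelWithCorners ℝ F H}
variable {N : Type*} [TopologicalSpace N] [ChartedSpace H N] [IsManifold I ∞ N] [T2Space N]
  [SigmaCompactSpace N]
variable {E : Type*} [NormedAddCommGroup E] [NormedSpace ℝ E]
variable {M : Type*} [TopologicalSpace M] [ChartedSpace E M] [IsManifold 𝓘(ℝ, E) ∞ M]

/-- A compact set has a uniform thickening inside any open neighbourhood. The form with `∀ᶠ` allows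
finitely many such bounds to be imposed at once. -/
lemma eventually_ball_subset_of_isCompact {X : Type*} [PseudoMetricSpace X] {K O : Set X} (hK : IsCompact K) (hO : IsOpen O)
    (h : K ⊆ O) : ∀ᶠ ε in 𝓝[>] (0 : ℝ), ∀ y ∈ K, Metric.ball y ε ⊆ O := by
  obtain ⟨δ, hδ, hsub⟩ := hK.exists_thickening_subset_open hO h
  filter_upwards [Ioc_mem_nhdsGT hδ] with ε hε y hy
  refine (Metric.ball_subset_ball hε.2).trans (Subset.trans ?_ hsub)
  exact Metric.ball_subset_thickening hy δ

/-- A continuous function with values in a vector space is uniformly close to a smooth function on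
a closed set on which it is continuous. -/
lemma exists_smooth_dist_lt {T : Set N} (hT : IsClosed T) {a : N → E} (ha : ContinuousOn a T)
    {ε : ℝ} (hε : 0 < ε) : ∃ b : C^∞⟮I, N; 𝓘(ℝ, E), E⟯, ∀ x ∈ T, b x ∈ Metric.ball (a x) ε := by
  classical
  -- Convex conditions on the value at each point can be met globally by a partition of unity once
  -- they can be met locally. Off `T` nothing is required; near a point of `T` a constant suffices.
  let t : N → Set E := fun x => if x ∈ T then Metric.ball (a x) ε else univ
  have ht : ∀ x, Convex ℝ (t x) := fun x => by
    by_cases hx : x ∈ T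
    · simp only [t, if_pos hx]
      exact convex_ball _ _
    · simp only [t, if_neg hx]
      exact convex_univ
  obtain ⟨b, hb⟩ := exists_contMDiffMap_forall_mem_convex_of_local I (n := (⊤ : ℕ∞)) ht (fun x => by
    by_cases hx : x ∈ T
    · have h1 := (ha x hx).eventually (Metric.ball_mem_nhds (a x) hε)
      rw [eventually_nhdsWithin_iff] at h1
      refine ⟨_, h1, fun _ => a x, contMDiffOn_const, fun y hy => ?_⟩
      by_cases hyT : y ∈ T
      · simp only [t, if_pos hyT]
        rw [Metric.mem_ball_comm]
        exact hy hyT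
      · simp only [t, if_neg hyT]
        exact mem_univ _
    · refine ⟨Tᶜ, hT.isOpen_compl.mem_nhds hx, fun _ => 0, contMDiffOn_const, fun y hy => ?_⟩
      simp only [t, if_neg (show y ∉ T from hy)]
      exact mem_univ _)
  refine ⟨b, fun x hx => ?_⟩
  have := hb x
  simpa only [t, if_pos hx] using this

/-- A continuous map can be made smooth on a compact set that is mapped to the domain of a chart,
without destroying smoothness elsewhere. -/
lemma exists_smoothing_step {ι : Type*} {T : ι → Set N} (hT : LocallyFinite T)
    (hTc : ∀ i, IsClosed (T i)) {W : ι → Set M} (hW : ∀ i, IsOpen (W i)) {g : N → M}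
    (hg : Continuous g) (hgT : ∀ i, MapsTo g (T i) (W i)) (z₀ : M) {χ : N → ℝ}
    (hχ : ContMDiff I 𝓘(ℝ, ℝ) ∞ χ) (h01 : ∀ x, χ x ∈ Icc (0 : ℝ) 1)
    (hχc : HasCompactSupport χ) (hχz : MapsTo g (tsupport χ) (chartAt E z₀).source) :
    ∃ g' : N → M, Continuous g' ∧ (∀ i, MapsTo g' (T i) (W i)) ∧
      (∀ x ∉ tsupport χ, g' x = g x) ∧
      (∀ x, ContMDiffAt I 𝓘(ℝ, E) ∞ g x → ContMDiffAt I 𝓘(ℝ, E) ∞ g' x) ∧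
      (∀ x, χ =ᶠ[𝓝 x] 1 → ContMDiffAt I 𝓘(ℝ, E) ∞ g' x) := by
  classical
  set φ := chartAt E z₀
  set S := tsupport χ with hS
  have hSc : IsClosed S := isClosed_tsupport χ
  have hφg : ∀ x, g x ∈ φ.source → ContinuousAt (φ ∘ g) x := fun x hx =>
    (φ.continuousAt hx).comp hg.continuousAt
  have hφgS : ContinuousOn (φ ∘ g) S := fun x hx => (hφg x (hχz hx)).continuousWithinAt
  -- Only finitely many of the constraints `T i → W i` meet the compact support of `χ`, so one `ε`
  -- serves them all.
  have hJ : {i | (T i ∩ S).Nonempty}.Finite := hT.finite_nonempty_inter_compact hχc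
  have hev1 : ∀ᶠ ε in 𝓝[>] (0 : ℝ), ∀ y ∈ (φ ∘ g) '' S, Metric.ball y ε ⊆ φ.target := by
    refine eventually_ball_subset_of_isCompact (IsCompact.image_of_continuousOn hχc hφgS)
      φ.open_target ?_
    rintro _ ⟨x, hx, rfl⟩
    exact φ.map_source (hχz hx)
  have hev2 : ∀ᶠ ε in 𝓝[>] (0 : ℝ), ∀ i ∈ {i | (T i ∩ S).Nonempty},
      ∀ y ∈ (φ ∘ g) '' (T i ∩ S), Metric.ball y ε ⊆ φ.target ∩ φ.symm ⁻¹' W i := by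
    rw [eventually_all_finite hJ]
    intro i _
    have hc : IsCompact (T i ∩ S) := hχc.inter_left (hTc i)
    refine eventually_ball_subset_of_isCompact
      (hc.image_of_continuousOn (hφgS.mono inter_subset_right))
      (φ.isOpen_inter_preimage_symm (hW i)) ?_
    rintro _ ⟨x, hx, rfl⟩
    refine ⟨φ.map_source (hχz hx.2), ?_⟩
    simp only [mem_preimage, Function.comp_apply]
    rw [φ.left_inv (hχz hx.2)]
    exact hgT i hx.1
  obtain ⟨ε, ⟨h1, h2⟩, hε⟩ := ((hev1.and hev2).and self_mem_nhdsWithin).exists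
  obtain ⟨b, hb⟩ := exists_smooth_dist_lt (I := I) hSc hφgS hε
  -- In the chart, `c` interpolates between `g` and its smooth approximation `b`: it is `b` where `χ
  -- = 1` and `g` where `χ = 0`. It never leaves the `ε`-ball around `φ (g x)`, hence respects all
  -- the constraints.
  let c : N → E := fun x => φ (g x) + χ x • (b x - φ (g x))
  have hc : ∀ x ∈ S, c x ∈ Metric.ball (φ (g x)) ε := fun x hx => by
    have h3 := hb x hx
    rw [mem_ball_iff_norm] at h3 ⊢
    simp only [c, add_sub_cancel_left, norm_smul, Real.norm_eq_abs, abs_of_nonneg (h01 x).1]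
    exact (mul_le_of_le_one_left (norm_nonneg _) (h01 x).2).trans_lt h3
  have hct : ∀ x ∈ S, c x ∈ φ.target := fun x hx => h1 _ ⟨x, hx, rfl⟩ (hc x hx)
  let g' : N → M := fun x => if x ∈ S then φ.symm (c x) else g x
  have hoff : ∀ x ∉ S, g' x = g x := fun x hx => if_neg hx
  have hon : ∀ x, g x ∈ φ.source → g' x = φ.symm (c x) := fun x hx => by
    by_cases hxS : x ∈ S
    · exact if_pos hxS
    · rw [hoff x hxS]
      have : χ x = 0 := image_eq_zero_of_notMem_tsupport hxS
      simp only [c, this, zero_smul, add_zero, φ.left_inv hx]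
  have hev : ∀ x ∈ S, g' =ᶠ[𝓝 x] φ.symm ∘ c := fun x hx => by
    filter_upwards [hg.continuousAt.eventually (φ.open_source.mem_nhds (hχz hx))] with y hy
    exact hon y hy
  have hevoff : ∀ x ∉ S, g' =ᶠ[𝓝 x] g := fun x hx => by
    filter_upwards [hSc.isOpen_compl.mem_nhds hx] with y hy
    exact hoff y hy
  have hsmooth : ∀ x, ContMDiffAt I 𝓘(ℝ, E) ∞ g x → ContMDiffAt I 𝓘(ℝ, E) ∞ g' x := by
    intro x hx
    by_cases hxS : x ∈ S
    · refine ContMDiffAt.congr_of_eventuallyEq ?_ (hev x hxS)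
      have h4 : ContMDiffAt I 𝓘(ℝ, E) ∞ (φ ∘ g) x := (contMDiffAt_chartAt z₀ (hχz hxS)).comp x hx
      have h5 : ContMDiffAt I 𝓘(ℝ, E) ∞ c x :=
        h4.add (hχ.contMDiffAt.smul (b.contMDiff.contMDiffAt.sub h4))
      exact (contMDiffAt_chartAt_symm z₀ (hct x hxS)).comp x h5
    · exact hx.congr_of_eventuallyEq (hevoff x hxS)
  refine ⟨g', continuous_iff_continuousAt.2 fun x => ?_, fun i x hx => ?_, hoff, hsmooth,
    fun x hx => ?_⟩
  · by_cases hxS : x ∈ S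
    · refine ContinuousAt.congr ?_ (hev x hxS).symm
      have h4 := hφg x (hχz hxS)
      have h5 : ContinuousAt c x := h4.add (hχ.continuous.continuousAt.smul
        (b.contMDiff.continuous.continuousAt.sub h4))
      exact (φ.continuousAt_symm (hct x hxS)).comp h5
    · exact hg.continuousAt.congr (hevoff x hxS).symm
  · by_cases hxS : x ∈ S
    · have h6 := h2 i ⟨x, hx, hxS⟩ _ ⟨x, ⟨hx, hxS⟩, rfl⟩ (hc x hxS)
      rw [hon x (hχz hxS)]
      exact h6.2
    · rw [hoff x hxS]
      exact hgT i hx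
  · have hxS : x ∈ S := subset_tsupport χ (by
      rw [Function.mem_support, hx.self_of_nhds]
      exact one_ne_zero)
    have h7 : g' =ᶠ[𝓝 x] φ.symm ∘ b := by
      filter_upwards [hev x hxS, hx] with y hy hy1
      rw [hy]
      simp only [Function.comp_apply, c, hy1, Pi.one_apply, one_smul, add_sub_cancel]
    have h8 : c x = b x := by
      simp only [c, hx.self_of_nhds, Pi.one_apply, one_smul, add_sub_cancel]
    refine ContMDiffAt.congr_of_eventuallyEq ?_ h7
    refine ContMDiffAt.comp x (contMDiffAt_chartAt_symm z₀ ?_) b.contMDiff.contMDiffAt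
    rw [← h8]
    exact hct x hxS

/-- A continuous map that is smooth on an open set can be replaced by a smooth map that coincides
with it on a given closed subset of this open set. -/
theorem exists_contMDiff_eqOn {f : N → M} (hf : Continuous f) {O A : Set N} (hO : IsOpen O)
    (hA : IsClosed A) (hAO : A ⊆ O) (hfO : ∀ x ∈ O, ContMDiffAt I 𝓘(ℝ, E) ∞ f x) :
    ∃ g : N → M, ContMDiff I 𝓘(ℝ, E) ∞ g ∧ EqOn g f A := by
  -- The map is smoothed on a bump covering of the complement of `O`. The supports avoid `A`, where
  -- nothing may change, and each is mapped by `f` into a single chart.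
  obtain ⟨ι, B, hB⟩ := SmoothBumpCovering.exists_isSubordinate I (s := Oᶜ)
    (U := fun x => Aᶜ ∩ f ⁻¹' (chartAt E (f x)).source) hO.isClosed_compl (fun x hx =>
      inter_mem (hA.isOpen_compl.mem_nhds fun h => hx (hAO h))
        (hf.continuousAt.eventually ((chartAt E (f x)).open_source.mem_nhds
          (mem_chart_source E (f x)))))
  have hlf : LocallyFinite fun i => tsupport (B i) := B.locallyFinite.closure
  have hcount : Countable ι := by
    refine countable_univ_iff.1 (B.locallyFinite.countable_univ fun i => ?_)
    exact ⟨B.c i, Function.mem_support.2 (by rw [(B i).eq_one]; exact one_ne_zero)⟩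
  have := Encodable.ofCountable ι
  -- The invariant of the iteration: each support stays mapped into the chart chosen from `f`, so
  -- that the smoothing step remains possible for every later index.
  let P : (N → M) → Prop := fun g => Continuous g ∧
    ∀ i, MapsTo g (tsupport (B i)) (chartAt E (f (B.c i))).source
  have hstep : ∀ (i : ι) (g : {g : N → M // P g}), ∃ g' : {g : N → M // P g},
      (∀ x ∉ tsupport (B i), g'.1 x = g.1 x) ∧
      (∀ x, ContMDiffAt I 𝓘(ℝ, E) ∞ g.1 x → ContMDiffAt I 𝓘(ℝ, E) ∞ g'.1 x) ∧
      (∀ x, B i =ᶠ[𝓝 x] 1 → ContMDiffAt I 𝓘(ℝ, E) ∞ g'.1 x) := by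
    rintro i ⟨g, hg, hgT⟩
    obtain ⟨g', h1, h2, h3⟩ := exists_smoothing_step hlf (fun i => isClosed_tsupport _)
      (fun i => (chartAt E (f (B.c i))).open_source) hg hgT (f (B.c i)) (B i).contMDiff
      (fun x => ⟨(B i).nonneg, (B i).le_one⟩) (B i).hasCompactSupport (hgT i)
    exact ⟨⟨g', h1, h2⟩, h3⟩
  choose step hstep1 hstep2 hstep3 using hstep
  -- Step `n` treats the index whose code is `n`. With `decode₂`, numbers that are not codes give
  -- `none`, and then the map is unchanged.
  let G : ℕ → {g : N → M // P g} := fun n => Nat.rec ⟨f, hf, fun i x hx => (hB i hx).2⟩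
    (fun n g => (Encodable.decode₂ ι n).elim g fun i => step i g) n
  have hG0 : (G 0).1 = f := rfl
  have hGs : ∀ n, G (n + 1) = (Encodable.decode₂ ι n).elim (G n) fun i => step i (G n) :=
    fun n => rfl
  have hGe : ∀ i : ι, G (Encodable.encode i + 1) = step i (G (Encodable.encode i)) := fun i => by
    rw [hGs, Encodable.encodek₂]
    rfl
  have hGn : ∀ n, (∃ i : ι, Encodable.encode i = n) ∨ G (n + 1) = G n := by
    intro n
    cases h : Encodable.decode₂ ι n with
    | none =>
      refine Or.inr ?_
      rw [hGs, h]
      rfl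
    | some i => exact Or.inl ⟨i, Encodable.decode₂_eq_some.1 h⟩
  have hGoff : ∀ n x, (∀ i : ι, Encodable.encode i = n → x ∉ tsupport (B i)) →
      (G (n + 1)).1 x = (G n).1 x := by
    intro n x hx
    rcases hGn n with ⟨i, rfl⟩ | h
    · rw [hGe]
      exact hstep1 i _ x (hx i rfl)
    · rw [h]
  have hGsm : ∀ n x, ContMDiffAt I 𝓘(ℝ, E) ∞ (G n).1 x →
      ContMDiffAt I 𝓘(ℝ, E) ∞ (G (n + 1)).1 x := by
    intro n x hx
    rcases hGn n with ⟨i, rfl⟩ | h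
    · rw [hGe]
      exact hstep2 i _ x hx
    · rwa [h]
  have hGsm' : ∀ n m x, n ≤ m → ContMDiffAt I 𝓘(ℝ, E) ∞ (G n).1 x →
      ContMDiffAt I 𝓘(ℝ, E) ∞ (G m).1 x := by
    intro n m x hnm hx
    induction m, hnm using Nat.le_induction with
    | base => exact hx
    | succ m _ ih => exact hGsm m x ih
  -- By local finiteness only finitely many steps change anything near `x`, so the sequence is
  -- locally eventually constant and its limit inherits smoothness from a finite stage.
  have hloc : ∀ x, ∃ V ∈ 𝓝 x, ∃ n, ∀ m, n ≤ m → ∀ y ∈ V, (G m).1 y = (G n).1 y := by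
    intro x
    obtain ⟨V, hV, hfin⟩ := hlf x
    obtain ⟨n, hn⟩ := (hfin.image fun i : ι => (Encodable.encode i : ℕ)).bddAbove
    refine ⟨V, hV, n + 1, fun m hm y hy => ?_⟩
    induction m, hm using Nat.le_induction with
    | base => rfl
    | succ m hm ih =>
      refine (hGoff m y fun i hi hyi => ?_).trans ih
      have : Encodable.encode i ≤ n := hn ⟨i, ⟨y, hyi, hy⟩, rfl⟩
      omega
  choose V hV n hn using hloc
  let g : N → M := fun x => (G (n x)).1 x
  have hg : ∀ x m, n x ≤ m → g =ᶠ[𝓝 x] (G m).1 := by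
    intro x m hm
    filter_upwards [hV x] with y hy
    have h1 := hn y (max m (n y)) (le_max_right _ _) y (mem_of_mem_nhds (hV y))
    have h2 := hn x (max m (n y)) (hm.trans (le_max_left _ _)) y hy
    have h3 := hn x m hm y hy
    change (G (n y)).1 y = _
    rw [← h1, h2, h3]
  refine ⟨g, fun x => ?_, fun x hx => ?_⟩
  · by_cases hx : x ∈ O
    · exact (hGsm' 0 (n x) x (Nat.zero_le _) (hfO x hx)).congr_of_eventuallyEq (hg x _ le_rfl)
    · obtain ⟨i, hi⟩ := B.eventuallyEq_one' x hx
      have h1 := hstep3 i (G (Encodable.encode i)) x hi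
      rw [← hGe] at h1
      exact (hGsm' _ (max (n x) (Encodable.encode i + 1)) x (le_max_right _ _)
        h1).congr_of_eventuallyEq (hg x _ (le_max_left _ _))
  · have h1 : ∀ m, (G m).1 x = f x := fun m => by
      induction m with
      | zero => rfl
      | succ m ih => exact (hGoff m x fun i _ hi => (hB i hi).1 hx).trans ih
    exact h1 _

end SmoothApproximation

lemma continuous_slice {P V : Type*} [TopologicalSpace P] [TopologicalSpace V] {γ : P × ℝ → V}
    {s : Set P} (hγ : ContinuousOn γ (s ×ˢ univ)) {p : P} (hp : p ∈ s) :
    Continuous fun t => γ (p, t) :=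
  hγ.comp_continuous (by fun_prop) fun t => ⟨hp, mem_univ t⟩

/-! ### Smooth dependence of integrals on parameters. -/

section ParametricIntegral

universe v

variable {P V : Type v} [NormedAddCommGroup P] [NormedSpace ℝ P] [NormedAddCommGroup V]
  [NormedSpace ℝ V]

/-- The derivative in the first variable. -/
def partialFDeriv (γ : P × ℝ → V) (q : P × ℝ) : P →L[ℝ] V :=
  (fderiv ℝ γ q).comp (ContinuousLinearMap.inl ℝ P ℝ)

lemma partialFDeriv_contDiffOn {γ : P × ℝ → V} {s : Set P} (hs : IsOpen s)
    (hγ : ContDiffOn ℝ ∞ γ (s ×ˢ univ)) : ContDiffOn ℝ ∞ (partialFDeriv γ) (s ×ˢ univ) :=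
  (hγ.fderiv_of_isOpen (hs.prod isOpen_univ) (by simp)).clm_comp contDiffOn_const

lemma hasFDerivAt_left {γ : P × ℝ → V} {s : Set P} (hs : IsOpen s)
    (hγ : ContDiffOn ℝ ∞ γ (s ×ˢ univ)) {p : P} (hp : p ∈ s) (t : ℝ) :
    HasFDerivAt (fun p => γ (p, t)) (partialFDeriv γ (p, t)) p := by
  have h1 : DifferentiableAt ℝ γ (p, t) :=
    (hγ.contDiffAt ((hs.prod isOpen_univ).mem_nhds ⟨hp, mem_univ t⟩)).differentiableAt (by simp)
  have h2 : HasFDerivAt (fun p : P => (p, t)) (ContinuousLinearMap.inl ℝ P ℝ) p :=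
    hasFDerivAt_prodMk_left p t
  exact h1.hasFDerivAt.comp p h2

/-- Differentiation under the integral sign. -/
lemma hasFDerivAt_integral_zero_one {γ : P × ℝ → V} {s : Set P} (hs : IsOpen s)
    (hγ : ContDiffOn ℝ ∞ γ (s ×ˢ univ)) {p : P} (hp : p ∈ s) :
    HasFDerivAt (fun p => ∫ t in (0 : ℝ)..1, γ (p, t))
      (∫ t in (0 : ℝ)..1, partialFDeriv γ (p, t)) p := by
  have hD := (partialFDeriv_contDiffOn hs hγ).continuousOn
  obtain ⟨C, hC⟩ := (isCompact_Icc (a := (0 : ℝ)) (b := 1)).bddAbove_image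
    (continuous_slice hD hp).norm.continuousOn
  -- Compactness of the interval gives a neighbourhood of `p` on which the derivatives have a
  -- constant integrable bound.
  have hev : ∀ᶠ p' in 𝓝 p, ∀ t ∈ Icc (0 : ℝ) 1, ‖partialFDeriv γ (p', t)‖ < C + 1 := by
    refine isCompact_Icc.eventually_forall_of_forall_eventually fun t ht => ?_
    have h1 : ContinuousAt (fun q => ‖partialFDeriv γ q‖) (p, t) :=
      (hD.continuousAt ((hs.prod isOpen_univ).mem_nhds ⟨hp, mem_univ t⟩)).norm
    exact h1.eventually (gt_mem_nhds ((hC ⟨t, ht, rfl⟩).trans_lt (lt_add_one C)))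
  refine intervalIntegral.hasFDerivAt_integral_of_dominated_of_fderiv_le
    (F := fun p t => γ (p, t)) (F' := fun p t => partialFDeriv γ (p, t))
    (bound := fun _ => C + 1) (inter_mem hev (hs.mem_nhds hp)) ?_ ?_ ?_ ?_ ?_ ?_
  · filter_upwards [hs.mem_nhds hp] with p' hp'
    exact (continuous_slice hγ.continuousOn hp').aestronglyMeasurable
  · exact (continuous_slice hγ.continuousOn hp).intervalIntegrable _ _
  · exact (continuous_slice hD hp).aestronglyMeasurable
  · refine Eventually.of_forall fun t ht p' hp' => (hp'.1 t ?_).le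
    rw [uIoc_of_le zero_le_one] at ht
    exact ⟨ht.1.le, ht.2⟩
  · exact intervalIntegrable_const
  · exact Eventually.of_forall fun t ht p' hp' => hasFDerivAt_left hs hγ hp'.2 t

/-- Integrals of smooth functions depend smoothly on parameters. -/
lemma contDiffOn_integral_zero_one {s : Set P} (hs : IsOpen s) {γ : P × ℝ → V}
    (hγ : ContDiffOn ℝ ∞ γ (s ×ˢ univ)) :
    ContDiffOn ℝ ∞ (fun p => ∫ t in (0 : ℝ)..1, γ (p, t)) s := by
  rw [contDiffOn_infty]
  intro n
  -- The induction passes from `V` to `P →L[ℝ] V`; for this reason the two spaces share one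
  -- universe.
  induction n generalizing V with
  | zero =>
    refine contDiffOn_zero.2 fun p hp => ?_
    exact (hasFDerivAt_integral_zero_one hs hγ hp).continuousAt.continuousWithinAt
  | succ n ih =>
    rw [Nat.cast_add, Nat.cast_one, contDiffOn_succ_iff_fderiv_of_isOpen hs]
    refine ⟨fun p hp => (hasFDerivAt_integral_zero_one hs
      hγ hp).differentiableAt.differentiableWithinAt, by simp, ?_⟩
    exact (ih (partialFDeriv_contDiffOn hs hγ)).congr fun p hp =>
      (hasFDerivAt_integral_zero_one hs hγ hp).fderiv

end ParametricIntegral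

/-! ### The homotopy formula in a vector space. -/

section HomotopyFormula

universe v

variable {E : Type v} [NormedAddCommGroup E] [NormedSpace ℝ E]

/-- Contraction with the unit vector in the last direction, followed by restriction. -/
def contractTime (E : Type v) [NormedAddCommGroup E] [NormedSpace ℝ E] (k : ℕ) :
    (E × ℝ) [⋀^Fin (k + 1)]→L[ℝ] ℝ →L[ℝ] E [⋀^Fin k]→L[ℝ] ℝ :=
  (ContinuousAlternatingMap.compContinuousLinearMapCLM (ContinuousLinearMap.inl ℝ E ℝ)).comp
    ((ContinuousLinearMap.apply ℝ _ ((0, 1) : E × ℝ)).comp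
      (ContinuousAlternatingMap.curryLeftLI (𝕜 := ℝ) (E := E × ℝ) (F := ℝ)
        (n := k)).toContinuousLinearMap)

/-- Restriction to the first factor. -/
def restrictSpace (E : Type v) [NormedAddCommGroup E] [NormedSpace ℝ E] (k : ℕ) :
    (E × ℝ) [⋀^Fin k]→L[ℝ] ℝ →L[ℝ] E [⋀^Fin k]→L[ℝ] ℝ :=
  ContinuousAlternatingMap.compContinuousLinearMapCLM (ContinuousLinearMap.inl ℝ E ℝ)

/-- Pointwise Cartan formula, with `L` in the role of the derivative of a closed form. Evaluating
its vanishing exterior derivative on `∂_t, v_0, …, v_k` isolates the term differentiated along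
`∂_t`; the remaining terms are minus the exterior derivative of the contraction. -/
lemma alternatizeUncurryFin_contractTime {k : ℕ}
    (L : (E × ℝ) →L[ℝ] (E × ℝ) [⋀^Fin (k + 1)]→L[ℝ] ℝ)
    (hL : ContinuousAlternatingMap.alternatizeUncurryFin L = 0) :
    ContinuousAlternatingMap.alternatizeUncurryFin
      ((contractTime E k).comp (L.comp (ContinuousLinearMap.inl ℝ E ℝ))) =
      restrictSpace E (k + 1) (L (0, 1)) := by
  ext v
  have h := DFunLike.congr_fun hL (Matrix.vecCons (0, 1) fun i => (v i, 0))
  rw [ContinuousAlternatingMap.alternatizeUncurryFin_apply, Fin.sum_univ_succ] at h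
  rw [ContinuousAlternatingMap.alternatizeUncurryFin_apply]
  simp only [Fin.val_zero, pow_zero, one_smul, Matrix.cons_val_zero, Matrix.cons_val_succ,
    Fin.val_succ] at h
  have h1 : (Fin.removeNth 0 (Matrix.vecCons ((0, 1) : E × ℝ) fun i => (v i, 0))) =
      fun i => (v i, 0) := by
    funext i
    rfl
  have h2 : ∀ i : Fin (k + 1), (Fin.removeNth i.succ
      (Matrix.vecCons ((0, 1) : E × ℝ) fun i => (v i, 0))) =
      Matrix.vecCons ((0, 1) : E × ℝ) fun j => (i.removeNth v j, 0) := by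
    intro i
    funext j
    refine Fin.cases ?_ (fun j => ?_) j
    · rfl
    · simp [Fin.removeNth]
  simp only [h1, h2] at h
  have h3 : restrictSpace E (k + 1) (L (0, 1)) v = L (0, 1) fun i => (v i, 0) := rfl
  rw [h3]
  have h4 := eq_neg_of_add_eq_zero_left h
  rw [h4, ← Finset.sum_neg_distrib]
  refine Finset.sum_congr rfl fun i _ => ?_
  rw [pow_succ, mul_neg_one, neg_smul, neg_neg]
  rfl

/-- The homotopy formula: the integral over the unit interval of the contraction of a closed form
is a primitive of the difference of its restrictions to the ends. -/
lemma extDeriv_integral_contractTime {k : ℕ} {s : Set E} (hs : IsOpen s)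
    {β : E × ℝ → (E × ℝ) [⋀^Fin (k + 1)]→L[ℝ] ℝ} (hβ : ContDiffOn ℝ ∞ β (s ×ˢ univ))
    (hcl : ∀ p ∈ s, ∀ t, extDeriv β (p, t) = 0) {p : E} (hp : p ∈ s) :
    extDeriv (fun p => ∫ t in (0 : ℝ)..1, contractTime E k (β (p, t))) p =
      restrictSpace E (k + 1) (β (p, 1)) - restrictSpace E (k + 1) (β (p, 0)) := by
  have hγ : ContDiffOn ℝ ∞ (fun q => contractTime E k (β q)) (s ×ˢ univ) :=
    (contractTime E k).contDiff.comp_contDiffOn hβ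
  have hint : IntervalIntegrable (fun t => partialFDeriv (fun q => contractTime E k (β q)) (p, t))
      MeasureTheory.volume 0 1 :=
    (continuous_slice (partialFDeriv_contDiffOn hs hγ).continuousOn hp).intervalIntegrable _ _
  have hβd : ∀ t, DifferentiableAt ℝ β (p, t) := fun t =>
    (hβ.contDiffAt ((hs.prod isOpen_univ).mem_nhds ⟨hp, mem_univ t⟩)).differentiableAt (by simp)
  unfold extDeriv
  rw [(hasFDerivAt_integral_zero_one hs hγ hp).fderiv,
    ← ContinuousAlternatingMap.alternatizeUncurryFinCLM_apply,
    ← ContinuousLinearMap.intervalIntegral_comp_comm _ hint]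
  have h1 : ∀ t, ContinuousAlternatingMap.alternatizeUncurryFinCLM ℝ E ℝ
      (partialFDeriv (fun q => contractTime E k (β q)) (p, t)) =
      restrictSpace E (k + 1) (fderiv ℝ β (p, t) (0, 1)) := by
    intro t
    rw [ContinuousAlternatingMap.alternatizeUncurryFinCLM_apply,
      ← alternatizeUncurryFin_contractTime _ (hcl p hp t)]
    congr 1
    unfold partialFDeriv
    have h2 : HasFDerivAt (fun q => contractTime E k (β q))
        ((contractTime E k).comp (fderiv ℝ β (p, t))) (p, t) :=
      (contractTime E k).hasFDerivAt.comp (p, t) (hβd t).hasFDerivAt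
    rw [h2.fderiv]
    rfl
  simp only [h1]
  -- After the Cartan formula the integrand is the time derivative of the restricted form, so the
  -- fundamental theorem of calculus finishes the proof.
  refine intervalIntegral.integral_eq_sub_of_hasDerivAt
    (f := fun t => restrictSpace E (k + 1) (β (p, t))) (fun t _ => ?_) ?_
  · have h3 : HasDerivAt (fun t : ℝ => (p, t)) ((0, 1) : E × ℝ) t :=
      (hasDerivAt_const t p).prodMk (hasDerivAt_id t)
    exact (restrictSpace E (k + 1)).hasFDerivAt.comp_hasDerivAt t
      ((hβd t).hasFDerivAt.comp_hasDerivAt t h3)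
  · refine Continuous.intervalIntegrable ?_ _ _
    have h4 := (hβ.fderiv_of_isOpen (m := ∞) (hs.prod isOpen_univ) (by simp)).continuousOn
    exact (restrictSpace E (k + 1)).continuous.comp
      ((continuous_slice h4 hp).clm_apply continuous_const)

end HomotopyFormula

/-! ### The homotopy operator on a manifold. -/

section HomotopyOperator

/-- The variant of `contDiffAt_compCLM` with different source, target and parameter space, needed
for `E × ℝ → E`. Composition is smooth for multilinear maps, and `(k!)⁻¹` times alternatization
returns to alternating maps without changing those that are already alternating. -/
lemma contDiffAt_compContinuousLinearMap {P F E : Type*} [NormedAddCommGroup P] [NormedSpace ℝ P]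
    [NormedAddCommGroup F] [NormedSpace ℝ F] [NormedAddCommGroup E] [NormedSpace ℝ E] {k : ℕ}
    {a : P → E [⋀^Fin k]→L[ℝ] ℝ} {g : P → F →L[ℝ] E} {y : P}
    (ha : ContDiffAt ℝ ∞ a y) (hg : ContDiffAt ℝ ∞ g y) :
    ContDiffAt ℝ ∞ (fun y => (a y).compContinuousLinearMap (g y)) y := by
  have h0 : ContDiffAt ℝ ∞ (fun p : (Fin k → F →L[ℝ] E) × ContinuousMultilinearMap ℝ
      (fun _ : Fin k => E) ℝ => p.2.compContinuousLinearMap p.1)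
      ((fun _ => g y), (a y).toContinuousMultilinearMap) :=
    ContinuousMultilinearMap.analyticAt_uncurry_compContinuousLinearMap.contDiffAt
  have h1 : ContDiffAt ℝ ∞ (fun y => (a y).toContinuousMultilinearMap.compContinuousLinearMap
      (fun _ => g y)) y := by
    have h5 : ContDiffAt ℝ ∞ (fun y => (a y).toContinuousMultilinearMap) y :=
      (((ContinuousAlternatingMap.toContinuousMultilinearMapCLM ℝ :
        E [⋀^Fin k]→L[ℝ] ℝ →L[ℝ] ContinuousMultilinearMap ℝ (fun _ : Fin k => E) ℝ).contDiff
          (n := ∞)).contDiffAt (x := a y)).comp y ha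
    have h6 : ContDiffAt ℝ ∞ (fun y => ((fun _ : Fin k => g y),
        (a y).toContinuousMultilinearMap)) y := (contDiffAt_pi.2 fun _ => hg).prodMk h5
    exact ContDiffAt.comp y h0 h6
  have h2 := ((((k.factorial : ℝ)⁻¹) • altCLM (E := F) k).contDiff (n := ∞)).contDiffAt.comp y h1
  refine h2.congr_of_eventuallyEq (Eventually.of_forall fun z => ?_)
  ext v
  simp only [Function.comp_apply, _root_.smul_apply,
    ContinuousAlternatingMap.smul_apply, altCLM_apply]
  have h3 : ∀ s : Equiv.Perm (Fin k), Equiv.Perm.sign s •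
      (a z).compContinuousLinearMap (g z) (v ∘ s) = (a z).compContinuousLinearMap (g z) v := by
    intro s
    have := ((a z).compContinuousLinearMap (g z)).toAlternatingMap.map_perm v s
    refine (congrArg (fun r => Equiv.Perm.sign s • r) this).trans ?_
    rw [smul_smul, Int.units_mul_self, one_smul]
    rfl
  have h4 := Finset.sum_congr (s₁ := Finset.univ) rfl fun s _ => h3 s
  rw [Finset.sum_const, Finset.card_univ, Fintype.card_perm, Fintype.card_fin] at h4
  refine Eq.trans ?_ (congrArg (fun r => ((k.factorial : ℝ)⁻¹) • r) h4.symm)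
  have : (k.factorial : ℝ) ≠ 0 := by positivity
  simp only [nsmul_eq_mul, smul_eq_mul]
  field_simp

universe v

variable {E : Type v} [NormedAddCommGroup E] [NormedSpace ℝ E]
variable {M : Type u} [TopologicalSpace M] [ChartedSpace E M]

/-- The differential of a map on `M × ℝ`. -/
def dmapProd (H : M × ℝ → M) (q : M × ℝ) : E × ℝ →L[ℝ] E :=
  (mfderiv (𝓘(ℝ, E).prod 𝓘(ℝ, ℝ)) 𝓘(ℝ, E) H q :
    TangentSpace (𝓘(ℝ, E).prod 𝓘(ℝ, ℝ)) q →L[ℝ] TangentSpace 𝓘(ℝ, E) (H q))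

lemma dmapProd_comp_inl {H : M × ℝ → M}
    (hH : ContMDiff (𝓘(ℝ, E).prod 𝓘(ℝ, ℝ)) 𝓘(ℝ, E) ∞ H) (x : M) (t : ℝ) :
    (dmapProd H (x, t) : E × ℝ →L[ℝ] E).comp (ContinuousLinearMap.inl ℝ E ℝ) =
      dmap E (fun x => H (x, t)) x := by
  have h1 : MDifferentiableAt 𝓘(ℝ, E) (𝓘(ℝ, E).prod 𝓘(ℝ, ℝ)) (fun x : M => (x, t)) x :=
    mdifferentiableAt_id.prodMk mdifferentiableAt_const
  have h2 := mfderiv_comp x (hH.contMDiffAt (x := (x, t)).mdifferentiableAt (by simp)) h1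
  refine Eq.trans ?_ h2.symm
  rw [mfderiv_prod_left]
  rfl

/-- A homotopy in the chart around `x₀` of its source and the chart around `z₀` of its target. -/
def homotopyRep (H : M × ℝ → M) (x₀ z₀ : M) (q : E × ℝ) : E :=
  chartAt E z₀ (H ((chartAt E x₀).symm q.1, q.2))

variable [IsManifold 𝓘(ℝ, E) ∞ M]

lemma contMDiffAt_homotopyRep {H : M × ℝ → M}
    (hH : ContMDiff (𝓘(ℝ, E).prod 𝓘(ℝ, ℝ)) 𝓘(ℝ, E) ∞ H) {x₀ z₀ : M} {y : E} {t : ℝ}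
    (hy : y ∈ (chartAt E x₀).target)
    (hz : H ((chartAt E x₀).symm y, t) ∈ (chartAt E z₀).source) :
    ContMDiffAt (𝓘(ℝ, E).prod 𝓘(ℝ, ℝ)) 𝓘(ℝ, E) ∞ (homotopyRep H x₀ z₀ : E × ℝ → E) (y, t) :=
  (contMDiffAt_chartAt z₀ hz).comp (y, t) ((hH _).comp (y, t)
    (ContMDiffAt.prodMap (contMDiffAt_chartAt_symm x₀ hy) contMDiffAt_id))

lemma contDiffAt_homotopyRep {H : M × ℝ → M}
    (hH : ContMDiff (𝓘(ℝ, E).prod 𝓘(ℝ, ℝ)) 𝓘(ℝ, E) ∞ H) {x₀ z₀ : M} {y : E} {t : ℝ}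
    (hy : y ∈ (chartAt E x₀).target)
    (hz : H ((chartAt E x₀).symm y, t) ∈ (chartAt E z₀).source) :
    ContDiffAt ℝ ∞ (homotopyRep H x₀ z₀ : E × ℝ → E) (y, t) := by
  have h := contMDiffAt_homotopyRep hH hy hz
  rw [← modelWithCornersSelf_prod, chartedSpaceSelf_prod] at h
  exact h.contDiffAt

/-- The differential of a homotopy, in a chart of its source. -/
def dhomotopy (H : M × ℝ → M) (x₀ : M) (q : E × ℝ) : E × ℝ →L[ℝ] E :=
  (dmapProd H ((chartAt E x₀).symm q.1, q.2)).comp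
    ((dmap E (chartAt E x₀).symm q.1).prodMap (ContinuousLinearMap.id ℝ ℝ))

lemma fderiv_homotopyRep {H : M × ℝ → M}
    (hH : ContMDiff (𝓘(ℝ, E).prod 𝓘(ℝ, ℝ)) 𝓘(ℝ, E) ∞ H) {x₀ z₀ : M} {y : E} {t : ℝ}
    (hy : y ∈ (chartAt E x₀).target)
    (hz : H ((chartAt E x₀).symm y, t) ∈ (chartAt E z₀).source) :
    fderiv ℝ (homotopyRep H x₀ z₀ : E × ℝ → E) (y, t) =
      (dmap E (chartAt E z₀) (H ((chartAt E x₀).symm y, t))).comp (dhomotopy H x₀ (y, t)) := by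
  have h0 := (contMDiffAt_chartAt_symm x₀ hy).mdifferentiableAt (by simp)
  have h1 : MDifferentiableAt (𝓘(ℝ, E).prod 𝓘(ℝ, ℝ)) (𝓘(ℝ, E).prod 𝓘(ℝ, ℝ))
      (Prod.map (chartAt E x₀).symm (id : ℝ → ℝ)) (y, t) := h0.prodMap mdifferentiableAt_id
  have h2 : MDifferentiableAt (𝓘(ℝ, E).prod 𝓘(ℝ, ℝ)) 𝓘(ℝ, E) H ((chartAt E x₀).symm y, t) :=
    (hH _).mdifferentiableAt (by simp)
  have h3 := (contMDiffAt_chartAt z₀ hz).mdifferentiableAt (by simp)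
  have h4 := mfderiv_comp (y, t) h3 (h2.comp (y, t) h1)
  rw [mfderiv_comp (y, t) h2 h1, mfderiv_prodMap h0 mdifferentiableAt_id] at h4
  -- The product manifold structure on `E × ℝ` has to be identified with that of a normed space
  -- before manifold and Fréchet derivatives can be compared.
  have h5 : fderiv ℝ (homotopyRep H x₀ z₀ : E × ℝ → E) (y, t) =
      mfderiv (𝓘(ℝ, E).prod 𝓘(ℝ, ℝ)) 𝓘(ℝ, E) (homotopyRep H x₀ z₀ : E × ℝ → E) (y, t) := by
    rw [← mfderiv_eq_fderiv]
    congr 1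
    · exact modelWithCornersSelf_prod
    · exact chartedSpaceSelf_prod.symm
  rw [h5]
  refine Eq.trans h4 ?_
  rw [mfderiv_id]
  rfl

/-- The pullback of a form along a homotopy, in a chart of its source. -/
def homotopyPullback {k : ℕ} (H : M × ℝ → M) (α : RawForm E M k) (x₀ : M) (q : E × ℝ) :
    (E × ℝ) [⋀^Fin k]→L[ℝ] ℝ :=
  (α (H ((chartAt E x₀).symm q.1, q.2))).compContinuousLinearMap (dhomotopy H x₀ q)

/-- With a chart of the target as well, the pullback is locally that of a form on `E` along a smooth
map of vector spaces. Smoothness and closedness follow from this description. -/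
lemma homotopyPullback_eventuallyEq {k : ℕ} {H : M × ℝ → M}
    (hH : ContMDiff (𝓘(ℝ, E).prod 𝓘(ℝ, ℝ)) 𝓘(ℝ, E) ∞ H) (α : RawForm E M k) {x₀ z₀ : M} {y : E}
    {t : ℝ} (hy : y ∈ (chartAt E x₀).target)
    (hz : H ((chartAt E x₀).symm y, t) ∈ (chartAt E z₀).source) :
    homotopyPullback H α x₀ =ᶠ[𝓝 (y, t)] fun q =>
      (α.rep z₀ (homotopyRep H x₀ z₀ q)).compContinuousLinearMap
        (fderiv ℝ (homotopyRep H x₀ z₀) q) := by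
  have h1 : ContinuousAt (fun q : E × ℝ => H ((chartAt E x₀).symm q.1, q.2)) (y, t) :=
    hH.continuous.continuousAt.comp ((((chartAt E x₀).continuousAt_symm hy).comp
      continuousAt_fst).prodMk continuousAt_snd)
  filter_upwards [h1.eventually ((chartAt E z₀).open_source.mem_nhds hz),
    continuousAt_fst.eventually ((chartAt E x₀).open_target.mem_nhds hy)] with q hq1 hq2
  rw [show q = (q.1, q.2) from rfl, fderiv_homotopyRep hH hq2 hq1]
  unfold homotopyPullback homotopyRep
  rw [← rep_chart α z₀ hq1]
  rfl

lemma contDiffAt_homotopyPullback {k : ℕ} {H : M × ℝ → M}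
    (hH : ContMDiff (𝓘(ℝ, E).prod 𝓘(ℝ, ℝ)) 𝓘(ℝ, E) ∞ H) {α : RawForm E M k} (hα : α.IsSmooth)
    {x₀ : M} {y : E} (t : ℝ) (hy : y ∈ (chartAt E x₀).target) :
    ContDiffAt ℝ ∞ (homotopyPullback H α x₀) (y, t) := by
  set z₀ := H ((chartAt E x₀).symm y, t)
  have hz : H ((chartAt E x₀).symm y, t) ∈ (chartAt E z₀).source := mem_chart_source E z₀
  have h1 := contDiffAt_homotopyRep hH hy hz
  refine ContDiffAt.congr_of_eventuallyEq ?_ (homotopyPullback_eventuallyEq hH α hy hz)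
  refine contDiffAt_compContinuousLinearMap (ContDiffAt.comp (g := α.rep z₀) (y, t) ?_ h1)
    (h1.fderiv_right (by simp))
  exact IsSmooth.contDiffAt hα ((chartAt E z₀).map_source hz)

lemma extDeriv_homotopyPullback {k : ℕ} {H : M × ℝ → M}
    (hH : ContMDiff (𝓘(ℝ, E).prod 𝓘(ℝ, ℝ)) 𝓘(ℝ, E) ∞ H) {α : RawForm E M k} (hα : α.IsSmooth)
    (hcl : α.ext = 0) {x₀ : M} {y : E} (t : ℝ) (hy : y ∈ (chartAt E x₀).target) :
    extDeriv (homotopyPullback H α x₀) (y, t) = 0 := by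
  set z₀ := H ((chartAt E x₀).symm y, t)
  have hz : H ((chartAt E x₀).symm y, t) ∈ (chartAt E z₀).source := mem_chart_source E z₀
  have h1 := contDiffAt_homotopyRep hH hy hz
  have h2 := (chartAt E z₀).map_source hz
  rw [(homotopyPullback_eventuallyEq hH α hy hz).extDeriv_eq]
  refine (extDeriv_pullback (f := homotopyRep H x₀ z₀)
    ((IsSmooth.contDiffAt hα h2).differentiableAt (by simp)) h1 two_le_smooth).trans ?_
  have h3 : extDeriv (α.rep z₀) (homotopyRep H x₀ z₀ (y, t)) = 0 := by
    refine (rep_ext hα h2).symm.trans ?_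
    rw [hcl]
    rfl
  rw [h3]
  rfl

/-- The homotopy operator: the integral over the unit interval of the contraction of the pullback
of a form along a homotopy with the unit vector field of the interval. -/
def homotopyOperator {k : ℕ} (H : M × ℝ → M) (α : RawForm E M (k + 1)) : RawForm E M k := fun x =>
  ∫ t in (0 : ℝ)..1, contractTime E k ((α (H (x, t))).compContinuousLinearMap (dmapProd H (x, t)))

/-- Undoing the chart of the source carries continuity in `t` over to the integrand of
`homotopyOperator`, which is defined without charts. -/
lemma dhomotopy_chart (H : M × ℝ → M) (x : M) (t : ℝ) :
    (dhomotopy H x (chartAt E x x, t)).comp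
      ((dmap E (chartAt E x) x).prodMap (ContinuousLinearMap.id ℝ ℝ)) = dmapProd H (x, t) := by
  have h1 := dmap_symm_comp_chart x (mem_chart_source E x)
  unfold dhomotopy
  dsimp only
  rw [(chartAt E x).left_inv (mem_chart_source E x), ContinuousLinearMap.comp_assoc]
  have h2 : ((dmap E (chartAt E x).symm (chartAt E x x)).prodMap (ContinuousLinearMap.id ℝ ℝ)).comp
      ((dmap E (chartAt E x) x).prodMap (ContinuousLinearMap.id ℝ ℝ)) =
      ContinuousLinearMap.id ℝ (E × ℝ) :=
    ContinuousLinearMap.ext fun v => Prod.ext (DFunLike.congr_fun h1 v.1) rfl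
  rw [h2, ContinuousLinearMap.comp_id]

/-- Pullback along the chart is linear and leaves the time direction alone, so it commutes with
contraction and with the integral. One chart of the source is used for the whole interval, while
charts of the target may vary with `t`. -/
lemma rep_homotopyOperator {k : ℕ} {H : M × ℝ → M}
    (hH : ContMDiff (𝓘(ℝ, E).prod 𝓘(ℝ, ℝ)) 𝓘(ℝ, E) ∞ H) {α : RawForm E M (k + 1)}
    (hα : α.IsSmooth) (x₀ : M) (y : E) :
    (homotopyOperator H α).rep x₀ y =
      ∫ t in (0 : ℝ)..1, contractTime E k (homotopyPullback H α x₀ (y, t)) := by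
  set x := (chartAt E x₀).symm y with hx
  have hcont : ∀ x₁ : M, ∀ y₁ ∈ (chartAt E x₁).target,
      Continuous fun t => homotopyPullback H α x₁ (y₁, t) := fun x₁ y₁ hy₁ =>
    continuous_iff_continuousAt.2 fun t => (contDiffAt_homotopyPullback hH hα t
      hy₁).continuousAt.comp (by fun_prop : ContinuousAt (fun t : ℝ => (y₁, t)) t)
  have h1 : Continuous fun t =>
      (α (H (x, t))).compContinuousLinearMap (dmapProd H (x, t) : E × ℝ →L[ℝ] E) := by
    have h2 := (ContinuousAlternatingMap.compContinuousLinearMapCLM (F := ℝ) (ι := Fin (k + 1))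
      ((dmap E (chartAt E x) x).prodMap (ContinuousLinearMap.id ℝ ℝ))).continuous.comp
        (hcont x _ (mem_chart_target E x))
    refine h2.congr fun t => ?_
    change (homotopyPullback H α x (chartAt E x x, t)).compContinuousLinearMap _ = _
    rw [← dhomotopy_chart]
    unfold homotopyPullback
    dsimp only
    rw [(chartAt E x).left_inv (mem_chart_source E x)]
    rfl
  change ContinuousAlternatingMap.compContinuousLinearMapCLM (dmap E (chartAt E x₀).symm y)
    (∫ t in (0 : ℝ)..1, contractTime E k
      ((α (H (x, t))).compContinuousLinearMap (dmapProd H (x, t)))) = _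
  have h3 : IntervalIntegrable (fun t => contractTime E k
      ((α (H (x, t))).compContinuousLinearMap (dmapProd H (x, t)))) MeasureTheory.volume 0 1 :=
    ((contractTime E k).continuous.comp h1).intervalIntegrable _ _
  rw [← ContinuousLinearMap.intervalIntegral_comp_comm _ h3]
  refine intervalIntegral.integral_congr fun t _ => ?_
  ext v
  change _ = (α (H (x, t))).compContinuousLinearMap (dhomotopy H x₀ (y, t))
    (Matrix.vecCons (0, 1) fun i => (v i, 0))
  change (α (H (x, t))).compContinuousLinearMap (dmapProd H (x, t) : E × ℝ →L[ℝ] E)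
    (Matrix.vecCons (0, 1) fun i => (dmap E (chartAt E x₀).symm y (v i), 0)) = _
  simp only [ContinuousAlternatingMap.compContinuousLinearMap_apply]
  congr 1
  funext i
  refine Fin.cases ?_ (fun i => ?_) i <;> simp [dhomotopy, hx]

/-- If the identity of a manifold is smoothly homotopic to a locally constant map, closed forms of
positive degree are exact. -/
lemma exists_ext_eq_of_homotopy {k : ℕ} {H : M × ℝ → M}
    (hH : ContMDiff (𝓘(ℝ, E).prod 𝓘(ℝ, ℝ)) 𝓘(ℝ, E) ∞ H) (h1 : ∀ x, H (x, 1) = x)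
    (h0 : IsLocallyConstant fun x => H (x, 0)) {α : RawForm E M (k + 1)} (hα : α.IsSmooth)
    (hcl : α.ext = 0) : ∃ η : RawForm E M k, η.IsSmooth ∧ η.ext = α := by
  have hβ : ∀ x₀ : M, ContDiffOn ℝ ∞ (homotopyPullback H α x₀)
      ((chartAt E x₀).target ×ˢ (univ : Set ℝ)) := fun x₀ q hq =>
    (contDiffAt_homotopyPullback hH hα q.2 hq.1).contDiffWithinAt
  have hsm : (homotopyOperator H α).IsSmooth := by
    intro x₀
    have h := contDiffOn_integral_zero_one (chartAt E x₀).open_target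
      ((contractTime E k).contDiff.comp_contDiffOn (hβ x₀))
    exact h.congr fun y _ => rep_homotopyOperator hH hα x₀ y
  refine ⟨homotopyOperator H α, hsm, RawForm.ext_of_rep fun x₀ y hy => ?_⟩
  rw [rep_ext hsm hy, funext (rep_homotopyOperator hH hα x₀),
    extDeriv_integral_contractTime (chartAt E x₀).open_target
    (hβ x₀) (fun p hp t => extDeriv_homotopyPullback hH hα hcl t hp) hy]
  set x := (chartAt E x₀).symm y
  have hr : ∀ t, restrictSpace E (k + 1) (homotopyPullback H α x₀ (y, t)) =
      (α (H (x, t))).compContinuousLinearMap ((dmap E (fun x => H (x, t)) x).comp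
        (dmap E (chartAt E x₀).symm y)) := by
    intro t
    rw [← dmapProd_comp_inl hH]
    ext v
    change (α (H (x, t))) (fun i => _) = (α (H (x, t))) (fun i => _)
    congr 1
  rw [hr, hr]
  -- At time `1` the restriction is `α` itself. At time `0` the map is locally constant, its
  -- differential is zero, and a form of positive degree pulls back to zero.
  have e1 : dmap E (fun x => H (x, 1)) x = ContinuousLinearMap.id ℝ E := by
    rw [funext h1]
    exact dmap_id x
  have e0 : dmap E (fun x => H (x, 0)) x = 0 := by
    rw [dmap_congr (g := fun _ => H (x, 0)) (h0.eventually_eq x)]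
    exact mfderiv_const
  rw [e1, e0, h1]
  have e2 : (α (H (x, 0))).compContinuousLinearMap
      ((0 : E →L[ℝ] E).comp (dmap E (chartAt E x₀).symm y)) = 0 := by
    ext v
    exact (α (H (x, 0))).map_coord_zero 0 rfl
  rw [e2, sub_zero]
  rfl

end HomotopyOperator

/-! ### Components of paracompact manifolds are σ-compact. -/

section SigmaCompact

/-- A connected locally compact paracompact Hausdorff space is σ-compact. -/
lemma sigmaCompactSpace_of_connected (X : Type*) [TopologicalSpace X] [T2Space X]
    [ParacompactSpace X] [WeaklyLocallyCompactSpace X] [ConnectedSpace X] :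
    SigmaCompactSpace X := by
  choose K hK hKx using fun x : X => exists_compact_mem_nhds x
  obtain ⟨v, hvo, hvc, hvf, hvK⟩ := precise_refinement (fun x => interior (K x))
    (fun x => isOpen_interior) (eq_univ_of_forall fun x => mem_iUnion.2
      ⟨x, mem_interior_iff_mem_nhds.2 (hKx x)⟩)
  -- A compact set meets only finitely many members of the locally finite cover, each contained in a
  -- compact set. Iteration from a point gives a countable union of compact sets that is clopen,
  -- hence everything.
  have hstep : ∀ A : TopologicalSpace.Compacts X, ∃ B : TopologicalSpace.Compacts X,
      ∀ i, (v i ∩ A).Nonempty → v i ⊆ B := by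
    intro A
    have hfin := hvf.finite_nonempty_inter_compact A.isCompact
    refine ⟨⟨⋃ i ∈ hfin.toFinset, K i, hfin.toFinset.isCompact_biUnion fun i _ => hK i⟩,
      fun i hi y hy => mem_biUnion (x := i) ?_ (interior_subset (hvK i hy))⟩
    exact hfin.mem_toFinset.2 hi
  choose f hf using hstep
  obtain ⟨x₀⟩ := (inferInstance : Nonempty X)
  let A : ℕ → TopologicalSpace.Compacts X := fun n => f^[n] ⟨{x₀}, isCompact_singleton⟩
  have hA : ∀ n i, (v i ∩ A n).Nonempty → v i ⊆ A (n + 1) := by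
    intro n i hi
    simp only [A, Function.iterate_succ_apply'] at hi ⊢
    exact hf _ i hi
  have hv : ∀ x, ∃ i, x ∈ v i := fun x => mem_iUnion.1 (hvc ▸ mem_univ x)
  have hcl : IsClopen (⋃ n, (A n : Set X)) := by
    constructor
    · refine isClosed_of_closure_subset fun x hx => ?_
      obtain ⟨i, hi⟩ := hv x
      obtain ⟨y, hy, hyA⟩ := mem_closure_iff.1 hx (v i) (hvo i) hi
      obtain ⟨n, hn⟩ := mem_iUnion.1 hyA
      exact mem_iUnion.2 ⟨n + 1, hA n i ⟨y, hy, hn⟩ hi⟩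
    · refine isOpen_iff_mem_nhds.2 fun x hx => ?_
      obtain ⟨n, hn⟩ := mem_iUnion.1 hx
      obtain ⟨i, hi⟩ := hv x
      exact mem_of_superset ((hvo i).mem_nhds hi)
        ((hA n i ⟨x, hi, hn⟩).trans (subset_iUnion (fun n => (A n : Set X)) (n + 1)))
  have huniv := hcl.eq_univ ⟨x₀, mem_iUnion.2 ⟨0, rfl⟩⟩
  exact ⟨⟨fun n => A n, fun n => (A n).isCompact, huniv⟩⟩

lemma isSigmaCompact_connectedComponent {X : Type*} [TopologicalSpace X] [T2Space X]
    [ParacompactSpace X] [LocallyCompactSpace X] (x : X) :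
    IsSigmaCompact (connectedComponent x) := by
  have h : IsClosedEmbedding (Subtype.val : connectedComponent x → X) :=
    isClosed_connectedComponent.isClosedEmbedding_subtypeVal
  have : ParacompactSpace (connectedComponent x) := h.paracompactSpace
  have : LocallyCompactSpace (connectedComponent x) := h.locallyCompactSpace
  have : ConnectedSpace (connectedComponent x) :=
    isConnected_iff_connectedSpace.1 isConnected_connectedComponent
  exact isSigmaCompact_iff_sigmaCompactSpace.2 (sigmaCompactSpace_of_connected _)

end SigmaCompact

/-! ### Smooth contractions of contractible components. -/

section Contraction

variable {E : Type*} [NormedAddCommGroup E] [NormedSpace ℝ E] [FiniteDimensional ℝ E]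
variable {M : Type*} [TopologicalSpace M] [T2Space M] [ChartedSpace E M]
  [IsManifold 𝓘(ℝ, E) ∞ M]

/-- A contractible open set has a smooth contraction. -/
lemma exists_smooth_contraction {C : Set M} (hC : IsOpen C) (hσ : IsSigmaCompact C)
    [ContractibleSpace C] : ∃ (g : {p : M × ℝ | p.1 ∈ C} → M) (y : M),
      @ContMDiff ℝ _ (E × ℝ) _ _ (ModelProd E ℝ) _ (𝓘(ℝ, E).prod 𝓘(ℝ, ℝ))
        (⟨{p : M × ℝ | p.1 ∈ C}, hC.preimage continuous_fst⟩ : TopologicalSpace.Opens (M × ℝ)) _ _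
        E _ _ E _ 𝓘(ℝ, E) M _ _ ∞ g ∧
      (∀ x (hx : x ∈ C), g ⟨(x, 1), hx⟩ = x) ∧ ∀ x (hx : x ∈ C), g ⟨(x, 0), hx⟩ = y := by
  let W : TopologicalSpace.Opens (M × ℝ) := ⟨{p : M × ℝ | p.1 ∈ C}, hC.preimage continuous_fst⟩
  have hW : IsSigmaCompact (W : Set (M × ℝ)) := by
    have := isSigmaCompact_iff_sigmaCompactSpace.1 hσ
    have h1 : (W : Set (M × ℝ)) = range (Prod.map (Subtype.val : C → M) (id : ℝ → ℝ)) := by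
      rw [range_prodMap, Subtype.range_coe, range_id]
      ext p
      simp [W]
    rw [h1]
    exact isSigmaCompact_range (continuous_subtype_val.prodMap continuous_id)
  have : SigmaCompactSpace W := isSigmaCompact_iff_sigmaCompactSpace.1 hW
  obtain ⟨y, ⟨F⟩⟩ := id_nullhomotopic C
  -- The homotopy `F` starts at the identity and ends at a constant, so time is reversed. It is also
  -- made stationary for `t ≤ 1/4` and `t ≥ 3/4`, so that `f` is smooth near both ends before the
  -- smoothing, which then preserves the values for `t ≤ 0` and `t ≥ 1`.
  let τ : ℝ → unitInterval := fun t => projIcc 0 1 zero_le_one (3 / 2 - 2 * t)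
  have hτ : Continuous τ := continuous_projIcc.comp (by fun_prop)
  have hτ1 : ∀ t ≤ (1 / 4 : ℝ), τ t = 1 := fun t ht =>
    projIcc_of_right_le _ (by linarith)
  have hτ0 : ∀ t, (3 / 4 : ℝ) ≤ t → τ t = 0 := fun t ht =>
    projIcc_of_le_left _ (by linarith)
  let f : W → M := fun w => F (τ w.1.2, ⟨w.1.1, w.2⟩)
  have hf : Continuous f := by
    refine continuous_subtype_val.comp (F.continuous.comp (Continuous.prodMk ?_ ?_))
    · exact hτ.comp (continuous_snd.comp continuous_subtype_val)
    · exact Continuous.subtype_mk (continuous_fst.comp continuous_subtype_val) _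
  have hf1 : ∀ w : W, w.1.2 ≤ 1 / 4 → f w = y := fun w hw => by
    simp only [f, hτ1 _ hw]
    rw [F.apply_one]
    rfl
  have hf0 : ∀ w : W, 3 / 4 ≤ w.1.2 → f w = w.1.1 := fun w hw => by
    simp only [f, hτ0 _ hw]
    rw [F.apply_zero]
    rfl
  have hsnd : Continuous fun w : W => w.1.2 := continuous_snd.comp continuous_subtype_val
  obtain ⟨g, hg, hgf⟩ := exists_contMDiff_eqOn (I := 𝓘(ℝ, E).prod 𝓘(ℝ, ℝ)) (E := E) hf
    (O := {w | w.1.2 < 1 / 4} ∪ {w | 3 / 4 < w.1.2}) (A := {w | w.1.2 ≤ 0} ∪ {w | 1 ≤ w.1.2})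
    ((isOpen_lt hsnd continuous_const).union (isOpen_lt continuous_const hsnd))
    ((isClosed_le hsnd continuous_const).union (isClosed_le continuous_const hsnd))
    (union_subset_union (fun w (hw : w.1.2 ≤ 0) => hw.trans_lt (by norm_num))
      fun w (hw : 1 ≤ w.1.2) => lt_of_lt_of_le (by norm_num) hw) (by
      rintro w (hw | hw)
      · refine (contMDiffAt_const (c := (y : M))).congr_of_eventuallyEq ?_
        filter_upwards [(isOpen_lt hsnd continuous_const).mem_nhds hw] with w' hw'
        exact hf1 w' (le_of_lt hw')
      · refine ContMDiffAt.congr_of_eventuallyEq (f := fun w : W => w.1.1)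
          ((contMDiff_fst.comp contMDiff_subtype_val).contMDiffAt) ?_
        filter_upwards [(isOpen_lt continuous_const hsnd).mem_nhds hw] with w' hw'
        exact hf0 w' (le_of_lt hw'))
  refine ⟨g, y, hg, fun x hx => ?_, fun x hx => ?_⟩
  · exact (hgf (x := (⟨(x, 1), hx⟩ : W)) (Or.inr (show (1 : ℝ) ≤ 1 from le_rfl))).trans (hf0 _ (by norm_num))
  · exact (hgf (x := (⟨(x, 0), hx⟩ : W)) (Or.inl (show (0 : ℝ) ≤ 0 from le_rfl))).trans (hf1 _ (by norm_num))

/-- A manifold with contractible components is smoothly homotopic to a discrete set of points. -/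
lemma exists_smooth_homotopy (hσ : ∀ x : M, IsSigmaCompact (connectedComponent x))
    (hc : ∀ x : M, ContractibleSpace (connectedComponent x)) :
    ∃ H : M × ℝ → M, ContMDiff (𝓘(ℝ, E).prod 𝓘(ℝ, ℝ)) 𝓘(ℝ, E) ∞ H ∧ (∀ x, H (x, 1) = x) ∧
      IsLocallyConstant fun x => H (x, 0) := by
  have : LocallyConnectedSpace M := ChartedSpace.locallyConnectedSpace E M
  have hop : ∀ x : M, IsOpen (connectedComponent x) := fun x => isOpen_connectedComponent
  choose g y hg hg1 hg0 using fun x : M => exists_smooth_contraction (E := E) (hop x) (hσ x)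
  -- One base point per component: the contraction used at `x` depends only on the component of `x`,
  -- so the contractions glue.
  let r : M → M := fun x => (x : ConnectedComponents M).out
  have hr : ∀ x, x ∈ connectedComponent (r x) := fun x =>
    ConnectedComponents.coe_eq_coe'.1 (Quotient.out_eq (x : ConnectedComponents M)).symm
  have hrr : ∀ x x', x' ∈ connectedComponent (r x) → r x' = r x := by
    intro x x' h
    have h1 : (x' : ConnectedComponents M) = x :=
      (ConnectedComponents.coe_eq_coe'.2 h).trans (Quotient.out_eq (x : ConnectedComponents M))
    simp only [r, h1]
  have key : ∀ (z z' : M) (h : z = z') (q : M × ℝ) (hq : q.1 ∈ connectedComponent z),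
      g z ⟨q, hq⟩ = g z' ⟨q, h ▸ hq⟩ := by
    rintro z _ rfl q hq
    rfl
  refine ⟨fun q => g (r q.1) ⟨q, hr q.1⟩, fun q => ?_, fun x => hg1 (r x) x (hr x), ?_⟩
  · let W : TopologicalSpace.Opens (M × ℝ) :=
      ⟨{p : M × ℝ | p.1 ∈ connectedComponent (r q.1)}, (hop (r q.1)).preimage continuous_fst⟩
    have h1 := (contMDiffAt_subtype_iff (U := W) (I := 𝓘(ℝ, E).prod 𝓘(ℝ, ℝ)) (I' := 𝓘(ℝ, E))
      (n := ∞) (f := fun q => g (r q.1) ⟨q, hr q.1⟩) (x := ⟨q, hr q.1⟩)).1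
    refine h1 (ContMDiffAt.congr_of_eventuallyEq ((hg (r q.1)).contMDiffAt) ?_)
    exact Eventually.of_forall fun w => key _ _ (hrr q.1 w.1.1 w.2) w.1 (hr w.1.1)
  · refine (IsLocallyConstant.iff_eventually_eq _).2 fun x => ?_
    filter_upwards [(hop (r x)).mem_nhds (hr x)] with x' hx'
    rw [hg0 (r x') x' (hr x'), hg0 (r x) x (hr x), hrr x x' hx']

end Contraction

/-! ### Topology of the nerve and its smooth homotopies. -/

namespace EtaleGroupoid

variable {E : Type*} [NormedAddCommGroup E] [NormedSpace ℝ E] {G₀ G₁ : Type u}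
variable [TopologicalSpace G₀] [ChartedSpace E G₀] [T2Space G₀]
variable [TopologicalSpace G₁] [ChartedSpace E G₁]
variable {G : EtaleGroupoid E G₀ G₁}

/-- The equations `s a_i = x_i` and `t a_i = x_{i+1}` cut out a closed subset because `G₀` is
Hausdorff. -/
lemma Nerve.isClosedEmbedding (k : ℕ) :
    IsClosedEmbedding fun p : G.Nerve k => (p.vertex, p.arrow) := by
  have hs : Continuous G.s := G.etale_s.contMDiff.continuous
  have ht : Continuous G.t := G.etale_t.contMDiff.continuous
  refine ⟨⟨⟨rfl⟩, fun p q h => ?_⟩, ?_⟩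
  · exact Nerve.ext (congrArg Prod.fst h) (congrArg Prod.snd h)
  · have h : (range fun p : G.Nerve k => (p.vertex, p.arrow)) =
        ⋂ i : Fin k, {q | G.s (q.2 i) = q.1 i.castSucc} ∩ {q | G.t (q.2 i) = q.1 i.succ} := by
      ext q
      simp only [mem_range, mem_iInter, mem_inter_iff, mem_ofPred_eq]
      constructor
      · rintro ⟨p, rfl⟩ i
        exact ⟨p.s_arrow i, p.t_arrow i⟩
      · intro h
        exact ⟨⟨q.1, q.2, fun i => (h i).1, fun i => (h i).2⟩, rfl⟩
    rw [h]
    exact isClosed_iInter fun i => (isClosed_eq (by fun_prop) (by fun_prop)).inter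
      (isClosed_eq (by fun_prop) (by fun_prop))

variable [T2Space G₁]

instance (k : ℕ) : T2Space (G.Nerve k) := (Nerve.isClosedEmbedding k).isEmbedding.t2Space

variable [FiniteDimensional ℝ E] [ParacompactSpace G₀] [ParacompactSpace G₁]

/-- A component of the nerve is closed in a finite product of components of `G₀` and `G₁`, which are
σ-compact. Thus the paracompactness of `G_k` itself need not be shown. -/
lemma Nerve.isSigmaCompact_connectedComponent {k : ℕ} (p : G.Nerve k) :
    IsSigmaCompact (connectedComponent p) := by
  have : LocallyCompactSpace G₀ := ChartedSpace.locallyCompactSpace E G₀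
  have : LocallyCompactSpace G₁ := ChartedSpace.locallyCompactSpace E G₁
  have h0 : ∀ i, SigmaCompactSpace (connectedComponent (p.vertex i)) := fun i =>
    isSigmaCompact_iff_sigmaCompactSpace.1 (_root_.isSigmaCompact_connectedComponent _)
  have h1 : ∀ i, SigmaCompactSpace (connectedComponent (p.arrow i)) := fun i =>
    isSigmaCompact_iff_sigmaCompactSpace.1 (_root_.isSigmaCompact_connectedComponent _)
  let φ : (∀ i, connectedComponent (p.vertex i)) × (∀ i, connectedComponent (p.arrow i)) →
    (Fin (k + 1) → G₀) × (Fin k → G₁) := fun q => (fun i => q.1 i, fun i => q.2 i)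
  have hφ : Continuous φ := by fun_prop
  have h2 := (isSigmaCompact_range hφ)
  rw [(Nerve.isClosedEmbedding k).isEmbedding.isSigmaCompact_iff]
  refine h2.of_isClosed_subset
    ((Nerve.isClosedEmbedding k).isClosedMap _ isClosed_connectedComponent) ?_
  rintro _ ⟨q, hq, rfl⟩
  exact ⟨(fun i => ⟨q.vertex i, (Nerve.continuous_vertex i).image_connectedComponent_subset p
    ⟨q, hq, rfl⟩⟩, fun i => ⟨q.arrow i, (Nerve.continuous_arrow
      i).image_connectedComponent_subset p ⟨q, hq, rfl⟩⟩), rfl⟩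

/-- The manifolds of a Leray groupoid are smoothly homotopic to discrete sets of points. -/
lemma IsLeray.exists_smooth_homotopy {E : Type} [NormedAddCommGroup E] [NormedSpace ℝ E]
    [FiniteDimensional ℝ E] [ChartedSpace E G₀] [ChartedSpace E G₁] [IsManifold 𝓘(ℝ, E) ∞ G₀]
    {G : EtaleGroupoid E G₀ G₁} (h : G.IsLeray) (k : ℕ) :
    ∃ H : G.Nerve k × ℝ → G.Nerve k, ContMDiff (𝓘(ℝ, E).prod 𝓘(ℝ, ℝ)) 𝓘(ℝ, E) ∞ H ∧
      (∀ x, H (x, 1) = x) ∧ IsLocallyConstant fun x => H (x, 0) :=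
  _root_.exists_smooth_homotopy Nerve.isSigmaCompact_connectedComponent (h k)

end EtaleGroupoid

/-! ### The Poincaré lemma and global logarithms. -/

section PoincareLemma

universe v

variable {E : Type v} [NormedAddCommGroup E] [NormedSpace ℝ E]
variable {M : Type u} [TopologicalSpace M] [ChartedSpace E M]

lemma DiffForm.ext_eval {f g : DiffForm E M 0} (h : ∀ x, f.eval x = g.eval x) : f = g :=
  Subtype.ext (funext fun x => ContinuousAlternatingMap.ext fun v => by
    rw [Subsingleton.elim v ![]]
    exact h x)

lemma DiffForm.ofInt_injective :
    Function.Injective (DiffForm.ofInt : LocallyConstant M ℤ →+ DiffForm E M 0) := by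
  intro z w h
  refine LocallyConstant.ext fun x => ?_
  have h1 : ((z x : ℤ) : ℝ) = (w x : ℝ) := congrArg (fun f : DiffForm E M 0 => f.eval x) h
  exact_mod_cast h1

lemma SmoothU1.ofConst_injective :
    Function.Injective (SmoothU1.ofConst : LocallyConstant M (Additive Circle) → SmoothU1 E M) :=
  fun _ _ h => LocallyConstant.ext fun x =>
    congrArg (fun g : SmoothU1 E M => Additive.ofMul (g.toMul x)) h

/-- A locally constant real valued function, as a form of degree `0`. -/
def DiffForm.ofLocallyConstant (h : LocallyConstant M ℝ) : DiffForm E M 0 :=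
  ⟨fun x => ContinuousAlternatingMap.constOfIsEmpty ℝ E (Fin 0) (h x), by
    intro x₀ y hy
    refine ((contDiffAt_const (c := ContinuousAlternatingMap.constOfIsEmpty ℝ E (Fin 0)
      (h ((chartAt E x₀).symm y)))).congr_of_eventuallyEq ?_).contDiffWithinAt
    have h1 := ((chartAt E x₀).continuousAt_symm hy).eventually
      (h.isLocallyConstant.eventually_eq ((chartAt E x₀).symm y))
    filter_upwards [h1] with y' hy'
    have hy2 : h ((chartAt E x₀).symm y') = h ((chartAt E x₀).symm y) := hy'
    ext v
    simp [RawForm.rep, hy2]⟩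

lemma DiffForm.scale_scale {k : ℕ} (a b : ℝ) (α : DiffForm E M k) :
    DiffForm.scale a k (DiffForm.scale b k α) = DiffForm.scale (a * b) k α :=
  Subtype.ext (smul_smul a b α.1)

lemma DiffForm.scale_one {k : ℕ} (α : DiffForm E M k) : DiffForm.scale 1 k α = α :=
  Subtype.ext (one_smul ℝ α.1)

lemma DiffForm.scale_two_pi_cancel {k : ℕ} (α : DiffForm E M k) :
    DiffForm.scale (2 * Real.pi) k (DiffForm.scale (2 * Real.pi)⁻¹ k α) = α := by
  rw [DiffForm.scale_scale, mul_inv_cancel₀ Real.two_pi_pos.ne', DiffForm.scale_one]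

lemma DiffForm.scale_two_pi_injective {k : ℕ} :
    Function.Injective (DiffForm.scale (2 * Real.pi) k : DiffForm E M k →+ DiffForm E M k) := by
  intro α β h
  have h1 := congrArg (DiffForm.scale (2 * Real.pi)⁻¹ k) h
  rwa [DiffForm.scale_scale, DiffForm.scale_scale, inv_mul_cancel₀ Real.two_pi_pos.ne',
    DiffForm.scale_one, DiffForm.scale_one] at h1

variable [IsManifold 𝓘(ℝ, E) ∞ M]

lemma DiffForm.d_scale {k : ℕ} (c : ℝ) (α : DiffForm E M k) :
    DiffForm.d k (DiffForm.scale c k α) = DiffForm.scale c (k + 1) (DiffForm.d k α) :=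
  Subtype.ext (RawForm.ext_smul α.smooth c)

/-- A continuous function with integer values is locally constant, since `ℤ` carries the discrete
topology as a subspace of `ℝ`. -/
lemma expU1_eq_zero_iff {f : DiffForm E M 0} :
    expU1 f = 0 ↔ ∃ z : LocallyConstant M ℤ, DiffForm.ofInt z = f := by
  constructor
  · intro h
    have h1 : ∀ x, ∃ n : ℤ, (n : ℝ) = f.eval x := by
      intro x
      have h2 : Circle.exp (2 * Real.pi * f.eval x) = 1 :=
        congrArg (fun g : SmoothU1 E M => g.toMul x) h
      obtain ⟨n, hn⟩ := Circle.exp_eq_one.1 h2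
      refine ⟨n, ?_⟩
      have := Real.two_pi_pos.ne'
      apply mul_left_cancel₀ this
      rw [hn]
      ring
    choose z hz using h1
    have hzc : Continuous z := by
      rw [Int.isClosedEmbedding_coe_real.isInducing.continuous_iff]
      exact f.eval_contMDiff.continuous.congr fun x => (hz x).symm
    exact ⟨⟨z, (IsLocallyConstant.iff_continuous z).2 hzc⟩, DiffForm.ext_eval hz⟩
  · rintro ⟨z, rfl⟩
    exact expU1_ofInt z

/-- The discontinuity of the argument is harmless, as it is only applied to the values of a locally
constant function. -/
lemma expU1_ofLocallyConstant_arg (z : LocallyConstant M (Additive Circle)) :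
    expU1 (DiffForm.ofLocallyConstant (z.map fun c => (2 * Real.pi)⁻¹ * Complex.arg c.toMul) :
      DiffForm E M 0) = SmoothU1.ofConst z := by
  refine ContMDiffMap.ext fun x => ?_
  change Circle.exp (2 * Real.pi * ((2 * Real.pi)⁻¹ * Complex.arg (z x).toMul)) = (z x).toMul
  rw [← mul_assoc, mul_inv_cancel₀ Real.two_pi_pos.ne', one_mul, Circle.exp_arg]

lemma dlog_ofConst (z : LocallyConstant M (Additive Circle)) :
    dlog (SmoothU1.ofConst z : SmoothU1 E M) = 0 := by
  refine Subtype.ext (funext fun x => ?_)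
  have h : circleDiff (E := E) (fun y : M => (z y).toMul) x = 0 := by
    have h1 : (fun y : M => (((z y).toMul : Circle) : ℂ)) =ᶠ[𝓝 x] fun _ => ((z x).toMul : ℂ) := by
      filter_upwards [z.isLocallyConstant.eventually_eq x] with y hy
      exact congrArg (fun c : Additive Circle => ((c.toMul : Circle) : ℂ)) hy
    unfold circleDiff
    rw [h1.mfderiv_eq]
    exact mfderiv_const
  change dlogRaw (fun y : M => (z y).toMul) x = 0
  unfold dlogRaw
  rw [h]
  ext v
  simp

/-- In a chart `g` is `exp(√-1 F)` and `dlog g` is the differential of `F`; so `F` is constant on a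
small ball. -/
lemma exists_ofConst_of_dlog_eq_zero {g : SmoothU1 E M} (h : dlog g = 0) :
    ∃ z : LocallyConstant M (Additive Circle), SmoothU1.ofConst z = g := by
  suffices hl : IsLocallyConstant fun x => Additive.ofMul (g.toMul x) from ⟨⟨_, hl⟩, rfl⟩
  refine (IsLocallyConstant.iff_eventually_eq _).2 fun x => ?_
  have hy := mem_chart_target E x
  obtain ⟨F, hF, hFg⟩ := exists_log g.toMul hy
  have h1 : ∀ᶠ y' in 𝓝 (chartAt E x x), ContDiffAt ℝ 1 F y' :=
    (hF.of_le (by exact WithTop.coe_le_coe.2 (le_top : (1 : ℕ∞) ≤ ⊤))).eventually (by simp)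
  obtain ⟨ε, hε, hb⟩ := Metric.eventually_nhds_iff_ball.1
    (h1.and (hFg.eventually_nhds.and ((chartAt E x).open_target.mem_nhds hy)))
  have hd : ∀ y' ∈ Metric.ball (chartAt E x x) ε, fderiv ℝ F y' = 0 := by
    intro y' hy'
    obtain ⟨h2, h3, h4⟩ := hb y' hy'
    have h5 := rep_dlogRaw g.toMul h4 (h2.differentiableAt (by simp)) h3
    have h6 : RawForm.rep (dlogRaw g.toMul : RawForm E M 1) x y' = 0 := by
      have h7 : (dlogRaw g.toMul : RawForm E M 1) = 0 := congrArg Subtype.val h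
      rw [h7]
      rfl
    rw [h6] at h5
    ext v
    exact (DFunLike.congr_fun h5 fun _ => v).symm
  have hc : ∀ y' ∈ Metric.ball (chartAt E x x) ε, F y' = F (chartAt E x x) := fun y' hy' =>
    Metric.isOpen_ball.is_const_of_fderiv_eq_zero (convex_ball _ _).isPreconnected
      (fun y hy => ((hb y hy).1.differentiableAt (by simp)).differentiableWithinAt)
      hd hy' (Metric.mem_ball_self hε)
  filter_upwards [(chartAt E x).continuousAt (mem_chart_source E x) (Metric.ball_mem_nhds _ hε),
    (chartAt E x).open_source.mem_nhds (mem_chart_source E x)] with x' hx' hx'2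
  have h8 := (hb _ hx').2.1.self_of_nhds
  have h9 := (hb _ (Metric.mem_ball_self hε)).2.1.self_of_nhds
  rw [hc _ hx', ← h9, (chartAt E x).left_inv hx'2,
    (chartAt E x).left_inv (mem_chart_source E x)] at h8
  exact congrArg _ (Circle.ext h8)

/-- The property that all closed forms of positive degree are exact. -/
def HasPoincareLemma (E : Type v) [NormedAddCommGroup E] [NormedSpace ℝ E] (M : Type u)
    [TopologicalSpace M] [ChartedSpace E M] [IsManifold 𝓘(ℝ, E) ∞ M] : Prop :=
  ∀ (k : ℕ) (α : DiffForm E M (k + 1)), DiffForm.d (k + 1) α = 0 →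
    ∃ β : DiffForm E M k, DiffForm.d k β = α

lemma hasPoincareLemma_of_homotopy {H : M × ℝ → M}
    (hH : ContMDiff (𝓘(ℝ, E).prod 𝓘(ℝ, ℝ)) 𝓘(ℝ, E) ∞ H) (h1 : ∀ x, H (x, 1) = x)
    (h0 : IsLocallyConstant fun x => H (x, 0)) : HasPoincareLemma E M := by
  intro k α hα
  obtain ⟨η, hη, he⟩ := exists_ext_eq_of_homotopy hH h1 h0 α.smooth (congrArg Subtype.val hα)
  exact ⟨⟨η, hη⟩, Subtype.ext he⟩

lemma HasPoincareLemma.exists_dlog_eq (hM : HasPoincareLemma E M) {α : DiffForm E M 1}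
    (hα : DiffForm.d 1 α = 0) : ∃ f : DiffForm E M 0, dlog (expU1 f) = α := by
  obtain ⟨f, rfl⟩ := hM 0 α hα
  refine ⟨DiffForm.scale (2 * Real.pi)⁻¹ 0 f, ?_⟩
  rw [dlog_expU1, DiffForm.d_scale, DiffForm.scale_two_pi_cancel]

/-- A primitive of the closed form `dlog g` gives a function with the same logarithmic differential
as `g`. The remaining quotient is locally constant and has a locally constant logarithm. -/
lemma HasPoincareLemma.expU1_surjective (hM : HasPoincareLemma E M) :
    Function.Surjective (expU1 : DiffForm E M 0 →+ SmoothU1 E M) := by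
  intro g
  obtain ⟨f, hf⟩ := hM.exists_dlog_eq (d_dlog g)
  obtain ⟨z, hz⟩ := exists_ofConst_of_dlog_eq_zero (g := g - expU1 f)
    (by rw [map_sub, hf, sub_self])
  refine ⟨f + DiffForm.ofLocallyConstant
    (z.map fun c => (2 * Real.pi)⁻¹ * Complex.arg c.toMul), ?_⟩
  rw [map_add, expU1_ofLocallyConstant_arg, hz, add_sub_cancel]

end PoincareLemma

lemma EtaleGroupoid.IsLeray.hasPoincareLemma {E : Type} [NormedAddCommGroup E] [NormedSpace ℝ E]
    [FiniteDimensional ℝ E] {G₀ G₁ : Type u} [TopologicalSpace G₀] [T2Space G₀]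
    [ParacompactSpace G₀] [ChartedSpace E G₀] [IsManifold 𝓘(ℝ, E) ∞ G₀] [TopologicalSpace G₁]
    [T2Space G₁] [ParacompactSpace G₁] [ChartedSpace E G₁]
    {G : EtaleGroupoid E G₀ G₁} (h : G.IsLeray) (k : ℕ) : HasPoincareLemma E (G.Nerve k) := by
  obtain ⟨H, hH, h1, h0⟩ := h.exists_smooth_homotopy k
  exact hasPoincareLemma_of_homotopy hH h1 h0

/-! ### Bump functions on compact sets. -/

section Bump

variable {E : Type*} [NormedAddCommGroup E] [NormedSpace ℝ E] [FiniteDimensional ℝ E]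
variable {M : Type*} [TopologicalSpace M] [T2Space M] [ChartedSpace E M]
  [IsManifold 𝓘(ℝ, E) ∞ M]

/-- For a compact subset of an open set there is a nonnegative smooth function with compact support
in the open set that is positive on the compact set. -/
lemma exists_smooth_pos_on_compact {K U : Set M} (hK : IsCompact K) (hU : IsOpen U) (hKU : K ⊆ U) :
    ∃ g : M → ℝ, ContMDiff 𝓘(ℝ, E) 𝓘(ℝ, ℝ) ∞ g ∧ (∀ x, 0 ≤ g x) ∧ IsCompact (tsupport g) ∧
      tsupport g ⊆ U ∧ ∀ x ∈ K, 0 < g x := by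
  refine hK.induction_on (p := fun K => ∃ g : M → ℝ, ContMDiff 𝓘(ℝ, E) 𝓘(ℝ, ℝ) ∞ g ∧
    (∀ x, 0 ≤ g x) ∧ IsCompact (tsupport g) ∧ tsupport g ⊆ U ∧ ∀ x ∈ K, 0 < g x) ?_ ?_ ?_ ?_
  · have h0 : tsupport (fun _ : M => (0 : ℝ)) = ∅ := tsupport_eq_empty_iff.2 rfl
    exact ⟨fun _ => 0, contMDiff_const, fun _ => le_rfl, h0 ▸ isCompact_empty,
      h0 ▸ empty_subset _, fun _ h => h.elim⟩
  · rintro s t hst ⟨g, h1, h2, h3, h4, h5⟩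
    exact ⟨g, h1, h2, h3, h4, fun x hx => h5 x (hst hx)⟩
  · rintro s t ⟨g, h1, h2, h3, h4, h5⟩ ⟨g', h1', h2', h3', h4', h5'⟩
    have h6 : tsupport (g + g') ⊆ tsupport g ∪ tsupport g' := tsupport_add g g'
    refine ⟨g + g', h1.add h1', fun x => add_nonneg (h2 x) (h2' x),
      (h3.union h3').of_isClosed_subset (isClosed_tsupport _) h6,
      h6.trans (union_subset h4 h4'), ?_⟩
    rintro x (hx | hx)
    · exact add_pos_of_pos_of_nonneg (h5 x hx) (h2' x)
    · exact add_pos_of_nonneg_of_pos (h2 x) (h5' x hx)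
  · intro x hx
    obtain ⟨f, -, hf⟩ := (SmoothBumpFunction.nhds_basis_tsupport (I := 𝓘(ℝ, E)) x).mem_iff.1
      (hU.mem_nhds (hKU hx))
    exact ⟨Function.support f, mem_nhdsWithin_of_mem_nhds f.support_mem_nhds, f, f.contMDiff,
      fun x => f.nonneg, f.hasCompactSupport, hf, fun y hy => lt_of_le_of_ne f.nonneg (Ne.symm hy)⟩

end Bump

/-! ### The orbit space of a proper groupoid and unnormalized cutoff functions. -/

namespace EtaleGroupoid

section Orbits

variable {E : Type} [NormedAddCommGroup E] [NormedSpace ℝ E] {G₀ G₁ : Type u}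
variable [TopologicalSpace G₀] [ChartedSpace E G₀] [TopologicalSpace G₁] [ChartedSpace E G₁]
variable (G : EtaleGroupoid E G₀ G₁)

lemma continuous_s : Continuous G.s := G.etale_s.contMDiff.continuous

lemma continuous_t : Continuous G.t := G.etale_t.contMDiff.continuous

/-- The projection to the orbit space. -/
def orbit (x : G₀) : G.OrbitSpace := Quot.mk _ x

/-- Identities, inverses and composites of arrows show that the relation is already an equivalence
relation. -/
lemma orbit_eq_iff {x y : G₀} : G.orbit x = G.orbit y ↔ ∃ a, G.s a = x ∧ G.t a = y := by
  refine ⟨fun h => ?_, fun h => Quot.sound h⟩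
  have h1 := Quot.eqvGen_exact h
  clear h
  induction h1 with
  | rel x y h => exact h
  | refl x => exact ⟨G.e x, G.s_e x, G.t_e x⟩
  | symm x y _ ih =>
    obtain ⟨a, ha, hb⟩ := ih
    exact ⟨G.inv a, (G.s_inv a).trans hb, (G.t_inv a).trans ha⟩
  | trans x y z _ _ ih1 ih2 =>
    obtain ⟨a, ha, hb⟩ := ih1
    obtain ⟨a', ha', hb'⟩ := ih2
    have h : G.t a = G.s a' := hb.trans ha'.symm
    exact ⟨G.m a a', (G.s_m _ _ h).trans ha, (G.t_m _ _ h).trans hb'⟩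

/-- The saturation of `U` is `t (s⁻¹ U)`, which is open since `t` is a local homeomorphism. -/
lemma isOpenQuotientMap_orbit : IsOpenQuotientMap G.orbit := by
  refine ⟨Quot.mk_surjective, continuous_quot_mk, fun U hU => ?_⟩
  change IsOpen (G.orbit ⁻¹' (G.orbit '' U))
  have h : G.orbit ⁻¹' (G.orbit '' U) = G.t '' (G.s ⁻¹' U) := by
    ext y
    constructor
    · rintro ⟨x, hx, hxy⟩
      obtain ⟨a, rfl, rfl⟩ := G.orbit_eq_iff.1 hxy
      exact ⟨a, hx, rfl⟩
    · rintro ⟨a, ha, rfl⟩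
      exact ⟨G.s a, ha, G.orbit_eq_iff.2 ⟨a, rfl, rfl⟩⟩
  rw [h]
  exact G.etale_t.isLocalHomeomorph.isOpenMap _ (hU.preimage G.continuous_s)

variable {G}

/-- The orbit relation is the image of the proper, hence closed, map `(s, t)`; an open quotient by a
closed relation is Hausdorff. -/
lemma IsProper.t2Space_orbitSpace (h : G.IsProper) : T2Space G.OrbitSpace := by
  refine (t2Space_iff_of_isOpenQuotientMap G.isOpenQuotientMap_orbit).2 ?_
  convert h.isClosedMap.isClosed_range using 1
  ext p
  simp only [mem_ofPred_eq, orbit_eq_iff, mem_range, Prod.ext_iff]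

variable [FiniteDimensional ℝ E] [T2Space G₀] [IsManifold 𝓘(ℝ, E) ∞ G₀]

/-- A proper groupoid with paracompact orbit space has a cutoff function (before its
normalization). -/
lemma IsProper.exists_cutoff (h : G.IsProper) (horbit : ParacompactSpace G.OrbitSpace) :
    ∃ c : G₀ → ℝ, ContMDiff 𝓘(ℝ, E) 𝓘(ℝ, ℝ) ∞ c ∧ (∀ x, 0 ≤ c x) ∧
      (∀ x, ∃ a, G.t a = x ∧ 0 < c (G.s a)) ∧
      ∀ K, IsCompact K → IsCompact {a | G.t a ∈ K ∧ G.s a ∈ tsupport c} := by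
  have hT2 := h.t2Space_orbitSpace
  have hq := G.isOpenQuotientMap_orbit
  have : LocallyCompactSpace G₀ := ChartedSpace.locallyCompactSpace E G₀
  choose K hK hKx using fun x : G₀ => exists_compact_mem_nhds x
  obtain ⟨V, hVo, hVc, hVf, hVK⟩ := precise_refinement (fun x => G.orbit '' interior (K x))
    (fun x => hq.isOpenMap _ isOpen_interior) (eq_univ_of_forall fun z => by
      obtain ⟨x, rfl⟩ := hq.surjective z
      exact mem_iUnion.2 ⟨x, mem_image_of_mem _ (mem_interior_iff_mem_nhds.2 (hKx x))⟩)
  -- The cover of the orbit space is shrunk so that `K x` over `closure (W x)` is compact, still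
  -- meets every orbit in `W x`, and lies over `V x`, where a function of compact support is
  -- available.
  obtain ⟨W, hWc, -, hWV⟩ := exists_iUnion_eq_closure_subset hVo hVf.point_finite hVc
  have hL : ∀ x, IsCompact (K x ∩ G.orbit ⁻¹' closure (W x)) := fun x =>
    (hK x).inter_right (isClosed_closure.preimage hq.continuous)
  choose g hg hg0 hgc hgV hgL using fun x => exists_smooth_pos_on_compact (E := E) (hL x)
    ((hVo x).preimage hq.continuous) (fun y hy => hWV x hy.2)
  have hfV : LocallyFinite fun x => G.orbit ⁻¹' V x := hVf.preimage_continuous hq.continuous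
  have hft : LocallyFinite fun x => tsupport (g x) := hfV.subset hgV
  have hfs : LocallyFinite fun x => Function.support (g x) :=
    hft.subset fun x => subset_tsupport (g x)
  have hpf : ∀ y, (Function.support fun x => g x y).Finite := fun y => hfs.point_finite y
  refine ⟨fun y => ∑ᶠ x, g x y, contMDiff_finsum hg hfs, fun y => finsum_nonneg fun x => hg0 x y,
    fun y => ?_, fun A hA => ?_⟩
  · obtain ⟨x, hx⟩ := mem_iUnion.1 (hWc ▸ mem_univ (G.orbit y) : G.orbit y ∈ ⋃ i, W i)
    obtain ⟨z, hz, hzy⟩ := hVK x (hWV x (subset_closure hx))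
    obtain ⟨a, rfl, rfl⟩ := G.orbit_eq_iff.1 hzy
    refine ⟨a, rfl, finsum_pos (fun x => hg0 x _) ⟨x, hgL x _ ⟨interior_subset hz, ?_⟩⟩ (hpf _)⟩
    rw [mem_preimage, hzy]
    exact subset_closure hx
  -- The orbits through a compact `A` meet only finitely many `V x`. So the arrows in question have
  -- their sources in finitely many compact supports and their targets in `A`, and properness of
  -- `(s, t)` applies.
  · have hfin := hVf.finite_nonempty_inter_compact (hA.image hq.continuous)
    have hts : tsupport (fun y => ∑ᶠ x, g x y) ⊆ ⋃ x, tsupport (g x) := by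
      refine closure_minimal (fun y hy => ?_) (hft.isClosed_iUnion fun x => isClosed_tsupport _)
      obtain ⟨x, hx⟩ : ∃ x, g x y ≠ 0 := by
        by_contra! h0
        exact hy (finsum_eq_zero_of_forall_eq_zero h0)
      exact mem_iUnion.2 ⟨x, subset_tsupport _ hx⟩
    refine (h.isCompact_preimage ((hfin.isCompact_biUnion fun x _ => hgc x).prod hA)
      ).of_isClosed_subset ?_ ?_
    · exact (hA.isClosed.preimage G.continuous_t).inter
        ((isClosed_tsupport _).preimage G.continuous_s)
    · rintro a ⟨ha, hs⟩
      obtain ⟨x, hx⟩ := mem_iUnion.1 (hts hs)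
      refine ⟨mem_biUnion (x := x) ?_ hx, ha⟩
      refine ⟨G.orbit (G.s a), hgV x hx, G.t a, ha, ?_⟩
      exact (G.orbit_eq_iff.2 ⟨a, rfl, rfl⟩).symm

end Orbits

end EtaleGroupoid

/-! ### Sums over the fibres of a local homeomorphism. -/

section FiberSums

variable {N M : Type*} [TopologicalSpace N] [TopologicalSpace M]

/-- The sum of a function over the fibres of a map. -/
def fiberSum {A : Type*} [AddCommMonoid A] (π : N → M) (F : N → A) (p : M) : A :=
  ∑ᶠ q ∈ π ⁻¹' {p}, F q

/-- The restriction of a map to a closed subset is proper. -/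
structure IsProperOn (π : N → M) (S : Set N) : Prop where
  isCompact_inter_preimage : ∀ K, IsCompact K → IsCompact (S ∩ π ⁻¹' K)

variable {π : N → M} {S : Set N}

/-- Each fibre of a local homeomorphism is discrete, and its part in `S` is compact. -/
lemma IsProperOn.finite_fiber (hS : IsProperOn π S) (hπ : IsLocalHomeomorph π) (p : M) :
    (S ∩ π ⁻¹' {p}).Finite := by
  have h := hS.isCompact_inter_preimage {p} isCompact_singleton
  have h1 : (S ∩ π ⁻¹' {p} ∩ π ⁻¹' {p}).Finite := by
    refine h.induction_on (p := fun A => (A ∩ π ⁻¹' {p}).Finite) (by simp)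
      (fun s t hst ht => ht.subset (inter_subset_inter_left _ hst))
      (fun s t hs ht => by rw [union_inter_distrib_right]; exact hs.union ht) fun x _ => ?_
    obtain ⟨e, hx, rfl⟩ := hπ x
    refine ⟨e.source, mem_nhdsWithin_of_mem_nhds (e.open_source.mem_nhds hx), ?_⟩
    refine Set.Subsingleton.finite fun a ha b hb => e.injOn ha.1 hb.1 ?_
    exact (show e a = p from ha.2).trans (show e b = p from hb.2).symm
  exact h1.subset fun x hx => ⟨hx, hx.2⟩

/-- Near each point a local homeomorphism that is proper on `S` has finitely many local sections
which cover `S`. -/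
lemma IsProperOn.exists_sections [T2Space N] [T2Space M] [LocallyCompactSpace M]
    (hS : IsProperOn π S) (hπ : IsLocalHomeomorph π) (p₀ : M) :
    ∃ (T : Finset N) (e : N → OpenPartialHomeomorph N M),
      (∀ q, ⇑(e q) = π) ∧ (∀ q ∈ T, p₀ ∈ (e q).target) ∧
      ∀ᶠ p in 𝓝 p₀, (∀ q ∈ T, p ∈ (e q).target) ∧ InjOn (fun q => (e q).symm p) T ∧
        ∀ q ∈ S, π q = p → ∃ q₀ ∈ T, (e q₀).symm p = q := by
  have hfin := hS.finite_fiber hπ p₀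
  choose e he hπe using hπ
  have hTe : ∀ q ∈ hfin.toFinset, e q q = p₀ := fun q hq => by
    rw [← hπe]
    exact (hfin.mem_toFinset.1 hq).2
  have hTt : ∀ q ∈ hfin.toFinset, p₀ ∈ (e q).target := fun q hq =>
    hTe q hq ▸ (e q).map_source (he q)
  have hTs : ∀ q ∈ hfin.toFinset, (e q).symm p₀ = q := fun q hq => by
    rw [← hTe q hq, (e q).left_inv (he q)]
  refine ⟨hfin.toFinset, e, fun q => (hπe q).symm, hTt, ?_⟩
  have h1 : ∀ᶠ p in 𝓝 p₀, ∀ q ∈ hfin.toFinset, p ∈ (e q).target :=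
    (Finset.eventually_all _).2 fun q hq => (e q).open_target.mem_nhds (hTt q hq)
  have h2 : ∀ᶠ p in 𝓝 p₀, ∀ q ∈ hfin.toFinset, ∀ q' ∈ hfin.toFinset, q ≠ q' →
      (e q).symm p ≠ (e q').symm p := by
    refine (Finset.eventually_all _).2 fun q hq => (Finset.eventually_all _).2 fun q' hq' => ?_
    by_cases hqq : q = q'
    · exact Eventually.of_forall fun p h => (h hqq).elim
    · obtain ⟨U, V, hU, hV, hqU, hqV, hUV⟩ := t2_separation hqq
      have c1 := (e q).continuousAt_symm (hTt q hq)
      have c2 := (e q').continuousAt_symm (hTt q' hq')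
      rw [ContinuousAt, hTs q hq] at c1
      rw [ContinuousAt, hTs q' hq'] at c2
      filter_upwards [c1 (hU.mem_nhds hqU), c2 (hV.mem_nhds hqV)] with p hp hp' _ h
      exact disjoint_left.1 hUV hp (mem_of_eq_of_mem h hp')
  obtain ⟨K, hK, hKp⟩ := exists_compact_mem_nhds p₀
  let V : Set N := ⋃ q ∈ hfin.toFinset, (e q).source
  have hV : IsOpen V := isOpen_biUnion fun q _ => (e q).open_source
  -- The points of `S` over `K` outside the chosen sheets form a compact set whose image is closed
  -- and misses `p₀`. Near `p₀` the sheets therefore contain all of `S`.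
  have hC : IsCompact ((S ∩ π ⁻¹' K) \ V) := (hS.isCompact_inter_preimage K hK).diff hV
  have hπc : Continuous π := IsLocalHomeomorph.continuous fun q => ⟨e q, he q, hπe q⟩
  have h3 : p₀ ∉ π '' ((S ∩ π ⁻¹' K) \ V) := by
    rintro ⟨q, ⟨hq, hqV⟩, rfl⟩
    exact hqV (mem_biUnion (x := q) (hfin.mem_toFinset.2 ⟨hq.1, rfl⟩) (he q))
  filter_upwards [h1, h2, hKp, (hC.image hπc).isClosed.isOpen_compl.mem_nhds h3]
    with p hp1 hp2 hp3 hp4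
  refine ⟨hp1, fun q hq q' hq' h => by_contra fun hne => hp2 q hq q' hq' hne h, ?_⟩
  rintro q hq rfl
  have hqV : q ∈ V := by_contra fun hqV => hp4 ⟨q, ⟨⟨hq, hp3⟩, hqV⟩, rfl⟩
  simp only [V, mem_iUnion] at hqV
  obtain ⟨q₀, hq₀, hq⟩ := hqV
  refine ⟨q₀, hq₀, ?_⟩
  rw [hπe q₀]
  exact (e q₀).left_inv hq

lemma fiberSum_eq_sum {A : Type*} [AddCommMonoid A] {F : N → A} (hF : ∀ q, q ∉ S → F q = 0)
    {T : Finset N} {e : N → OpenPartialHomeomorph N M} (he : ∀ q, ⇑(e q) = π) {p : M}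
    (h1 : ∀ q ∈ T, p ∈ (e q).target) (h2 : InjOn (fun q => (e q).symm p) T)
    (h3 : ∀ q ∈ S, π q = p → ∃ q₀ ∈ T, (e q₀).symm p = q) :
    fiberSum π F p = ∑ q ∈ T, F ((e q).symm p) := by
  classical
  rw [← Finset.sum_image (f := F) h2]
  refine finsum_mem_eq_sum_of_inter_support_eq F ?_
  ext q
  simp only [mem_inter_iff, mem_preimage, mem_singleton_iff, Finset.coe_image, mem_image,
    Function.mem_support]
  refine and_congr_left fun hq => ⟨fun h => h3 q (by_contra fun h' => hq (hF q h')) h, ?_⟩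
  rintro ⟨q₀, hq₀, rfl⟩
  rw [← he q₀]
  exact (e q₀).right_inv (h1 q₀ hq₀)

lemma IsProperOn.fiberSum_eq_sum_fiber {A : Type*} [AddCommMonoid A] (hS : IsProperOn π S)
    (hπ : IsLocalHomeomorph π) {F : N → A} (hF : ∀ q, q ∉ S → F q = 0) (p : M) :
    fiberSum π F p = ∑ q ∈ (hS.finite_fiber hπ p).toFinset, F q := by
  refine finsum_mem_eq_sum_of_inter_support_eq F ?_
  ext q
  simp only [mem_inter_iff, mem_preimage, mem_singleton_iff, Finite.coe_toFinset,
    Function.mem_support]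
  exact and_congr_left fun hq => ⟨fun h => ⟨by_contra fun h' => hq (hF q h'), h⟩, fun h => h.2⟩

end FiberSums

/-! ### Smooth pushforward of forms along étale maps. -/

section LocalSmoothness

variable {E : Type*} [NormedAddCommGroup E] [NormedSpace ℝ E]
variable {M : Type u} [TopologicalSpace M] [ChartedSpace E M]
variable {N : Type u} [TopologicalSpace N] [ChartedSpace E N]

/-- A form is smooth near a point. -/
def RawForm.SmoothAt {k : ℕ} (α : RawForm E M k) (x : M) : Prop :=
  ∀ x₀ : M, x ∈ (chartAt E x₀).source → ContDiffAt ℝ ∞ (α.rep x₀) (chartAt E x₀ x)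

namespace RawForm

variable {k : ℕ} {α β : RawForm E M k} {x : M}

lemma IsSmooth.of_smoothAt (h : ∀ x, α.SmoothAt x) : α.IsSmooth := by
  intro x₀ y hy
  have h1 := h _ x₀ ((chartAt E x₀).map_target hy)
  rw [(chartAt E x₀).right_inv hy] at h1
  exact h1.contDiffWithinAt

lemma SmoothAt.congr (h : α.SmoothAt x) (he : β =ᶠ[𝓝 x] α) : β.SmoothAt x := by
  intro x₀ hx
  refine (h x₀ hx).congr_of_eventuallyEq ?_
  have h1 := (chartAt E x₀).continuousAt_symm ((chartAt E x₀).map_source hx)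
  rw [ContinuousAt, (chartAt E x₀).left_inv hx] at h1
  filter_upwards [h1 he] with y hy
  have hy' : β ((chartAt E x₀).symm y) = α ((chartAt E x₀).symm y) := hy
  unfold rep
  rw [hy']

lemma SmoothAt.sum {ι : Type*} (s : Finset ι) {α : ι → RawForm E M k}
    (h : ∀ i ∈ s, (α i).SmoothAt x) : SmoothAt (fun x => ∑ i ∈ s, α i x : RawForm E M k) x := by
  intro x₀ hx
  have h1 : rep (fun x => ∑ i ∈ s, α i x : RawForm E M k) x₀ = fun y =>
      ∑ i ∈ s, (α i).rep x₀ y := by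
    funext y
    exact map_sum (ContinuousAlternatingMap.compContinuousLinearMapCLM (F := ℝ) (ι := Fin k)
      (dmap E (chartAt E x₀).symm y)) _ s
  rw [h1]
  exact ContDiffAt.sum fun i hi => h i hi x₀ hx

variable [IsManifold 𝓘(ℝ, E) ∞ M] [IsManifold 𝓘(ℝ, E) ∞ N]

lemma SmoothAt.smul {u : M → ℝ} (hu : ContMDiffAt 𝓘(ℝ, E) 𝓘(ℝ, ℝ) ∞ u x) (h : α.SmoothAt x) :
    SmoothAt (fun x => u x • α x : RawForm E M k) x := by
  intro x₀ hx
  have hy := (chartAt E x₀).map_source hx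
  refine ContDiffAt.smul (f := fun y => u ((chartAt E x₀).symm y)) ?_ (h x₀ hx)
  rw [← contMDiffAt_iff_contDiffAt]
  refine ContMDiffAt.comp _ ?_ (contMDiffAt_chartAt_symm x₀ hy)
  rwa [(chartAt E x₀).left_inv hx]

/-- Only smoothness of `f` near `z` is required, since the lemma is meant for local sections, which
are meaningful only on an open set. -/
lemma IsSmooth.smoothAt_pullback {f : N → M} {z : N} (h : α.IsSmooth)
    (hf : ∀ᶠ z in 𝓝 z, ContMDiffAt 𝓘(ℝ, E) 𝓘(ℝ, E) ∞ f z) : (α.pullback f).SmoothAt z := by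
  intro x₀ hx
  set z₀ := f z
  set y := chartAt E x₀ z
  have hy : y ∈ (chartAt E x₀).target := (chartAt E x₀).map_source hx
  have hyz : (chartAt E x₀).symm y = z := (chartAt E x₀).left_inv hx
  have h1 := (chartAt E x₀).continuousAt_symm hy
  have hfz := hf.self_of_nhds
  have hz : f ((chartAt E x₀).symm y) ∈ (chartAt E z₀).source := by
    rw [hyz]
    exact mem_chart_source E z₀
  have hm := mapRep_contDiffAt hy (hyz ▸ hfz) hz
  have h2 : ContDiffAt ℝ ∞ (fun y => α.rep z₀ (mapRep f x₀ z₀ y)) y :=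
    ContDiffAt.comp (g := α.rep z₀) y (IsSmooth.contDiffAt h ((chartAt E z₀).map_source hz)) hm
  refine (contDiffAt_compCLM h2 (hm.fderiv_right (by simp))).congr_of_eventuallyEq ?_
  rw [ContinuousAt, hyz] at h1
  filter_upwards [h1 hf, (chartAt E x₀).open_target.mem_nhds hy, h1 (hfz.continuousAt
    ((chartAt E z₀).open_source.mem_nhds (mem_chart_source E z₀)))] with y' ha hb hc
  exact rep_pullback α hb ha hc

end RawForm

/-- An étale map of manifolds: a smooth local homeomorphism whose local inverses are smooth. -/
structure IsSmoothEtale (E : Type*) [NormedAddCommGroup E] [NormedSpace ℝ E] {M N : Type*}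
    [TopologicalSpace M] [ChartedSpace E M] [TopologicalSpace N] [ChartedSpace E N]
    (π : N → M) : Prop where
  isLocalHomeomorph : IsLocalHomeomorph π
  contMDiff : ContMDiff 𝓘(ℝ, E) 𝓘(ℝ, E) ∞ π
  contMDiffAt_symm : ∀ e : OpenPartialHomeomorph N M, ⇑e = π → ∀ p ∈ e.target,
    ContMDiffAt 𝓘(ℝ, E) 𝓘(ℝ, E) ∞ e.symm p

variable {π : N → M} {S : Set N}

lemma IsSmoothEtale.dmap_comp_dmap_symm (hπ : IsSmoothEtale E π) (e : OpenPartialHomeomorph N M)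
    (he : ⇑e = π) {p : M} (hp : p ∈ e.target) :
    (dmap E π (e.symm p)).comp (dmap E e.symm p) = ContinuousLinearMap.id ℝ E ∧
      (dmap E e.symm p).comp (dmap E π (e.symm p)) = ContinuousLinearMap.id ℝ E := by
  have h1 : π (e.symm p) = p := by rw [← he, e.right_inv hp]
  have hs := hπ.contMDiffAt_symm e he p hp
  constructor
  · rw [← dmap_comp hπ.contMDiff.contMDiffAt hs, ← dmap_id p]
    refine dmap_congr ?_
    filter_upwards [e.open_target.mem_nhds hp] with p' hp'
    rw [Function.comp_apply, ← he, e.right_inv hp']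
    rfl
  · have h2 := dmap_comp (E := E) (f := π) (g := e.symm) (x := e.symm p) (by rwa [h1])
      hπ.contMDiff.contMDiffAt
    rw [h1] at h2
    rw [← h2, ← dmap_id (e.symm p)]
    refine dmap_congr ?_
    filter_upwards [e.open_source.mem_nhds (e.map_target hp)] with q hq
    rw [Function.comp_apply, ← he, e.left_inv hq]
    rfl

/-- Along a local section the inverse differential is the differential of that section. This turns
the terms of the pushforward into ordinary pullbacks, which are known to be smooth. -/
lemma IsSmoothEtale.inverse_dmap (hπ : IsSmoothEtale E π) (e : OpenPartialHomeomorph N M)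
    (he : ⇑e = π) {p : M} (hp : p ∈ e.target) :
    (dmap E π (e.symm p)).inverse = dmap E e.symm p :=
  ContinuousLinearMap.inverse_eq (hπ.dmap_comp_dmap_symm e he hp).1
    (hπ.dmap_comp_dmap_symm e he hp).2

/-- `ContinuousLinearMap.inverse` has the default value zero on maps that are not invertible; for
étale maps this case does not occur. -/
lemma IsSmoothEtale.dmap_isInvertible (hπ : IsSmoothEtale E π) (q : N) :
    (dmap E π q).comp (dmap E π q).inverse = ContinuousLinearMap.id ℝ E ∧
      (dmap E π q).inverse.comp (dmap E π q) = ContinuousLinearMap.id ℝ E := by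
  obtain ⟨e, hq, he⟩ := hπ.isLocalHomeomorph q
  have h1 := hπ.dmap_comp_dmap_symm e he.symm (e.map_source hq)
  have h2 := hπ.inverse_dmap e he.symm (e.map_source hq)
  rw [e.left_inv hq] at h1 h2
  rwa [h2]

/-- Near each point the fibre sum is a finite sum of compositions with smooth local sections. -/
lemma contMDiff_fiberSum [T2Space N] [T2Space M] [LocallyCompactSpace M]
    (hπ : IsSmoothEtale E π) (hS : IsProperOn π S) {u : N → ℝ}
    (hu : ContMDiff 𝓘(ℝ, E) 𝓘(ℝ, ℝ) ∞ u) (huS : ∀ q, q ∉ S → u q = 0) :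
    ContMDiff 𝓘(ℝ, E) 𝓘(ℝ, ℝ) ∞ (fiberSum π u) := by
  intro p₀
  obtain ⟨T, e, he, hT, hev⟩ := hS.exists_sections hπ.isLocalHomeomorph p₀
  have h1 : ContMDiffAt 𝓘(ℝ, E) 𝓘(ℝ, ℝ) ∞ (fun p => ∑ q ∈ T, u ((e q).symm p)) p₀ :=
    contMDiffAt_finsetSum fun q hq => hu.contMDiffAt.comp p₀
      (hπ.contMDiffAt_symm _ (he q) _ (hT q hq))
  refine h1.congr_of_eventuallyEq ?_
  filter_upwards [hev] with p hp
  exact fiberSum_eq_sum huS he hp.1 hp.2.1 hp.2.2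

/-- The pushforward of a form with a weight along an étale map. -/
def RawForm.pushforward {k : ℕ} (π : N → M) (u : N → ℝ) (α : RawForm E N k) : RawForm E M k :=
  fiberSum π fun q => u q • (α q).compContinuousLinearMap (dmap E π q).inverse

variable [IsManifold 𝓘(ℝ, E) ∞ M] [IsManifold 𝓘(ℝ, E) ∞ N]

lemma RawForm.IsSmooth.pushforward [T2Space N] [T2Space M] [LocallyCompactSpace M]
    (hπ : IsSmoothEtale E π) (hS : IsProperOn π S) {u : N → ℝ}
    (hu : ContMDiff 𝓘(ℝ, E) 𝓘(ℝ, ℝ) ∞ u) (huS : ∀ q, q ∉ S → u q = 0) {k : ℕ}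
    {α : RawForm E N k} (hα : α.IsSmooth) : (RawForm.pushforward π u α).IsSmooth := by
  refine RawForm.IsSmooth.of_smoothAt fun p₀ => ?_
  obtain ⟨T, e, he, hT, hev⟩ := hS.exists_sections hπ.isLocalHomeomorph p₀
  have hs : ∀ q ∈ T, ∀ᶠ p in 𝓝 p₀, ContMDiffAt 𝓘(ℝ, E) 𝓘(ℝ, E) ∞ (e q).symm p := fun q hq => by
    filter_upwards [(e q).open_target.mem_nhds (hT q hq)] with p hp
    exact hπ.contMDiffAt_symm _ (he q) _ hp
  have h1 : RawForm.SmoothAt (fun p => ∑ q ∈ T, u ((e q).symm p) • α.pullback (e q).symm p :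
      RawForm E M k) p₀ :=
    RawForm.SmoothAt.sum T fun q hq => RawForm.SmoothAt.smul
      (hu.contMDiffAt.comp p₀ (hs q hq).self_of_nhds) (hα.smoothAt_pullback (hs q hq))
  refine h1.congr ?_
  filter_upwards [hev] with p hp
  refine (fiberSum_eq_sum (S := S) (fun q hq => ?_) he hp.1 hp.2.1 hp.2.2).trans ?_
  · rw [huS q hq, zero_smul]
  · refine Finset.sum_congr rfl fun q hq => ?_
    rw [hπ.inverse_dmap _ (he q) (hp.1 q hq)]
    rfl

end LocalSmoothness

/-! ### Smoothness of lifts through étale maps, at a point. -/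

section LocalLifts

variable {E : Type*} [NormedAddCommGroup E] [NormedSpace ℝ E]
variable {X Y Z W : Type*} [TopologicalSpace X] [TopologicalSpace Y] [ChartedSpace E Y]
variable [TopologicalSpace Z] [ChartedSpace E Z] [TopologicalSpace W] [ChartedSpace E W]

lemma contMDiffAt_lift [IsManifold 𝓘(ℝ, E) ∞ Y] {f : X → Y} (hf : IsLocalHomeomorph f)
    {g : Z → X} {z : Z} (hg : ContinuousAt g z) (h : ContMDiffAt 𝓘(ℝ, E) 𝓘(ℝ, E) ∞ (f ∘ g) z) :
    letI := pullbackChartedSpace (E := E) hf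
    ContMDiffAt 𝓘(ℝ, E) 𝓘(ℝ, E) ∞ g z := by
  let _ := pullbackChartedSpace (E := E) hf
  have := pullback_isManifold (E := E) hf
  have h2 : (chartAt E (g z) : X → E) = chartAt E (f (g z)) ∘ f := pullback_chart_comp hf (g z)
  have h1 : ContMDiffAt 𝓘(ℝ, E) 𝓘(ℝ, E) ∞ (chartAt E (g z) ∘ g) z := by
    rw [h2]
    exact ContMDiffAt.comp (g := chartAt E (f (g z))) (f := f ∘ g) z
      (contMDiffAt_chartAt (f (g z)) (mem_chart_source E (f (g z)))) h
  have h3 : ContMDiffAt 𝓘(ℝ, E) 𝓘(ℝ, E) ∞ ((chartAt E (g z)).symm ∘ (chartAt E (g z) ∘ g)) z :=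
    (contMDiffAt_chartAt_symm (g z) (mem_chart_target E (g z))).comp z h1
  refine h3.congr_of_eventuallyEq ?_
  filter_upwards [hg.eventually
    ((chartAt E (g z)).open_source.mem_nhds (mem_chart_source E (g z)))] with w hw
  exact ((chartAt E (g z)).left_inv hw).symm

lemma contMDiffAt_of_localDiffeo {f : W → Y} (hf : IsLocalDiffeomorph 𝓘(ℝ, E) 𝓘(ℝ, E) ∞ f)
    {g : Z → W} {z : Z} (hg : ContinuousAt g z)
    (h : ContMDiffAt 𝓘(ℝ, E) 𝓘(ℝ, E) ∞ (f ∘ g) z) : ContMDiffAt 𝓘(ℝ, E) 𝓘(ℝ, E) ∞ g z := by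
  have h1 : ContMDiffAt 𝓘(ℝ, E) 𝓘(ℝ, E) ∞ ((hf (g z)).localInverse ∘ (f ∘ g)) z :=
    (hf (g z)).localInverse_contMDiffAt.comp z h
  refine h1.congr_of_eventuallyEq ?_
  exact (hg.eventually (hf (g z)).localInverse_eventuallyEq_left).mono fun w hw => hw.symm

lemma OpenPartialHomeomorph.comp_symm_eventuallyEq {f : W → Y} (e : OpenPartialHomeomorph W Y)
    (he : ⇑e = f) {p : Y} (hp : p ∈ e.target) : f ∘ e.symm =ᶠ[𝓝 p] id := by
  filter_upwards [e.open_target.mem_nhds hp] with y hy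
  rw [Function.comp_apply, ← he, e.right_inv hy]
  rfl

lemma IsLocalDiffeomorph.isSmoothEtale {f : W → Y}
    (hf : IsLocalDiffeomorph 𝓘(ℝ, E) 𝓘(ℝ, E) ∞ f) : IsSmoothEtale E f where
  isLocalHomeomorph := hf.isLocalHomeomorph
  contMDiff := hf.contMDiff
  contMDiffAt_symm e he _ hp := contMDiffAt_of_localDiffeo hf (e.continuousAt_symm hp)
    (contMDiffAt_id.congr_of_eventuallyEq (e.comp_symm_eventuallyEq he hp))

end LocalLifts

/-! ### The zeroth face map as an étale map, proper over the support of a cutoff. -/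

namespace EtaleGroupoid

variable {E : Type*} [NormedAddCommGroup E] [NormedSpace ℝ E] {G₀ G₁ : Type u}
variable [TopologicalSpace G₀] [ChartedSpace E G₀]
variable [TopologicalSpace G₁] [ChartedSpace E G₁]
variable {G : EtaleGroupoid E G₀ G₁}

lemma Nerve.arrow_face_zero {k : ℕ} (q : G.Nerve (k + 1)) (j : Fin k) :
    (Nerve.face 0 q).arrow j = q.arrow j.succ := by
  change Nerve.faceArrow 0 q j = _
  unfold Nerve.faceArrow
  rw [if_neg (by simp), if_neg (by simp)]

lemma Nerve.vertex_face_zero {k : ℕ} (q : G.Nerve (k + 1)) (j : Fin (k + 1)) :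
    (Nerve.face 0 q).vertex j = q.vertex j.succ := by
  change q.vertex (Fin.succAbove 0 j) = _
  rw [Fin.zero_succAbove]

lemma Nerve.t_arrow_zero {k : ℕ} (q : G.Nerve (k + 1)) :
    G.t (q.arrow 0) = (Nerve.face 0 q).first := by
  rw [q.t_arrow 0]
  exact (Nerve.vertex_face_zero q 0).symm

lemma Nerve.s_arrow_zero {k : ℕ} (q : G.Nerve (k + 1)) : G.s (q.arrow 0) = q.first :=
  q.s_arrow 0

/-- A string of arrows is determined by its first arrow and the remaining string. -/
lemma Nerve.eq_of_face_zero {k : ℕ} {p q : G.Nerve (k + 1)} (h : Nerve.face 0 p = Nerve.face 0 q)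
    (ha : p.arrow 0 = q.arrow 0) : p = q := by
  refine Nerve.hext (fun i => ?_) fun i => ?_
  · refine Fin.cases ?_ (fun i => ?_) i
    · exact (p.s_arrow_zero).symm.trans ((congrArg G.s ha).trans q.s_arrow_zero)
    · rw [← Nerve.vertex_face_zero, h, Nerve.vertex_face_zero]
  · refine Fin.cases ha (fun i => ?_) i
    rw [← Nerve.arrow_face_zero, h, Nerve.arrow_face_zero]

/-- The string with one more arrow at its beginning. -/
def Nerve.cons {k : ℕ} (a : G₁) (p : G.Nerve k) (h : G.t a = p.first) : G.Nerve (k + 1) :=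
  ⟨Fin.cons (α := fun _ => G₀) (G.s a) p.vertex, Fin.cons (α := fun _ => G₁) a p.arrow, by
    intro i
    refine Fin.cases ?_ (fun i => ?_) i
    · rfl
    · rw [Fin.cons_succ, p.s_arrow, ← Fin.succ_castSucc, Fin.cons_succ], by
    intro i
    refine Fin.cases ?_ (fun i => ?_) i
    · exact h
    · rw [Fin.cons_succ, p.t_arrow, Fin.cons_succ]⟩

lemma Nerve.face_zero_cons {k : ℕ} (a : G₁) (p : G.Nerve k) (h : G.t a = p.first) :
    Nerve.face 0 (Nerve.cons a p h) = p := by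
  refine Nerve.hext (fun i => ?_) fun i => ?_
  · exact Nerve.vertex_face_zero _ i
  · exact Nerve.arrow_face_zero _ i

lemma Nerve.continuous_cons {k : ℕ} : Continuous
    fun x : {x : G₁ × G.Nerve k // G.t x.1 = x.2.first} => Nerve.cons x.1.1 x.1.2 x.2 := by
  have h1 : Continuous fun x : {x : G₁ × G.Nerve k // G.t x.1 = x.2.first} => x.1.1 :=
    continuous_fst.comp continuous_subtype_val
  have h2 : Continuous fun x : {x : G₁ × G.Nerve k // G.t x.1 = x.2.first} => x.1.2 :=
    continuous_snd.comp continuous_subtype_val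
  refine Nerve.continuous_mk (fun i => ?_) fun i => ?_
  · exact Fin.cases (G.etale_s.contMDiff.continuous.comp h1)
      (fun i => (Nerve.continuous_vertex i).comp h2) i
  · exact Fin.cases h1 (fun i => (Nerve.continuous_arrow i).comp h2) i

/-- Two cancellations: `s` of the first arrow is the first vertex, so the first arrow is a local
homeomorphism; and the first vertex of the zeroth face is `t` of that arrow. -/
lemma Nerve.isLocalHomeomorph_face_zero {k : ℕ} :
    IsLocalHomeomorph (Nerve.face 0 : G.Nerve (k + 1) → G.Nerve k) := by
  have h1 : IsLocalHomeomorph fun q : G.Nerve (k + 1) => q.arrow 0 := by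
    refine IsLocalHomeomorph.of_comp (g := G.s) ?_ G.etale_s.isLocalHomeomorph
      (Nerve.continuous_arrow 0)
    have h : (G.s ∘ fun q : G.Nerve (k + 1) => q.arrow 0) = Nerve.first :=
      funext Nerve.s_arrow_zero
    rw [h]
    exact Nerve.isLocalHomeomorph_first (k + 1)
  refine IsLocalHomeomorph.of_comp (g := Nerve.first) ?_ (Nerve.isLocalHomeomorph_first k)
    (Nerve.continuous_face 0)
  have h : Nerve.first ∘ (Nerve.face 0 : G.Nerve (k + 1) → G.Nerve k) =
      G.t ∘ fun q => q.arrow 0 := funext fun q => (Nerve.t_arrow_zero q).symm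
  rw [h]
  exact G.etale_t.isLocalHomeomorph.comp h1

/-- Along a local section the first arrow is a lift through `t` of the first vertex of the given
string, hence smooth. Its source is the coordinate that defines the manifold structure of the nerve.
-/
lemma Nerve.isSmoothEtale_face_zero [IsManifold 𝓘(ℝ, E) ∞ G₀] {k : ℕ} :
    IsSmoothEtale E (Nerve.face 0 : G.Nerve (k + 1) → G.Nerve k) where
  isLocalHomeomorph := Nerve.isLocalHomeomorph_face_zero
  contMDiff := Nerve.contMDiff_face 0
  contMDiffAt_symm e he p hp := by
    have hc := e.continuousAt_symm hp
    have h1 : ContMDiffAt 𝓘(ℝ, E) 𝓘(ℝ, E) ∞ (fun p => (e.symm p).arrow 0) p := by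
      refine contMDiffAt_of_localDiffeo G.etale_t
        ((Nerve.continuous_arrow 0).continuousAt.comp hc) ?_
      refine (Nerve.contMDiff_first k).contMDiffAt.congr_of_eventuallyEq ?_
      filter_upwards [e.comp_symm_eventuallyEq he hp] with p' hp'
      exact (Nerve.t_arrow_zero _).trans (congrArg Nerve.first hp')
    refine contMDiffAt_lift (Nerve.isLocalHomeomorph_first (k + 1)) hc ?_
    refine (G.etale_s.contMDiff.contMDiffAt.comp p h1).congr_of_eventuallyEq ?_
    exact Eventually.of_forall fun p' => (Nerve.s_arrow_zero _).symm

/-- `G_{k+1}` is the fibre product of `G₁` and `G_k` over `G₀`, and the zeroth face map is a base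
change of `t`; properness passes to base changes. -/
lemma Nerve.isProperOn_face_zero [T2Space G₀] [T2Space G₁] {A : Set G₀} (hAc : IsClosed A)
    (hA : IsProperOn G.t (G.s ⁻¹' A)) (k : ℕ) :
    IsProperOn (Nerve.face 0 : G.Nerve (k + 1) → G.Nerve k) (Nerve.first ⁻¹' A) where
  isCompact_inter_preimage K hK := by
    have hf : Continuous (Nerve.first : G.Nerve k → G₀) := Nerve.continuous_vertex 0
    have h1 := (hA.isCompact_inter_preimage _ (hK.image hf)).prod hK
    have h2 : IsClosed {x : G₁ × G.Nerve k | G.t x.1 = x.2.first} :=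
      isClosed_eq (G.etale_t.contMDiff.continuous.comp continuous_fst) (hf.comp continuous_snd)
    have h3 := h2.isClosedEmbedding_subtypeVal.isCompact_preimage h1
    refine (h3.image Nerve.continuous_cons).of_isClosed_subset ?_ ?_
    · exact (hAc.preimage (Nerve.continuous_vertex 0)).inter
        (hK.isClosed.preimage (Nerve.continuous_face 0))
    · rintro q ⟨hq, hqK⟩
      have hq0 := q.t_arrow_zero
      refine ⟨⟨(q.arrow 0, Nerve.face 0 q), hq0⟩, ⟨⟨?_, ?_⟩, hqK⟩, ?_⟩
      · change G.s (q.arrow 0) ∈ A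
        rw [q.s_arrow_zero]
        exact hq
      · exact ⟨_, hqK, hq0.symm⟩
      · exact Nerve.eq_of_face_zero (Nerve.face_zero_cons _ _ _) rfl

end EtaleGroupoid

/-! ### Fibres of the zeroth face map, the contracting homotopy and the exact columns. -/

namespace EtaleGroupoid

section Fibers

variable {E : Type*} [NormedAddCommGroup E] [NormedSpace ℝ E] {G₀ G₁ : Type u}
variable [TopologicalSpace G₀] [ChartedSpace E G₀]
variable [TopologicalSpace G₁] [ChartedSpace E G₁]
variable {G : EtaleGroupoid E G₀ G₁}

lemma m_m_inv {a b : G₁} (h : G.t a = G.s b) : G.m (G.m a b) (G.inv b) = a := by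
  rw [G.m_assoc a b _ h (G.s_inv b).symm, G.m_inv, ← h, G.m_e]

lemma m_inv_m {a b : G₁} (h : G.t a = G.t b) : G.m (G.m a (G.inv b)) b = a := by
  rw [G.m_assoc a _ b (h.trans (G.s_inv b).symm) (G.t_inv b), G.inv_m, ← h, G.m_e]

/-- Right translation by `b`, with inverse right translation by `inv b`. -/
lemma bijOn_m_right (b : G₁) :
    BijOn (fun a => G.m a b) (G.t ⁻¹' {G.s b}) (G.t ⁻¹' {G.t b}) := by
  refine ⟨fun a ha => G.t_m a b ha, fun a ha a' ha' h => ?_, fun a ha => ?_⟩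
  · rw [← m_m_inv (show G.t a = G.s b from ha), ← m_m_inv (show G.t a' = G.s b from ha')]
    exact congrArg (fun x => G.m x (G.inv b)) h
  · refine ⟨G.m a (G.inv b), ?_, m_inv_m ha⟩
    exact (G.t_m _ _ ((show G.t a = G.t b from ha).trans (G.s_inv b).symm)).trans (G.t_inv b)

lemma bijOn_arrow_zero {k : ℕ} (p : G.Nerve k) :
    BijOn (fun q : G.Nerve (k + 1) => q.arrow 0) (Nerve.face 0 ⁻¹' {p}) (G.t ⁻¹' {p.first}) := by
  refine ⟨fun q hq => ?_, fun q hq q' hq' h => ?_, fun a ha => ?_⟩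
  · exact q.t_arrow_zero.trans (congrArg Nerve.first hq)
  · exact Nerve.eq_of_face_zero (Eq.trans hq (Eq.symm hq')) h
  · exact ⟨Nerve.cons a p ha, Nerve.face_zero_cons a p ha, rfl⟩

lemma Nerve.first_face_succ {k : ℕ} (r : Fin (k + 1)) (q : G.Nerve (k + 1)) :
    (Nerve.face r.succ q).first = q.first := by
  change q.vertex (r.succ.succAbove 0) = q.vertex 0
  rw [Fin.succ_succAbove_zero]

lemma Nerve.face_zero_face_succ {k : ℕ} (r : Fin (k + 2)) (q : G.Nerve (k + 2)) :
    Nerve.face 0 (Nerve.face r.succ q) = Nerve.face r (Nerve.face 0 q) :=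
  Nerve.face_face (Fin.zero_le r) q

lemma Nerve.arrow_zero_face_one {k : ℕ} (q : G.Nerve (k + 2)) :
    (Nerve.face (Fin.succ 0) q).arrow 0 = G.m (q.arrow 0) ((Nerve.face 0 q).arrow 0) := by
  rw [Nerve.arrow_face_zero]
  change Nerve.faceArrow (Fin.succ 0) q 0 = _
  unfold Nerve.faceArrow
  rw [if_neg (by simp), if_pos (by simp)]
  rfl

lemma Nerve.arrow_zero_face_succ_succ {k : ℕ} (r : Fin (k + 1)) (q : G.Nerve (k + 2)) :
    (Nerve.face r.succ.succ q).arrow 0 = q.arrow 0 := by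
  change Nerve.faceArrow r.succ.succ q 0 = _
  unfold Nerve.faceArrow
  rw [if_pos (by simp)]
  rfl

/-- Fibres of the zeroth face map are parametrized by the first arrow. The face `r + 1`
right-translates this arrow by the first arrow of `p` if `r = 0` and keeps it otherwise, hence is
bijective on fibres. This makes summation over fibres compatible with face maps. -/
lemma bijOn_face_succ {k : ℕ} (r : Fin (k + 2)) (p : G.Nerve (k + 1)) :
    BijOn (fun q : G.Nerve (k + 2) => Nerve.face r.succ q) (Nerve.face 0 ⁻¹' {p})
      (Nerve.face 0 ⁻¹' {Nerve.face r p}) := by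
  have hmem : ∀ q : G.Nerve (k + 2), Nerve.face 0 q = p →
      Nerve.face 0 (Nerve.face r.succ q) = Nerve.face r p := fun q hq => by
    rw [Nerve.face_zero_face_succ, hq]
  refine ⟨hmem, fun q hq q' hq' h => ?_, fun q' hq' => ?_⟩
  · have hq : Nerve.face 0 q = p := hq
    have hq' : Nerve.face 0 q' = p := hq'
    refine (bijOn_arrow_zero p).injOn.eq_iff hq hq' |>.1 ?_
    have h' : Nerve.face r.succ q = Nerve.face r.succ q' := h
    refine Fin.cases (motive := fun r => Nerve.face r.succ q = Nerve.face r.succ q' →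
      q.arrow 0 = q'.arrow 0) (fun h' => ?_) (fun r h' => ?_) r h'
    · have h1 := congrArg (fun x => Nerve.arrow x 0) h'
      simp only [Nerve.arrow_zero_face_one, hq, hq'] at h1
      refine (bijOn_m_right (p.arrow 0)).injOn ?_ ?_ h1
      · exact q.t_arrow_zero.trans ((congrArg Nerve.first hq).trans p.s_arrow_zero.symm)
      · exact q'.t_arrow_zero.trans ((congrArg Nerve.first hq').trans p.s_arrow_zero.symm)
    · rw [← Nerve.arrow_zero_face_succ_succ r q, h', Nerve.arrow_zero_face_succ_succ]
  · have hq' : Nerve.face 0 q' = Nerve.face r p := hq'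
    have ht : G.t (q'.arrow 0) = (Nerve.face r p).first :=
      q'.t_arrow_zero.trans (congrArg Nerve.first hq')
    suffices h : ∃ a, G.t a = p.first ∧ ∀ q : G.Nerve (k + 2), Nerve.face 0 q = p →
        q.arrow 0 = a → (Nerve.face r.succ q).arrow 0 = q'.arrow 0 by
      obtain ⟨a, ha, h⟩ := h
      have h0 := Nerve.face_zero_cons a p ha
      refine ⟨Nerve.cons a p ha, h0, ?_⟩
      exact Nerve.eq_of_face_zero ((hmem _ h0).trans hq'.symm) (h _ h0 rfl)
    clear hmem hq'
    refine Fin.cases (motive := fun r => G.t (q'.arrow 0) = (Nerve.face r p).first → ∃ a,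
      G.t a = p.first ∧ ∀ q : G.Nerve (k + 2), Nerve.face 0 q = p → q.arrow 0 = a →
        (Nerve.face r.succ q).arrow 0 = q'.arrow 0) (fun ht => ?_) (fun r ht => ?_) r ht
    · obtain ⟨a, ha, h⟩ := (bijOn_m_right (p.arrow 0)).surjOn
        (show q'.arrow 0 ∈ _ from ht.trans p.t_arrow_zero.symm)
      refine ⟨a, Eq.trans ha p.s_arrow_zero, fun q hq hqa => ?_⟩
      rw [Nerve.arrow_zero_face_one, hq, hqa]
      exact h
    · refine ⟨q'.arrow 0, ht.trans (Nerve.first_face_succ r p), fun q _ hqa => ?_⟩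
      rw [Nerve.arrow_zero_face_succ_succ, hqa]

/-- A cutoff function of a groupoid, supported in `A`. -/
structure IsCutoff (G : EtaleGroupoid E G₀ G₁) (c : G₀ → ℝ) (A : Set G₀) : Prop where
  contMDiff : ContMDiff 𝓘(ℝ, E) 𝓘(ℝ, ℝ) ∞ c
  isClosed : IsClosed A
  eq_zero : ∀ x ∉ A, c x = 0
  isProperOn : IsProperOn G.t (G.s ⁻¹' A)
  sum_eq_one : ∀ x, fiberSum G.t (fun a => c (G.s a)) x = 1

lemma IsCutoff.fiberSum_face_zero {c : G₀ → ℝ} {A : Set G₀} (hc : G.IsCutoff c A) {k : ℕ}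
    (p : G.Nerve k) :
    fiberSum (Nerve.face 0 : G.Nerve (k + 1) → G.Nerve k) (fun q => c q.first) p = 1 := by
  rw [← hc.sum_eq_one p.first]
  refine finsum_mem_eq_of_bijOn _ (bijOn_arrow_zero p) fun q _ => ?_
  rw [q.s_arrow_zero]

end Fibers

section Pullbacks

variable {E : Type} [NormedAddCommGroup E] [NormedSpace ℝ E] {G₀ G₁ : Type u}
variable [TopologicalSpace G₀] [ChartedSpace E G₀] [IsManifold 𝓘(ℝ, E) ∞ G₀]
variable [TopologicalSpace G₁] [ChartedSpace E G₁]
variable {G : EtaleGroupoid E G₀ G₁}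

/-- The alternating sum of the pullbacks of forms, at a point. -/
lemma altSum_pullback_apply {j k : ℕ} (β : DiffForm E (G.Nerve k) j) (p : G.Nerve (k + 1)) :
    (altSum (fun r : Fin (k + 2) => DiffForm.pullback (G.smoothFace k r) j) β).1 p =
      ∑ r : Fin (k + 2), (-1 : ℤ) ^ (r : ℕ) • RawForm.pullback (Nerve.face r) β.1 p := by
  let ev : DiffForm E (G.Nerve (k + 1)) j →+ E [⋀^Fin j]→L[ℝ] ℝ :=
    { toFun := fun α => α.1 p, map_zero' := rfl, map_add' := fun _ _ => rfl }
  rw [altSum_apply]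
  change ev _ = _
  rw [map_sum]
  refine Finset.sum_congr rfl fun r _ => ?_
  rw [map_zsmul]
  rfl

/-- The chain rule for the simplicial identity, solved for the inverse differentials of the zeroth
faces. -/
lemma dmap_face_succ_comp_inverse {k : ℕ} (r : Fin (k + 2)) (q : G.Nerve (k + 2)) :
    (dmap E (Nerve.face r.succ) q).comp (dmap E (Nerve.face 0) q).inverse =
      (dmap E (Nerve.face 0) (Nerve.face r.succ q)).inverse.comp
        (dmap E (Nerve.face r) (Nerve.face 0 q)) := by
  have h1 : (dmap E (Nerve.face 0) (Nerve.face r.succ q)).comp (dmap E (Nerve.face r.succ) q) =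
      (dmap E (Nerve.face r) (Nerve.face 0 q)).comp (dmap E (Nerve.face 0) q) := by
    rw [← dmap_comp (Nerve.contMDiff_face 0).contMDiffAt
        (Nerve.contMDiff_face r.succ).contMDiffAt,
      ← dmap_comp (Nerve.contMDiff_face r).contMDiffAt (Nerve.contMDiff_face 0).contMDiffAt,
      show Nerve.face 0 ∘ Nerve.face r.succ = Nerve.face r ∘ (Nerve.face 0 : G.Nerve (k + 2) → _)
        from funext (Nerve.face_zero_face_succ r)]
  have h2 := (Nerve.isSmoothEtale_face_zero (E := E)).dmap_isInvertible q
  have h3 := (Nerve.isSmoothEtale_face_zero (E := E)).dmap_isInvertible (Nerve.face r.succ q)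
  calc _ = ((dmap E (Nerve.face 0) (Nerve.face r.succ q)).inverse.comp
        (dmap E (Nerve.face 0) (Nerve.face r.succ q))).comp
        ((dmap E (Nerve.face r.succ) q).comp (dmap E (Nerve.face 0) q).inverse) := by
        rw [h3.2, ContinuousLinearMap.id_comp]
    _ = (dmap E (Nerve.face 0) (Nerve.face r.succ q)).inverse.comp
        (((dmap E (Nerve.face 0) (Nerve.face r.succ q)).comp
        (dmap E (Nerve.face r.succ) q)).comp (dmap E (Nerve.face 0) q).inverse) := rfl
    _ = (dmap E (Nerve.face 0) (Nerve.face r.succ q)).inverse.comp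
        ((dmap E (Nerve.face r) (Nerve.face 0 q)).comp
        ((dmap E (Nerve.face 0) q).comp (dmap E (Nerve.face 0) q).inverse)) := by
        rw [h1]
        rfl
    _ = _ := by rw [h2.1, ContinuousLinearMap.comp_id]

/-- The contracting homotopy given by a cutoff function. -/
lemma IsCutoff.pullback_pushforward [T2Space G₀] [T2Space G₁] {c : G₀ → ℝ} {A : Set G₀} (hc : G.IsCutoff c A) {j k : ℕ}
    (α : RawForm E (G.Nerve (k + 1)) j) (r : Fin (k + 2)) (p : G.Nerve (k + 1)) :
    RawForm.pullback (Nerve.face r)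
        (RawForm.pushforward (Nerve.face 0) (fun q => c q.first) α) p =
      fiberSum (Nerve.face 0 : G.Nerve (k + 2) → G.Nerve (k + 1)) (fun q => c q.first •
        (α (Nerve.face r.succ q)).compContinuousLinearMap ((dmap E (Nerve.face r.succ) q).comp
          (dmap E (Nerve.face 0) q).inverse)) p := by
  have hz : ∀ {m : ℕ} (q : G.Nerve m), q ∉ Nerve.first ⁻¹' A → c q.first = 0 :=
    fun q hq => hc.eq_zero _ hq
  have hA := Nerve.isProperOn_face_zero hc.isClosed hc.isProperOn
  have hfin := (hA k).fiberSum_eq_sum_fiber Nerve.isLocalHomeomorph_face_zero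
    (F := fun q => c q.first • (α q).compContinuousLinearMap (dmap E (Nerve.face 0) q).inverse)
    (fun q hq => by rw [hz q hq, zero_smul]) (Nerve.face r p)
  unfold RawForm.pullback RawForm.pushforward
  rw [hfin]
  have hmap := map_sum (ContinuousAlternatingMap.compContinuousLinearMapCLM (F := ℝ) (ι := Fin j)
    (dmap E (Nerve.face r) p)) (fun q : G.Nerve (k + 1) => c q.first •
      (α q).compContinuousLinearMap (dmap E (Nerve.face 0) q).inverse)
    ((hA k).finite_fiber Nerve.isLocalHomeomorph_face_zero (Nerve.face r p)).toFinset
  refine hmap.trans ?_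
  rw [(hA (k + 1)).fiberSum_eq_sum_fiber Nerve.isLocalHomeomorph_face_zero
    (fun q hq => by rw [hz q hq, zero_smul]) p]
  -- The two finite sums are matched by the bijection of fibres; the weights agree because a face of
  -- positive index keeps the first vertex.
  have hb := bijOn_face_succ r p
  refine (Finset.sum_nbij (fun q => Nerve.face r.succ q) (fun q hq => ?_) ?_ ?_ ?_).symm
  · have hq := (Finite.mem_toFinset _).1 hq
    refine (Finite.mem_toFinset _).2 ⟨?_, hb.mapsTo hq.2⟩
    rw [mem_preimage, Nerve.first_face_succ]
    exact hq.1
  · exact hb.injOn.mono fun q hq => ((Finite.mem_toFinset _).1 hq).2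
  · intro q' hq'
    have hq' := (Finite.mem_toFinset _).1 hq'
    obtain ⟨q, hq, rfl⟩ := hb.surjOn hq'.2
    refine ⟨q, (Finite.mem_toFinset _).2 ⟨?_, hq⟩, rfl⟩
    have h : (Nerve.face r.succ q).first ∈ A := hq'.1
    rwa [Nerve.first_face_succ] at h
  · intro q hq
    have hq : Nerve.face 0 q = p := ((Finite.mem_toFinset _).1 hq).2
    rw [Nerve.first_face_succ, dmap_face_succ_comp_inverse, hq]
    rfl

end Pullbacks

section Cutoff

variable {E : Type} [NormedAddCommGroup E] [NormedSpace ℝ E] [FiniteDimensional ℝ E]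
variable {G₀ G₁ : Type u} [TopologicalSpace G₀] [ChartedSpace E G₀] [T2Space G₀]
variable [IsManifold 𝓘(ℝ, E) ∞ G₀] [TopologicalSpace G₁] [ChartedSpace E G₁] [T2Space G₁]
variable {G : EtaleGroupoid E G₀ G₁}

/-- The sum `σ` of `c ∘ s` over the arrows into a point is smooth, positive and, by right
translation, constant on orbits. Dividing `c` by `σ` therefore makes all these sums `1`. -/
lemma IsProper.exists_isCutoff (h : G.IsProper) (horbit : ParacompactSpace G.OrbitSpace) :
    ∃ c A, G.IsCutoff c A := by
  obtain ⟨c, hc, hc0, hpos, hK⟩ := h.exists_cutoff horbit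
  have : LocallyCompactSpace G₀ := ChartedSpace.locallyCompactSpace E G₀
  have hA : IsProperOn G.t (G.s ⁻¹' tsupport c) :=
    ⟨fun K hcK => by
      rw [inter_comm]
      exact hK K hcK⟩
  have hz : ∀ x ∉ tsupport c, c x = 0 := fun x hx => image_eq_zero_of_notMem_tsupport hx
  have hsz : ∀ a ∉ G.s ⁻¹' tsupport c, c (G.s a) = 0 := fun a ha => hz _ ha
  let σ : G₀ → ℝ := fiberSum G.t fun a => c (G.s a)
  have hσ : ContMDiff 𝓘(ℝ, E) 𝓘(ℝ, ℝ) ∞ σ := contMDiff_fiberSum G.etale_t.isSmoothEtale hA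
    (hc.comp G.etale_s.contMDiff) hsz
  have hσpos : ∀ x, 0 < σ x := by
    intro x
    obtain ⟨a, rfl, ha⟩ := hpos x
    refine lt_of_lt_of_eq ?_
      (hA.fiberSum_eq_sum_fiber G.etale_t.isLocalHomeomorph hsz (G.t a)).symm
    refine Finset.sum_pos' (fun b _ => hc0 _) ⟨a, ?_, ha⟩
    exact (Finite.mem_toFinset _).2 ⟨subset_tsupport _ ha.ne', rfl⟩
  have hinv : ∀ b, σ (G.s b) = σ (G.t b) := by
    intro b
    refine finsum_mem_eq_of_bijOn _ (bijOn_m_right b) fun a ha => ?_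
    rw [G.s_m a b ha]
  refine ⟨fun x => c x * (σ x)⁻¹, tsupport c, ⟨?_, isClosed_tsupport c, fun x hx => ?_, hA, ?_⟩⟩
  · exact hc.mul (hσ.inv₀ fun x => (hσpos x).ne')
  · rw [hz x hx, zero_mul]
  · intro x
    have h1 := hA.fiberSum_eq_sum_fiber G.etale_t.isLocalHomeomorph
      (F := fun a => c (G.s a) * (σ (G.s a))⁻¹) (fun a ha => by rw [hsz a ha, zero_mul]) x
    rw [h1]
    have h2 : ∀ a ∈ (hA.finite_fiber G.etale_t.isLocalHomeomorph x).toFinset,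
        c (G.s a) * (σ (G.s a))⁻¹ = c (G.s a) * (σ x)⁻¹ := by
      intro a ha
      have ha2 : G.t a = x := ((Finite.mem_toFinset _).1 ha).2
      rw [hinv a, ha2]
    rw [Finset.sum_congr rfl h2, ← Finset.sum_mul,
      ← hA.fiberSum_eq_sum_fiber G.etale_t.isLocalHomeomorph hsz x]
    exact mul_inv_cancel₀ (hσpos x).ne'

/-- The Čech complex of the sheaf of forms of degree `j` on a proper groupoid with paracompact
orbit space is exact in positive degrees. -/
theorem exists_altSum_pullback_eq (hproper : G.IsProper)
    (horbit : ParacompactSpace G.OrbitSpace) {j k : ℕ} {α : DiffForm E (G.Nerve (k + 1)) j}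
    (h : altSum (fun r : Fin (k + 3) => DiffForm.pullback (G.smoothFace (k + 1) r) j) α = 0) :
    ∃ β, altSum (fun r : Fin (k + 2) => DiffForm.pullback (G.smoothFace k r) j) β = α := by
  obtain ⟨c, A, hc⟩ := hproper.exists_isCutoff horbit
  have : LocallyCompactSpace G₀ := ChartedSpace.locallyCompactSpace E G₀
  have hlc : ∀ m, LocallyCompactSpace (G.Nerve m) := fun m =>
    ChartedSpace.locallyCompactSpace E (G.Nerve m)
  have hz : ∀ {m : ℕ} (q : G.Nerve m), q ∉ Nerve.first ⁻¹' A → c q.first = 0 :=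
    fun q hq => hc.eq_zero _ hq
  have hA := Nerve.isProperOn_face_zero hc.isClosed hc.isProperOn
  -- The primitive at `p` is the `c`-weighted average of `α` over all strings whose zeroth face is
  -- `p`, transported by the inverse differential.
  have hsm : (RawForm.pushforward (Nerve.face 0 : G.Nerve (k + 1) → G.Nerve k)
      (fun q => c q.first) α.1).IsSmooth :=
    RawForm.IsSmooth.pushforward Nerve.isSmoothEtale_face_zero (hA k)
      (hc.contMDiff.comp (Nerve.contMDiff_first (k + 1))) hz α.smooth
  refine ⟨⟨_, hsm⟩, Subtype.ext (funext fun p => ?_)⟩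
  rw [altSum_pullback_apply]
  simp only [hc.pullback_pushforward]
  have hπ : IsLocalHomeomorph (Nerve.face 0 : G.Nerve (k + 2) → G.Nerve (k + 1)) :=
    Nerve.isLocalHomeomorph_face_zero
  set T := ((hA (k + 1)).finite_fiber hπ p).toFinset with hT
  let γ : Fin (k + 2) → G.Nerve (k + 2) → E [⋀^Fin j]→L[ℝ] ℝ := fun r q =>
    (α.1 (Nerve.face r.succ q)).compContinuousLinearMap
      ((dmap E (Nerve.face r.succ) q).comp (dmap E (Nerve.face 0) q).inverse)
  have h1 : ∀ r : Fin (k + 2), fiberSum (Nerve.face 0 : G.Nerve (k + 2) → G.Nerve (k + 1))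
      (fun q => c q.first • γ r q) p = ∑ q ∈ T, c q.first • γ r q := fun r =>
    (hA (k + 1)).fiberSum_eq_sum_fiber hπ (fun q hq => by rw [hz q hq, zero_smul]) p
  have h2 : ∑ q ∈ T, c q.first = 1 := by
    rw [← hc.fiberSum_face_zero p]
    exact ((hA (k + 1)).fiberSum_eq_sum_fiber hπ hz p).symm
  -- The cocycle condition at `q`, solved for its zeroth term. Each prolongation `q` of `p` thus
  -- yields `α` at `p`, and averaging with total weight `1` gives `α` again.
  have h3 : ∀ q ∈ T, ∑ r : Fin (k + 2), (-1 : ℤ) ^ (r : ℕ) • γ r q = α.1 p := by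
    intro q hq
    have hqp : Nerve.face 0 q = p := ((Finite.mem_toFinset _).1 hq).2
    have h4 := altSum_pullback_apply α q
    rw [h, Fin.sum_univ_succ] at h4
    have h5 := congrArg (ContinuousAlternatingMap.compContinuousLinearMapCLM (F := ℝ)
      (ι := Fin j) (dmap E (Nerve.face 0) q).inverse) h4
    rw [map_add, map_sum] at h5
    have h6 : ContinuousAlternatingMap.compContinuousLinearMapCLM (F := ℝ) (ι := Fin j)
        (dmap E (Nerve.face 0) q).inverse ((-1 : ℤ) ^ ((0 : Fin (k + 3)) : ℕ) •
          RawForm.pullback (Nerve.face 0) α.1 q) = α.1 p := by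
      rw [Fin.val_zero, pow_zero, one_smul, ← hqp]
      change (α.1 (Nerve.face 0 q)).compContinuousLinearMap ((dmap E (Nerve.face 0) q).comp
        (dmap E (Nerve.face 0) q).inverse) = _
      rw [(Nerve.isSmoothEtale_face_zero.dmap_isInvertible q).1]
      rfl
    rw [h6] at h5
    have h7 : ∀ r : Fin (k + 2), ContinuousAlternatingMap.compContinuousLinearMapCLM (F := ℝ)
        (ι := Fin j) (dmap E (Nerve.face 0) q).inverse ((-1 : ℤ) ^ ((r.succ : Fin (k + 3)) : ℕ) •
          RawForm.pullback (Nerve.face r.succ) α.1 q) = -((-1 : ℤ) ^ (r : ℕ) • γ r q) := by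
      intro r
      rw [map_zsmul, Fin.val_succ, pow_succ, mul_neg_one, neg_smul]
      rfl
    simp only [h7, Finset.sum_neg_distrib] at h5
    refine (eq_of_sub_eq_zero ?_).symm
    rw [sub_eq_add_neg, ← h5]
    exact map_zero _
  calc ∑ r : Fin (k + 2), (-1 : ℤ) ^ (r : ℕ) • fiberSum (Nerve.face 0)
        (fun q => c q.first • γ r q) p
      = ∑ r : Fin (k + 2), (-1 : ℤ) ^ (r : ℕ) • ∑ q ∈ T, c q.first • γ r q := by simp only [h1]
    _ = ∑ q ∈ T, c q.first • ∑ r : Fin (k + 2), (-1 : ℤ) ^ (r : ℕ) • γ r q := by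
      simp only [Finset.smul_sum]
      rw [Finset.sum_comm]
      refine Finset.sum_congr rfl fun q _ => Finset.sum_congr rfl fun r _ => smul_comm _ _ _
    _ = α.1 p := by
      rw [Finset.sum_congr rfl fun q hq => congrArg (c q.first • ·) (h3 q hq),
        ← Finset.sum_smul, h2, one_smul]

end Cutoff

end EtaleGroupoid

/-! ### The comparison theorems for the groupoid. -/

namespace EtaleGroupoid

variable {E : Type} [NormedAddCommGroup E] [NormedSpace ℝ E] {G₀ G₁ : Type u}
variable [TopologicalSpace G₀] [ChartedSpace E G₀] [IsManifold 𝓘(ℝ, E) ∞ G₀]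
variable [TopologicalSpace G₁] [ChartedSpace E G₁]
variable (G : EtaleGroupoid E G₀ G₁)

/-- The Čech complex of smooth functions. -/
def cechFunCpx : CochainCpx.{u} where
  X k := DiffForm E (G.Nerve k) 0
  d k := G.cechFun k
  d_d k x := G.zDouble.δ_δ k 1 x

/-- The homomorphism of the inclusion of the locally constant functions with values in `U(1)`. -/
def ofConstHom (k : ℕ) : (G.cechConst (Additive Circle)).X k →+ G.uDouble.X k 0 where
  toFun z := (SmoothU1.ofConst z : SmoothU1 E (G.Nerve k))
  map_zero' := rfl
  map_add' _ _ := rfl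

/-- The inclusion of the locally constant integer valued functions in the smooth functions. -/
def ofIntHom (k : ℕ) : (G.cechConst ℤ).X k →+ G.cechFunCpx.X k :=
  (DiffForm.ofInt : LocallyConstant (G.Nerve k) ℤ →+ DiffForm E (G.Nerve k) 0)

/-- The exponential map on Čech cochains. -/
def expHom (k : ℕ) : G.cechFunCpx.X k →+ G.cechSmoothU1.X k :=
  (expU1 : DiffForm E (G.Nerve k) 0 →+ SmoothU1 E (G.Nerve k))

lemma ofIntHom_d (k : ℕ) (x : (G.cechConst ℤ).X k) :
    G.ofIntHom (k + 1) ((G.cechConst ℤ).d k x) = G.cechFunCpx.d k (G.ofIntHom k x) :=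
  map_altSum _ _ (G.ofIntHom k) (G.ofIntHom (k + 1))
    (fun _ z => (DiffForm.ofInt_pullback _ z).symm) x

lemma expHom_d (k : ℕ) (x : G.cechFunCpx.X k) :
    G.expHom (k + 1) (G.cechFunCpx.d k x) = G.cechSmoothU1.d k (G.expHom k x) :=
  map_altSum _ _ (G.expHom k) (G.expHom (k + 1)) (fun _ f => expU1_pullback _ f) x

variable {G}

/-- The Poincaré lemma enters only through the surjectivity of the exponential map; on forms of
positive degree, multiplication by `2π` is bijective. -/
lemma exists_equiv_expMap (hP : ∀ k, HasPoincareLemma E (G.Nerve k)) {n : ℕ} (hn : 1 ≤ n)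
    (k : ℕ) :
    ∃ e : (G.cechZ n).H (k + 1) ≃+ (G.cechU n).H k, CochainCpx.Induces (G.expMap n k) e := by
  refine DoubleCpx.exists_equiv_shiftMap (A := G.zDouble) (B := G.uDouble)
    (fun i j => ZCol.toUCol j) (fun i j x => ?_) (fun i j x => ?_)
    (fun i x => expU1_ofInt x) (fun i j => ?_)
    (fun i x => expU1_eq_zero_iff.1) (fun i j => DiffForm.scale_two_pi_injective)
    (fun i => DiffForm.ofInt_injective) hn k
  · refine map_altSum _ _ _ _ (fun r x => ?_) x
    match j, x with
    | 0, x => exact expU1_pullback _ x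
    | j + 1, x => rfl
  · match j, x with
    | 0, x => exact (dlog_expU1 x).symm
    | j + 1, x => exact (DiffForm.d_scale _ x).symm
  · match j with
    | 0 => exact (hP i).expU1_surjective
    | j + 1 => exact fun α => ⟨_, DiffForm.scale_two_pi_cancel α⟩

lemma exists_equiv_inclConst (hP : ∀ k, HasPoincareLemma E (G.Nerve k)) {n k : ℕ}
    (hk : k + 1 < n) : ∃ e : (G.cechConst (Additive Circle)).H k ≃+ (G.cechU n).H k,
      CochainCpx.Induces (G.inclConst n k) e := by
  refine DoubleCpx.exists_equiv_ofFirstColumn (A := G.uDouble) hk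
    (G.cechConst (Additive Circle)) G.ofConstHom (fun m x => ?_)
    (fun m => SmoothU1.ofConst_injective) (fun m x => dlog_ofConst x)
    (fun m x => exists_ofConst_of_dlog_eq_zero) (fun i j hj x hx => ?_)
  · exact map_altSum _ _ (G.ofConstHom m) (G.ofConstHom (m + 1)) (fun r x => rfl) x
  · match j, x, hx with
    | 0, x, hx =>
      obtain ⟨f, hf⟩ := (hP i).exists_dlog_eq hx
      exact ⟨_, hf⟩
    | j + 1, x, hx => exact hP i (j + 1) x hx

/-- Global logarithms make `ℤ → A^0 → U(1)` short exact on sections over each `G_k`, and `hF` is the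
acyclicity of the middle term. -/
lemma exists_equiv_exponential (hP : ∀ k, HasPoincareLemma E (G.Nerve k))
    (hF : ∀ k (f : DiffForm E (G.Nerve (k + 1)) 0), G.cechFun (k + 1) f = 0 →
      ∃ g, G.cechFun k g = f) {k : ℕ} (hk : 1 ≤ k) :
    ∃ e : G.cechSmoothU1.H k ≃+ (G.cechConst ℤ).H (k + 1),
      ∀ (f : DiffForm E (G.Nerve k) 0) (z : LocallyConstant (G.Nerve (k + 1)) ℤ),
        G.cechFun k f = DiffForm.ofInt z →
        ∃ (hf : G.cechSmoothU1.d k (expU1 f : SmoothU1 E (G.Nerve k)) = 0)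
          (hz : (G.cechConst ℤ).d (k + 1) z = 0),
          e (G.cechSmoothU1.cls (expU1 f : SmoothU1 E (G.Nerve k)) hf) =
            (G.cechConst ℤ).cls z hz :=
  CochainCpx.exists_connecting_equiv G.ofIntHom G.expHom G.ofIntHom_d G.expHom_d
    (fun _ => DiffForm.ofInt_injective) (fun k => (hP k).expU1_surjective)
    (fun _ x => expU1_ofInt x) (fun _ _ => expU1_eq_zero_iff.1) hF hk

end EtaleGroupoid

end

theorem mainTheorem8 {E : Type} [NormedAddCommGroup E] [NormedSpace ℝ E] [FiniteDimensional ℝ E]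
    {G₀ G₁ : Type u}
    [TopologicalSpace G₀] [T2Space G₀] [ParacompactSpace G₀] [ChartedSpace E G₀]
    [IsManifold 𝓘(ℝ, E) ∞ G₀]
    [TopologicalSpace G₁] [T2Space G₁] [ParacompactSpace G₁] [ChartedSpace E G₁]
    [IsManifold 𝓘(ℝ, E) ∞ G₁]
    (G : EtaleGroupoid E G₀ G₁) (hproper : G.IsProper) (hleray : G.IsLeray)
    (horbit : ParacompactSpace G.OrbitSpace) (n : ℕ) (hn : 1 ≤ n) :
    Subsingleton ((G.cechZ n).H 0) ∧
    ∀ k : ℕ,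
      (∃ e : (G.cechZ n).H (k + 1) ≃+ (G.cechU n).H k, CochainCpx.Induces (G.expMap n k) e) ∧
      (n < k + 1 →
        (∃ e : (G.cechU n).H k ≃+ G.cechSmoothU1.H k, CochainCpx.Induces (G.projU1 hn k) e) ∧
        (∃ e : G.cechSmoothU1.H k ≃+ (G.cechConst ℤ).H (k + 1),
          ∀ (f : DiffForm E (G.Nerve k) 0) (z : LocallyConstant (G.Nerve (k + 1)) ℤ),
            G.cechFun k f = DiffForm.ofInt z →
            ∃ (hf : G.cechSmoothU1.d k (expU1 f : SmoothU1 E (G.Nerve k)) = 0)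
              (hz : (G.cechConst ℤ).d (k + 1) z = 0),
              e (G.cechSmoothU1.cls (expU1 f : SmoothU1 E (G.Nerve k)) hf) =
                (G.cechConst ℤ).cls z hz)) ∧
      (k + 1 < n →
        ∃ e : (G.cechConst (Additive Circle)).H k ≃+ (G.cechU n).H k,
          CochainCpx.Induces (G.inclConst n k) e) := by
  -- The degree `p ≥ 1` is `k + 1` throughout, and `p = 0` is the separate first claim, where the
  -- two columns `ℤ` and `A^0` exist because `1 ≤ n`.
  have hP := hleray.hasPoincareLemma
  refine ⟨DoubleCpx.subsingleton_H_zero (A := G.zDouble) (by omega) DiffForm.ofInt_injective,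
    fun k => ⟨EtaleGroupoid.exists_equiv_expMap hP hn k, fun hk => ⟨?_, ?_⟩,
      fun hk => EtaleGroupoid.exists_equiv_inclConst hP hk⟩⟩
  · exact DoubleCpx.exists_equiv_toFirstColumn (A := G.uDouble) hn (by omega)
      fun i j _ x hx => EtaleGroupoid.exists_altSum_pullback_eq hproper horbit hx
  · exact EtaleGroupoid.exists_equiv_exponential hP
      (fun i f hf => EtaleGroupoid.exists_altSum_pullback_eq hproper horbit hf) (by omega)
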